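/- **Conventions.** Let $G$ be a discrete group. A *\*-algebraic bundle* over $G$ is a family $\mathcal A=(A_t)_{t\in G}$ of complex vector spaces with an associative product whose restrictions $A_s\times A_t\to A_{st}$ are bilinear, and an involution whose restrictions $A_t\to A_{t^{-1}}$ are conjugate linear, with $(ab)^*=b^*a^*$ and $a^{**}=a$. A *C\*-norm* on $\mathcal A$ is a norm on each $A_t$ such that $\|ab\|\le\|a\|\,\|b\|$, $\|a^*a\|=\|a\|^2$, and $a^*a\ge 0$ in the completion of the pre-C\*-algebra $A_e$. A *Fell bundle* is a \*-algebraic bundle with a C\*-norm for which all the fibers are complete. For a Fell bundle $\mathcal A$, $C_c(\mathcal A)$ is the convolution \*-algebra of finitely supported sections, and $\delta_a\in C_c(\mathcal A)$ is the section with the value $a\in A_t$ at $t$ and $0$ elsewhere. $C^*(\mathcal A)$ is the enveloping C\*-algebra of $C_c(\mathcal A)$. $\ell^2(\mathcal A)$ is the Hilbert $A_e$-module that is the completion of $C_c(\mathcal A)$ for $\langle f,g\rangle=\sum_t f(t)^*g(t)$. The left regular representation $\Lambda$ of $C_c(\mathcal A)$ by adjointable operators on $\ell^2(\mathcal A)$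 is given by left convolution, so that $(\Lambda(\delta_b)\xi)(s)=b\,\xi(t^{-1}s)$ for $b\in A_t$. $C^*_r(\mathcal A)\subseteq\mathcal L(\ell^2(\mathcal A))$ is the C\*-algebra generated by the operators $\Lambda(\delta_b)$. Write $\Lambda_{\mathcal A}\colon C^*(\mathcal A)\to C^*_r(\mathcal A)$ for the \*-homomorphism that extends the left regular representation. For Fell bundles $\mathcal A=(A_t)_{t\in G}$ and $\mathcal B=(B_s)_{s\in H}$ over discrete groups, $\mathcal A\odot\mathcal B$ is the \*-algebraic bundle over $G\times H$ with the fibers $A_t\odot B_s$ (algebraic tensor products), the product $(a\otimes b)(a'\otimes b')=aa'\otimes bb'$ and the involution $(a\otimes b)^*=a^*\otimes b^*$. For a C\*-norm $\alpha$ on $\mathcal A\odot\mathcal B$, $\mathcal A\otimes_\alpha\mathcal B$ is the Fell bundle obtained by completing the fibers. $\ell^2(\mathcal A)\otimes_\alpha\ell^2(\mathcal B)$ is the Hilbert $A_e\otimes_\alpha B_e$-module that is the completion of $\ell^2(\mathcal A)\odot\ell^2(\mathcal B)$ for $\langle\xi\otimes\eta,\xi'\otimes\eta'\rangle=\langle\xi,\xi'\rangle\otimes\langle\eta,\eta'\rangle$,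 and $C^*_r(\mathcal A)\otimes_{\hat\alpha}C^*_r(\mathcal B)$ is the closed \*-subalgebra of $\mathcal L(\ell^2(\mathcal A)\otimes_\alpha\ell^2(\mathcal B))$ generated by the operators $T\otimes S$ with $T\in C^*_r(\mathcal A)$, $S\in C^*_r(\mathcal B)$. **Theorem.** Let $\mathcal A=(A_t)_{t\in G}$ and $\mathcal B=(B_s)_{s\in H}$ be Fell bundles over discrete groups $G$ and $H$. There is a C\*-norm $\max$ on $\mathcal A\odot\mathcal B$ whose restriction to $A_e\odot B_e$ is the maximal C\*-norm of $A_e\odot B_e$. For every C\*-norm $\alpha$ on $\mathcal A\odot\mathcal B$ there is a commutative diagram of \*-homomorphisms $$D_\alpha:\qquad\begin{array}{ccccc} C^*(\mathcal A\otimes_{\max}\mathcal B)&\xrightarrow{\ \Theta_\alpha\ }&C^*(\mathcal A\otimes_\alpha\mathcal B)&\xrightarrow{\ \Lambda_\alpha\ }&C^*_r(\mathcal A\otimes_\alpha\mathcal B)\\ {\scriptstyle\Phi}\downarrow\cong&&&&\cong\uparrow{\scriptstyle\Psi}\\ C^*(\mathcal A)\otimes_{\max}C^*(\mathcal B)&&\xrightarrow{\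 \Lambda_{\mathcal A}\otimes\Lambda_{\mathcal B}\ }&&C^*_r(\mathcal A)\otimes_{\hat\alpha}C^*_r(\mathcal B) \end{array}$$ that is, $\Lambda_\alpha\circ\Theta_\alpha=\Psi\circ(\Lambda_{\mathcal A}\otimes\Lambda_{\mathcal B})\circ\Phi$, where * $\Theta_\alpha$ is surjective and is the identity on $C_c(\mathcal A\odot\mathcal B)$: $\Theta_\alpha(\delta_x)=\delta_x$ for $x\in A_t\odot B_s$, $(t,s)\in G\times H$; * $\Lambda_\alpha$ is the left regular representation of $\mathcal A\otimes_\alpha\mathcal B$, and is surjective; * $\Phi$ is a \*-isomorphism with $\Phi(\delta_{a\otimes b})=\delta_a\otimes\delta_b$ for $a\in A_t$, $b\in B_s$; * $\Lambda_{\mathcal A}$ and $\Lambda_{\mathcal B}$ are the left regular representations of $\mathcal A$ and $\mathcal B$ and are surjective, and $\Lambda_{\mathcal A}\otimes\Lambda_{\mathcal B}$ is surjective and maps $x\otimes y$ to the operator $\Lambda_{\mathcal A}(x)\otimes\Lambda_{\mathcal B}(y)$ for $x\in C^*(\mathcal A)$, $y\in C^*(\mathcal B)$; * $\Psi$ is a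 \*-isomorphism with $\Psi(\Lambda(\delta_a)\otimes\Lambda(\delta_b))=\Lambda(\delta_{a\otimes b})$ for $a\in A_t$, $b\in B_s$. -/

import Mathlib

open scoped TensorProduct ComplexConjugate
open UniformSpace

set_option linter.unusedSectionVars false

universe u v u₁ v₁ u₂ v₂

noncomputable section

section BilinExt

variable {V W F : Type*} [SeminormedAddCommGroup V] [NormedSpace ℂ V]
  [SeminormedAddCommGroup W] [NormedSpace ℂ W]
  [NormedAddCommGroup F] [NormedSpace ℂ F] [CompleteSpace F]
  {σ : ℂ →+* ℂ} [RingHomIsometric σ]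

theorem denseRange_toComplₗ :
    DenseRange ((Completion.toComplₗᵢ : V →ₗᵢ[ℂ] Completion V).toLinearMap) :=
  Completion.denseRange_coe

/-- The extension of a bounded (semi)linear map to the completion of its domain. -/
def linExt (f : V →ₛₗ[σ] F) : Completion V →SL[σ] F :=
  f.extendOfNorm (Completion.toComplₗᵢ : V →ₗᵢ[ℂ] Completion V).toLinearMap

theorem linExt_coe (f : V →ₛₗ[σ] F) (hf : ∃ C, ∀ v, ‖f v‖ ≤ C * ‖v‖) (v : V) :
    linExt f (v : Completion V) = f v := by
  obtain ⟨C, hC⟩ := hf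
  exact LinearMap.extendOfNorm_eq denseRange_toComplₗ ⟨C, fun x => by simpa using hC x⟩ v

theorem linExt_norm_le (f : V →ₛₗ[σ] F) (C : ℝ) (hf : ∀ v, ‖f v‖ ≤ C * ‖v‖)
    (x : Completion V) : ‖linExt f x‖ ≤ C * ‖x‖ :=
  LinearMap.norm_extendOfNorm_apply_le denseRange_toComplₗ C (fun x => by simpa using hf x) x

/-- A map that is (semi)linear in the first and linear in the second variable, and bounded,
as a map into continuous linear maps on the completion. -/
def bilinExtAux (f : V →ₛₗ[σ] W →ₗ[ℂ] F) (hf : ∃ C, ∀ v w, ‖f v w‖ ≤ C * ‖v‖ * ‖w‖) :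
    V →ₛₗ[σ] (Completion W →L[ℂ] F) where
  toFun v := linExt (f v)
  map_add' v v' := by
    obtain ⟨C, hC⟩ := hf
    ext x
    induction x using Completion.induction_on with
    | hp => exact isClosed_eq (by fun_prop) (by fun_prop)
    | ih w =>
      simp only [add_apply]
      rw [linExt_coe _ ⟨_, hC _⟩, linExt_coe _ ⟨_, hC _⟩, linExt_coe _ ⟨_, hC _⟩]
      simp
  map_smul' c v := by
    obtain ⟨C, hC⟩ := hf
    ext x
    induction x using Completion.induction_on with
    | hp => exact isClosed_eq (by fun_prop) (by fun_prop)
    | ih w =>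
      simp only [smul_apply]
      rw [linExt_coe _ ⟨_, hC _⟩, linExt_coe _ ⟨_, hC _⟩]
      simp

/-- The extension of a bounded bilinear (or sesquilinear) map to the completions. -/
def bilinExt (f : V →ₛₗ[σ] W →ₗ[ℂ] F) (hf : ∃ C, ∀ v w, ‖f v w‖ ≤ C * ‖v‖ * ‖w‖) :
    Completion V →SL[σ] (Completion W →L[ℂ] F) :=
  linExt (bilinExtAux f hf)

theorem bilinExtAux_bound (f : V →ₛₗ[σ] W →ₗ[ℂ] F) (C : ℝ)
    (hC : ∀ v w, ‖f v w‖ ≤ C * ‖v‖ * ‖w‖) (v : V) :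
    ‖bilinExtAux f ⟨C, hC⟩ v‖ ≤ |C| * ‖v‖ := by
  refine ContinuousLinearMap.opNorm_le_bound _ (by positivity) fun x => ?_
  refine (linExt_norm_le (f v) (C * ‖v‖) (hC v) x).trans ?_
  gcongr
  exact le_abs_self C

theorem bilinExt_coe (f : V →ₛₗ[σ] W →ₗ[ℂ] F) (hf : ∃ C, ∀ v w, ‖f v w‖ ≤ C * ‖v‖ * ‖w‖)
    (v : V) (w : W) : bilinExt f hf (v : Completion V) (w : Completion W) = f v w := by
  obtain ⟨C, hC⟩ := hf
  unfold bilinExt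
  rw [linExt_coe _ ⟨|C|, bilinExtAux_bound f C hC⟩]
  exact linExt_coe _ ⟨_, hC v⟩ w

end BilinExt

/-! ### C*-seminorms on complex *-algebras -/

/-- A C*-seminorm on a complex *-algebra. -/
structure CStarSeminorm (R : Type*) [NonUnitalRing R] [StarRing R] [Module ℂ R]
    extends Seminorm ℂ R where
  mul_le : ∀ x y, toFun (x * y) ≤ toFun x * toFun y
  star_mul_self : ∀ x, toFun (star x * x) = toFun x ^ 2

namespace CStarSeminorm

variable {R : Type*} [NonUnitalRing R] [StarRing R] [Module ℂ R]

instance : CoeFun (CStarSeminorm R) (fun _ => R → ℝ) := ⟨fun p => p.toFun⟩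

theorem nonneg (p : CStarSeminorm R) (x : R) : 0 ≤ p x := apply_nonneg p.toSeminorm x

theorem star_eq (p : CStarSeminorm R) (x : R) : p (star x) = p x := by
  have key : ∀ y, p y ≤ p (star y) := by
    intro y
    rcases (p.nonneg y).eq_or_lt with h | h
    · rw [← h]; exact p.nonneg _
    · have := p.mul_le (star y) y
      rw [p.star_mul_self, sq] at this
      exact le_of_mul_le_mul_right this h
  refine le_antisymm ?_ (key x)
  simpa using key (star x)

/-- The C*-seminorm `0`. -/
instance : Zero (CStarSeminorm R) :=
  ⟨{ (0 : Seminorm ℂ R) with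
      mul_le := fun _ _ => (mul_zero (0 : ℝ)).ge
      star_mul_self := fun _ => (zero_pow two_ne_zero : (0 : ℝ) ^ 2 = 0).symm }⟩

/-- The supremum of a pointwise bounded family of C*-seminorms. -/
def sup {ι : Type*} [Nonempty ι] (p : ι → CStarSeminorm R)
    (hp : ∀ x, BddAbove (Set.range fun i => p i x)) : CStarSeminorm R where
  toFun x := ⨆ i, p i x
  map_zero' := by
    have : ∀ i, p i 0 = 0 := fun i => map_zero (p i).toSeminorm
    simp [this]
  add_le' x y := ciSup_le fun i =>
    (map_add_le_add (p i).toSeminorm x y).trans (add_le_add (le_ciSup (hp x) i) (le_ciSup (hp y) i))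
  neg' x := by
    congr 1; ext i; exact map_neg_eq_map (p i).toSeminorm x
  smul' c x := by
    rw [Real.mul_iSup_of_nonneg (norm_nonneg c)]
    congr 1; ext i; exact map_smul_eq_mul (p i).toSeminorm c x
  mul_le x y := ciSup_le fun i => ((p i).mul_le x y).trans <|
    mul_le_mul (le_ciSup (hp x) i) (le_ciSup (hp y) i) ((p i).nonneg y)
      (((p i).nonneg x).trans (le_ciSup (hp x) i))
  star_mul_self x := by
    refine le_antisymm (ciSup_le fun i => ?_) ?_
    · rw [(p i).star_mul_self]
      exact pow_le_pow_left₀ ((p i).nonneg x) (le_ciSup (hp x) i) 2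
    · have h0 : 0 ≤ ⨆ i, p i (star x * x) := Real.iSup_nonneg fun i => (p i).nonneg _
      have : ⨆ i, p i x ≤ √(⨆ i, p i (star x * x)) := ciSup_le fun i => by
        refine Real.le_sqrt_of_sq_le ?_
        rw [← (p i).star_mul_self]
        exact le_ciSup (hp (star x * x)) i
      calc _ ≤ √(⨆ i, p i (star x * x)) ^ 2 :=
            pow_le_pow_left₀ (Real.iSup_nonneg fun i => (p i).nonneg _) this 2
        _ = _ := Real.sq_sqrt h0

/-- The *-algebra `R`, regarded as a seminormed space with the seminorm `p`. -/
def Pre (_p : CStarSeminorm R) : Type _ := R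

variable (p : CStarSeminorm R)

instance : SeminormedAddCommGroup p.Pre :=
  AddGroupSeminorm.toSeminormedAddCommGroup (E := R) p.toAddGroupSeminorm

instance : NormedSpace ℂ p.Pre where
  __ := (inferInstance : Module ℂ R)
  norm_smul_le c x := (map_smul_eq_mul p.toSeminorm c x).le

/-- The separated completion of a *-algebra for a C*-seminorm. -/
def Compl : Type _ := Completion p.Pre

instance : NormedAddCommGroup p.Compl := inferInstanceAs (NormedAddCommGroup (Completion p.Pre))
instance : NormedSpace ℂ p.Compl := inferInstanceAs (NormedSpace ℂ (Completion p.Pre))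
instance : CompleteSpace p.Compl := inferInstanceAs (CompleteSpace (Completion p.Pre))

/-- The canonical linear map of a *-algebra into its completion. -/
def toCompl : R →ₗ[ℂ] p.Compl where
  toFun x := ((show p.Pre from x : p.Pre) : Completion p.Pre)
  map_add' x y := Completion.coe_add (α := p.Pre) x y
  map_smul' c x := Completion.coe_smul (M := ℂ) (X := p.Pre) c x

theorem norm_toCompl (x : R) : ‖p.toCompl x‖ = p x := Completion.norm_coe (E := p.Pre) x

theorem denseRange_toCompl : DenseRange p.toCompl := Completion.denseRange_coe (α := p.Pre)

theorem compl_induction {q : p.Compl → Prop} (hc : IsClosed {x | q x})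
    (h : ∀ x : R, q (p.toCompl x)) (x : p.Compl) : q x :=
  Completion.induction_on (α := p.Pre) x hc h

variable [IsScalarTower ℂ R R] [SMulCommClass ℂ R R] [StarModule ℂ R]

/-- The extension of the product to the completion. -/
def mulCompl : p.Compl →L[ℂ] p.Compl →L[ℂ] p.Compl :=
  bilinExt (V := p.Pre) (W := p.Pre) (F := p.Compl)
    ((LinearMap.mul ℂ R).compr₂ p.toCompl : R →ₗ[ℂ] R →ₗ[ℂ] p.Compl)
    ⟨1, fun x y => by
      rw [one_mul]
      exact (p.norm_toCompl _).trans_le (p.mul_le x y)⟩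

/-- The extension of the involution to the completion. -/
def starCompl : p.Compl →L⋆[ℂ] p.Compl :=
  linExt (V := p.Pre) (F := p.Compl)
    (p.toCompl.comp (starLinearEquiv ℂ (A := R) : R →ₗ⋆[ℂ] R) : R →ₗ⋆[ℂ] p.Compl)

theorem mulCompl_coe (x y : R) :
    p.mulCompl (p.toCompl x) (p.toCompl y) = p.toCompl (x * y) :=
  bilinExt_coe (V := p.Pre) (W := p.Pre) (F := p.Compl) _ _ x y

theorem starCompl_coe (x : R) : p.starCompl (p.toCompl x) = p.toCompl (star x) :=
  linExt_coe (V := p.Pre) (F := p.Compl) _ ⟨1, fun y => by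
    rw [one_mul]
    exact ((p.norm_toCompl _).trans (p.star_eq y)).le⟩ x

instance : NonUnitalCStarAlgebra p.Compl where
  __ := (inferInstance : NormedAddCommGroup p.Compl)
  __ := (inferInstance : NormedSpace ℂ p.Compl)
  __ := (inferInstance : CompleteSpace p.Compl)
  mul x y := p.mulCompl x y
  left_distrib x y z := map_add (p.mulCompl x) y z
  right_distrib x y z := congrArg (fun T => T z) (map_add p.mulCompl x y)
  zero_mul x := congrArg (fun T => T x) (map_zero p.mulCompl)
  mul_zero x := map_zero (p.mulCompl x)
  mul_assoc x y z := by
    change p.mulCompl (p.mulCompl x y) z = p.mulCompl x (p.mulCompl y z)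
    induction x using p.compl_induction with
    | hc => exact isClosed_eq (by fun_prop) (by fun_prop)
    | h x =>
    induction y using p.compl_induction with
    | hc => exact isClosed_eq (by fun_prop) (by fun_prop)
    | h y =>
    induction z using p.compl_induction with
    | hc => exact isClosed_eq (by fun_prop) (by fun_prop)
    | h z => simp only [mulCompl_coe, mul_assoc]
  norm_mul_le x y := by
    change ‖p.mulCompl x y‖ ≤ ‖x‖ * ‖y‖
    induction x using p.compl_induction with
    | hc => exact isClosed_le (by fun_prop) (by fun_prop)
    | h x =>
    induction y using p.compl_induction with
    | hc => exact isClosed_le (by fun_prop) (by fun_prop)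
    | h y => simpa only [mulCompl_coe, norm_toCompl] using p.mul_le x y
  star x := p.starCompl x
  star_involutive x := by
    induction x using p.compl_induction with
    | hc => exact isClosed_eq (by fun_prop) (by fun_prop)
    | h x => simp only [starCompl_coe, star_star]
  star_add x y := map_add p.starCompl x y
  star_mul x y := by
    change p.starCompl (p.mulCompl x y) = p.mulCompl (p.starCompl y) (p.starCompl x)
    induction x using p.compl_induction with
    | hc => exact isClosed_eq (by fun_prop) (by fun_prop)
    | h x =>
    induction y using p.compl_induction with
    | hc => exact isClosed_eq (by fun_prop) (by fun_prop)
    | h y => simp only [starCompl_coe, mulCompl_coe, star_mul]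
  norm_mul_self_le x := by
    change ‖x‖ * ‖x‖ ≤ ‖p.mulCompl (p.starCompl x) x‖
    induction x using p.compl_induction with
    | hc => exact isClosed_le (by fun_prop) (by fun_prop)
    | h x =>
      simp only [starCompl_coe, mulCompl_coe, norm_toCompl]
      exact ((p.star_mul_self x).trans (sq _)).ge
  smul_assoc c x y := congrArg (fun T => T y) (map_smul p.mulCompl c x)
  smul_comm c x y := (map_smul (p.mulCompl x) c y).symm
  star_smul c x := map_smulₛₗ p.starCompl c x

/-- The canonical *-homomorphism of a *-algebra into its completion. -/
def of : R →⋆ₙₐ[ℂ] p.Compl where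
  toFun := p.toCompl
  map_smul' := map_smul p.toCompl
  map_zero' := map_zero p.toCompl
  map_add' := map_add p.toCompl
  map_mul' x y := (p.mulCompl_coe x y).symm
  map_star' x := (p.starCompl_coe x).symm

theorem norm_of (x : R) : ‖p.of x‖ = p x := p.norm_toCompl x

theorem denseRange_of : DenseRange p.of := p.denseRange_toCompl

end CStarSeminorm

/-! ### *-algebraic bundles over discrete groups -/

/-- A *-algebraic bundle over a discrete group: a family of complex vector spaces with an
associative product `A_s × A_t → A_{st}` and an involution `A_s → A_{s⁻¹}`. The operations take an
equation for the index of the target fiber, so that no transport along equations of group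
elements is needed. -/
structure StarBundle (G : Type u) [Group G] where
  /-- The fibers. -/
  fiber : G → Type v
  [addCommGroup : ∀ t, AddCommGroup (fiber t)]
  [module : ∀ t, Module ℂ (fiber t)]
  /-- The product `A_s × A_t → A_{st}`. -/
  mulMap : ∀ {s t r : G}, s * t = r → fiber s →ₗ[ℂ] fiber t →ₗ[ℂ] fiber r
  /-- The involution `A_s → A_{s⁻¹}`. -/
  starMap : ∀ {s t : G}, s⁻¹ = t → fiber s →ₗ⋆[ℂ] fiber t
  mulMap_assoc : ∀ {r s t x y z : G} (h₁ : r * s = x) (h₂ : x * t = z) (h₃ : s * t = y)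
    (h₄ : r * y = z) (a : fiber r) (b : fiber s) (c : fiber t),
    mulMap h₂ (mulMap h₁ a b) c = mulMap h₄ a (mulMap h₃ b c)
  starMap_mulMap : ∀ {s t r s' t' r' : G} (h : s * t = r) (hs : s⁻¹ = s') (ht : t⁻¹ = t')
    (hr : r⁻¹ = r') (h' : t' * s' = r') (a : fiber s) (b : fiber t),
    starMap hr (mulMap h a b) = mulMap h' (starMap ht b) (starMap hs a)
  starMap_starMap : ∀ {s t : G} (h : s⁻¹ = t) (h' : t⁻¹ = s) (a : fiber s),
    starMap h' (starMap h a) = a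

attribute [instance] StarBundle.addCommGroup StarBundle.module

namespace StarBundle

variable {G : Type u} [Group G] (P : StarBundle.{u, v} G)

/-- The space `C_c(A)` of finitely supported sections. -/
def Cc : Type (max u v) := Π₀ t, P.fiber t

instance : AddCommGroup P.Cc := inferInstanceAs (AddCommGroup (Π₀ t, P.fiber t))
instance : Module ℂ P.Cc := inferInstanceAs (Module ℂ (Π₀ t, P.fiber t))

/-- The value of a section at a group element. -/
def ev (t : G) : P.Cc →ₗ[ℂ] P.fiber t := DFinsupp.lapply t

open scoped Classical in
/-- The section with the value `a` at `t` and zero elsewhere. -/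
def δ (t : G) : P.fiber t →ₗ[ℂ] P.Cc := DFinsupp.lsingle t

open scoped Classical in
theorem ev_δ (s t : G) (a : P.fiber t) :
    P.ev s (P.δ t a) = if h : t = s then h ▸ a else 0 := by
  change (DFinsupp.single t a : Π₀ t, P.fiber t) s = _
  rw [DFinsupp.single_apply]

theorem ev_δ_same (t : G) (a : P.fiber t) : P.ev t (P.δ t a) = a := by
  simp [ev_δ]

theorem ev_δ_ne {s t : G} (h : t ≠ s) (a : P.fiber t) : P.ev s (P.δ t a) = 0 := by
  simp [ev_δ, h]

theorem Cc_induction {q : P.Cc → Prop} (f : P.Cc) (h0 : q 0)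
    (hδ : ∀ t a, q (P.δ t a)) (hadd : ∀ f g, q f → q g → q (f + g)) : q f := by
  classical
  refine DFinsupp.induction (p := q) f h0 fun t b f _ _ hf => hadd _ _ ?_ hf
  exact hδ t b

open scoped Classical in
/-- The linear map on `C_c(A)` with prescribed restrictions to the fibers. -/
def liftCc {M : Type*} [AddCommGroup M] [Module ℂ M] (f : ∀ t, P.fiber t →ₗ[ℂ] M) :
    P.Cc →ₗ[ℂ] M :=
  DFinsupp.lsum (R := ℂ) ℂ f

theorem liftCc_δ {M : Type*} [AddCommGroup M] [Module ℂ M] (f : ∀ t, P.fiber t →ₗ[ℂ] M) (t : G)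
    (a : P.fiber t) : P.liftCc f (P.δ t a) = f t a := by
  classical
  exact DFinsupp.lsum_single (R := ℂ) ℂ f t a

/-- The convolution product of sections, determined by `δ_a * δ_b = δ_{ab}`. -/
def mulCc : P.Cc →ₗ[ℂ] P.Cc →ₗ[ℂ] P.Cc :=
  P.liftCc fun s => LinearMap.flip
    (P.liftCc fun t => LinearMap.flip ((P.mulMap rfl).compr₂ (P.δ (s * t))))

open scoped Classical in
/-- The involution of sections, determined by `δ_a* = δ_{a*}`. -/
def starCc : P.Cc →+ P.Cc :=
  DFinsupp.sumAddHom fun t =>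
    (P.δ t⁻¹).toAddMonoidHom.comp (P.starMap (rfl : t⁻¹ = t⁻¹)).toAddMonoidHom

theorem mulCc_δ {s t r : G} (h : s * t = r) (a : P.fiber s) (b : P.fiber t) :
    P.mulCc (P.δ s a) (P.δ t b) = P.δ r (P.mulMap h a b) := by
  subst h
  rw [mulCc, liftCc_δ, LinearMap.flip_apply, liftCc_δ, LinearMap.flip_apply,
    LinearMap.compr₂_apply]

theorem starCc_δ {s t : G} (h : s⁻¹ = t) (a : P.fiber s) :
    P.starCc (P.δ s a) = P.δ t (P.starMap h a) := by
  classical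
  subst h
  exact DFinsupp.sumAddHom_single _ s a

/-- `C_c(A)` with the convolution product. -/
instance : NonUnitalRing P.Cc where
  __ := (inferInstance : AddCommGroup P.Cc)
  mul f g := P.mulCc f g
  left_distrib f g h := map_add (P.mulCc f) g h
  right_distrib f g h := congrArg (fun T => T h) (map_add P.mulCc f g)
  zero_mul f := congrArg (fun T => T f) (map_zero P.mulCc)
  mul_zero f := map_zero (P.mulCc f)
  mul_assoc f g h := by
    change P.mulCc (P.mulCc f g) h = P.mulCc f (P.mulCc g h)
    induction f using P.Cc_induction with
    | h0 => simp
    | hadd f f' hf hf' => simp [hf, hf']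
    | hδ r a =>
    induction g using P.Cc_induction with
    | h0 => simp
    | hadd f f' hf hf' => simp [hf, hf']
    | hδ s b =>
    induction h using P.Cc_induction with
    | h0 => simp
    | hadd f f' hf hf' => simp [hf, hf']
    | hδ t c =>
      rw [P.mulCc_δ rfl, P.mulCc_δ rfl, P.mulCc_δ rfl, P.mulCc_δ (mul_assoc r s t).symm,
        P.mulMap_assoc rfl rfl rfl (mul_assoc r s t).symm]

theorem δ_mul_δ {s t r : G} (h : s * t = r) (a : P.fiber s) (b : P.fiber t) :
    P.δ s a * P.δ t b = P.δ r (P.mulMap h a b) := P.mulCc_δ h a b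

/-- `C_c(A)` with the involution `f*(t) = f(t⁻¹)*`. -/
instance : StarRing P.Cc where
  star f := P.starCc f
  star_add f g := map_add P.starCc f g
  star_involutive f := by
    change P.starCc (P.starCc f) = f
    induction f using P.Cc_induction with
    | h0 => simp
    | hadd f f' hf hf' => simp [hf, hf']
    | hδ t a => rw [P.starCc_δ rfl, P.starCc_δ (inv_inv t), P.starMap_starMap]
  star_mul f g := by
    change P.starCc (P.mulCc f g) = P.mulCc (P.starCc g) (P.starCc f)
    induction f using P.Cc_induction with
    | h0 => simp
    | hadd f f' hf hf' => simp [hf, hf']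
    | hδ r a =>
    induction g using P.Cc_induction with
    | h0 => simp
    | hadd f f' hf hf' => simp [hf, hf']
    | hδ s b =>
      rw [P.mulCc_δ rfl, P.starCc_δ rfl, P.starCc_δ rfl, P.starCc_δ rfl,
        P.mulCc_δ (mul_inv_rev r s).symm,
        P.starMap_mulMap rfl rfl rfl rfl (mul_inv_rev r s).symm]

theorem star_δ {s t : G} (h : s⁻¹ = t) (a : P.fiber s) :
    star (P.δ s a) = P.δ t (P.starMap h a) := P.starCc_δ h a

instance : IsScalarTower ℂ P.Cc P.Cc :=
  ⟨fun c f g => congrArg (fun T => T g) (map_smul P.mulCc c f)⟩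

instance : SMulCommClass ℂ P.Cc P.Cc :=
  ⟨fun c f g => (map_smul (P.mulCc f) c g).symm⟩

instance : StarModule ℂ P.Cc where
  star_smul c f := by
    induction f using P.Cc_induction with
    | h0 => simp
    | hadd f f' hf hf' => simp [hf, hf']
    | hδ t a => rw [← map_smul, P.star_δ rfl, P.star_δ rfl, map_smulₛₗ, map_smul]; rfl

open scoped Classical in
/-- The value at `e` of `f* * g` is `∑ₜ f(t)* g(t)`. -/
theorem ev_one_star_mul (f g : P.Cc) (S : Finset G) (hf : ∀ t ∉ S, P.ev t f = 0) :
    P.ev 1 (star f * g) =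
      ∑ t ∈ S, P.mulMap (inv_mul_cancel t) (P.starMap rfl (P.ev t f)) (P.ev t g) := by
  have hf' : f = ∑ t ∈ S, P.δ t (P.ev t f) := by
    refine DFinsupp.ext (β := P.fiber) fun s => ?_
    change P.ev s f = P.ev s _
    rw [map_sum]
    by_cases hs : s ∈ S
    · rw [Finset.sum_eq_single_of_mem s hs fun t _ hts => P.ev_δ_ne hts _, P.ev_δ_same]
    · rw [hf s hs, Finset.sum_eq_zero]
      intro t ht
      exact P.ev_δ_ne (fun h : t = s => hs (h ▸ ht)) _
  conv_lhs => rw [hf']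
  rw [star_sum, Finset.sum_mul, map_sum]
  refine Finset.sum_congr rfl fun t _ => ?_
  induction g using P.Cc_induction with
  | h0 => simp
  | hadd g g' h h' => rw [mul_add, map_add, h, h', map_add, map_add]
  | hδ s b =>
    rw [P.star_δ rfl, P.δ_mul_δ rfl]
    by_cases h : t = s
    · subst h
      rw [← P.δ_mul_δ rfl, P.δ_mul_δ (inv_mul_cancel t), P.ev_δ_same, P.ev_δ_same]
    · rw [P.ev_δ_ne, P.ev_δ_ne (Ne.symm h), map_zero]
      intro h'
      exact h (inv_mul_eq_one.mp h')

end StarBundle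

namespace StarBundle

variable {G : Type u} [Group G] (P : StarBundle.{u, v} G)

/-- The product `a* b ∈ A_e` of two elements of the same fiber. -/
def starMul {t : G} : P.fiber t →ₗ⋆[ℂ] P.fiber t →ₗ[ℂ] P.fiber 1 :=
  (P.mulMap (inv_mul_cancel t)).comp (P.starMap rfl)

theorem starMul_apply {s t : G} (h : t⁻¹ = s) (h' : s * t = 1) (a b : P.fiber t) :
    P.starMul a b = P.mulMap h' (P.starMap h a) b := by
  subst h
  rfl

/-- A C*-norm on a *-algebraic bundle `A`. The positivity of `a* a` in the completion of the
pre-C*-algebra `A_e` is expressed by: `a* a` is a limit of elements `c* c` with `c ∈ A_e`. -/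
structure CStarNorm where
  /-- The norms of the fibers. -/
  nrm : ∀ t, Seminorm ℂ (P.fiber t)
  eq_zero : ∀ (t : G) (a : P.fiber t), nrm t a = 0 → a = 0
  mul_le : ∀ {s t r : G} (h : s * t = r) (a : P.fiber s) (b : P.fiber t),
    nrm r (P.mulMap h a b) ≤ nrm s a * nrm t b
  starMul_self : ∀ (t : G) (a : P.fiber t), nrm 1 (P.starMul a a) = nrm t a ^ 2
  pos : ∀ (t : G) (a : P.fiber t) (ε : ℝ), 0 < ε →
    ∃ c : P.fiber 1, nrm 1 (P.starMul a a - P.starMul c c) < ε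

namespace CStarNorm

variable {P} (n : P.CStarNorm)

theorem nrm_star {s t : G} (h : s⁻¹ = t) (a : P.fiber s) :
    n.nrm t (P.starMap h a) = n.nrm s a := by
  have key : ∀ {s t : G} (h : s⁻¹ = t) (a : P.fiber s),
      n.nrm s a ≤ n.nrm t (P.starMap h a) := by
    intro s t h a
    rcases (apply_nonneg (n.nrm s) a).eq_or_lt with h0 | h0
    · rw [← h0]; exact apply_nonneg _ _
    · have h1 : t * s = 1 := by rw [← h]; exact inv_mul_cancel s
      have := n.mul_le h1 (P.starMap h a) a
      rw [← P.starMul_apply, n.starMul_self, sq] at this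
      exact le_of_mul_le_mul_right this h0
  have h' : t⁻¹ = s := by rw [← h, inv_inv]
  refine le_antisymm ?_ (key h a)
  simpa [P.starMap_starMap h h'] using key h' (P.starMap h a)

/-- The fiber at `t`, regarded as a normed space. -/
def Fib (_n : P.CStarNorm) (t : G) : Type v := P.fiber t

instance (t : G) : NormedAddCommGroup (n.Fib t) :=
  AddGroupNorm.toNormedAddCommGroup (E := P.fiber t)
    { (n.nrm t).toAddGroupSeminorm with
      eq_zero_of_map_eq_zero' := n.eq_zero t }

instance (t : G) : NormedSpace ℂ (n.Fib t) where
  __ := (inferInstance : Module ℂ (P.fiber t))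
  norm_smul_le c a := (map_smul_eq_mul (n.nrm t) c a).le

theorem norm_fib {t : G} (a : n.Fib t) : ‖a‖ = n.nrm t a := rfl

end CStarNorm

end StarBundle

/-- A Fell bundle over a discrete group: a *-algebraic bundle with a C*-norm for which all fibers
are complete. -/
structure FellBundle (G : Type u) [Group G] extends StarBundle.{u, v} G where
  /-- The norm. -/
  cstarNorm : toStarBundle.CStarNorm
  complete : ∀ t, CompleteSpace (cstarNorm.Fib t)

namespace FellBundle

variable {G : Type u} [Group G] (A : FellBundle.{u, v} G)

/-- The unit fiber `A_e` of a Fell bundle, as a C*-algebra. -/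
def UnitFiber : Type v := A.cstarNorm.Fib 1

instance : NormedAddCommGroup A.UnitFiber :=
  inferInstanceAs (NormedAddCommGroup (A.cstarNorm.Fib 1))
instance : NormedSpace ℂ A.UnitFiber := inferInstanceAs (NormedSpace ℂ (A.cstarNorm.Fib 1))
instance : CompleteSpace A.UnitFiber := A.complete 1

instance : NonUnitalCStarAlgebra A.UnitFiber where
  __ := (inferInstance : NormedAddCommGroup A.UnitFiber)
  __ := (inferInstance : NormedSpace ℂ A.UnitFiber)
  __ := (inferInstance : CompleteSpace A.UnitFiber)
  mul a b := A.mulMap (one_mul 1) a b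
  left_distrib a b c := map_add (A.mulMap (one_mul 1) a) b c
  right_distrib a b c := congrArg (fun T => T c) (map_add (A.mulMap (one_mul 1)) a b)
  zero_mul a := congrArg (fun T => T a) (map_zero (A.mulMap (one_mul 1)))
  mul_zero a := map_zero (A.mulMap (one_mul 1) a)
  mul_assoc a b c := A.mulMap_assoc (one_mul 1) (one_mul 1) (one_mul 1) (one_mul 1) a b c
  norm_mul_le a b := A.cstarNorm.mul_le (one_mul 1) a b
  star a := A.starMap inv_one a
  star_involutive a := A.starMap_starMap inv_one inv_one a
  star_add a b := map_add (A.starMap inv_one) a b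
  star_mul a b := A.starMap_mulMap (one_mul 1) inv_one inv_one inv_one (one_mul 1) a b
  norm_mul_self_le a := by
    have h := A.cstarNorm.starMul_self 1 a
    rw [show A.starMul a a = A.mulMap (one_mul 1) (A.starMap inv_one a) a from
      A.starMul_apply inv_one (one_mul 1) a a, sq] at h
    exact h.ge
  smul_assoc c a b := congrArg (fun T => T b) (map_smul (A.mulMap (one_mul 1)) c a)
  smul_comm c a b := (map_smul (A.mulMap (one_mul 1) a) c b).symm
  star_smul c a := map_smulₛₗ (A.starMap inv_one) c a

instance : PartialOrder A.UnitFiber := CStarAlgebra.spectralOrder _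
instance : StarOrderedRing A.UnitFiber := CStarAlgebra.spectralOrderedRing _

theorem mul_unitFiber (a b : A.fiber 1) :
    (show A.UnitFiber from a) * (show A.UnitFiber from b) =
      (show A.UnitFiber from A.mulMap (one_mul 1) a b) := rfl

/-- The product `a* b ∈ A_e` of two elements of the same fiber, with values in the C*-algebra
`A_e`. -/
def starMulUnit {t : G} : A.fiber t →ₗ⋆[ℂ] A.fiber t →ₗ[ℂ] A.UnitFiber := A.starMul

theorem starMulUnit_nonneg {t : G} (a : A.fiber t) : 0 ≤ A.starMulUnit a a := by
  have : A.starMulUnit a a ∈ closure {x : A.UnitFiber | 0 ≤ x} := by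
    rw [Metric.mem_closure_iff]
    intro ε hε
    obtain ⟨c, hc⟩ := A.cstarNorm.pos t a ε hε
    refine ⟨A.starMulUnit c c, ?_, ?_⟩
    · have : A.starMulUnit c c = star (show A.UnitFiber from c) * (show A.UnitFiber from c) :=
        A.starMul_apply inv_one (one_mul 1) c c
      rw [Set.mem_ofPred_eq, this]
      exact star_mul_self_nonneg _
    · rw [dist_eq_norm]
      exact hc
  rwa [CStarAlgebra.isClosed_nonneg.closure_eq] at this

end FellBundle

namespace StarBundle.CStarNorm

variable {G : Type u} [Group G] {P : StarBundle.{u, v} G} (n : P.CStarNorm)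

/-- The completion of a fiber. -/
abbrev ComplFib (t : G) : Type v := Completion (n.Fib t)

/-- The canonical map of a fiber into its completion. -/
def toComplFib {t : G} : P.fiber t →ₗ[ℂ] n.ComplFib t :=
  (Completion.toComplₗᵢ : n.Fib t →ₗᵢ[ℂ] n.ComplFib t).toLinearMap

theorem norm_toComplFib {t : G} (a : P.fiber t) : ‖n.toComplFib a‖ = n.nrm t a :=
  Completion.norm_coe (E := n.Fib t) a

theorem complFib_induction {t : G} {q : n.ComplFib t → Prop} (hc : IsClosed {x | q x})
    (h : ∀ a : P.fiber t, q (n.toComplFib a)) (x : n.ComplFib t) : q x :=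
  Completion.induction_on (α := n.Fib t) x hc h

/-- The extension of the product to the completions of the fibers. -/
def mulCompl {s t r : G} (h : s * t = r) : n.ComplFib s →L[ℂ] n.ComplFib t →L[ℂ] n.ComplFib r :=
  bilinExt (V := n.Fib s) (W := n.Fib t)
    ((P.mulMap h).compr₂ n.toComplFib : P.fiber s →ₗ[ℂ] P.fiber t →ₗ[ℂ] n.ComplFib r)
    ⟨1, fun a b => by
      rw [one_mul]
      exact (n.norm_toComplFib _).trans_le (n.mul_le h a b)⟩

/-- The extension of the involution to the completions of the fibers. -/
def starCompl {s t : G} (h : s⁻¹ = t) : n.ComplFib s →L⋆[ℂ] n.ComplFib t :=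
  linExt (V := n.Fib s)
    (n.toComplFib.comp (P.starMap h) : P.fiber s →ₗ⋆[ℂ] n.ComplFib t)

theorem mulCompl_coe {s t r : G} (h : s * t = r) (a : P.fiber s) (b : P.fiber t) :
    n.mulCompl h (n.toComplFib a) (n.toComplFib b) = n.toComplFib (P.mulMap h a b) :=
  bilinExt_coe (V := n.Fib s) (W := n.Fib t) _ _ a b

theorem starCompl_coe {s t : G} (h : s⁻¹ = t) (a : P.fiber s) :
    n.starCompl h (n.toComplFib a) = n.toComplFib (P.starMap h a) :=
  linExt_coe (V := n.Fib s) _ ⟨1, fun b => by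
    rw [one_mul]
    exact ((n.norm_toComplFib _).trans (n.nrm_star h b)).le⟩ a

/-- The *-algebraic bundle of the completions of the fibers. -/
def complBundle : StarBundle.{u, v} G where
  fiber t := n.ComplFib t
  mulMap h := (ContinuousLinearMap.coeLM ℂ).comp (n.mulCompl h).toLinearMap
  starMap h := (n.starCompl h).toLinearMap
  mulMap_assoc h₁ h₂ h₃ h₄ a b c := by
    change n.mulCompl h₂ (n.mulCompl h₁ a b) c = n.mulCompl h₄ a (n.mulCompl h₃ b c)
    induction a using n.complFib_induction with
    | hc => exact isClosed_eq (by fun_prop) (by fun_prop)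
    | h a =>
    induction b using n.complFib_induction with
    | hc => exact isClosed_eq (by fun_prop) (by fun_prop)
    | h b =>
    induction c using n.complFib_induction with
    | hc => exact isClosed_eq (by fun_prop) (by fun_prop)
    | h c => simp only [mulCompl_coe, P.mulMap_assoc h₁ h₂ h₃ h₄]
  starMap_mulMap h hs ht hr h' a b := by
    change n.starCompl hr (n.mulCompl h a b) = n.mulCompl h' (n.starCompl ht b) (n.starCompl hs a)
    induction a using n.complFib_induction with
    | hc => exact isClosed_eq (by fun_prop) (by fun_prop)
    | h a =>
    induction b using n.complFib_induction with
    | hc => exact isClosed_eq (by fun_prop) (by fun_prop)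
    | h b => simp only [mulCompl_coe, starCompl_coe, P.starMap_mulMap h hs ht hr h']
  starMap_starMap h h' a := by
    change n.starCompl h' (n.starCompl h a) = a
    induction a using n.complFib_induction with
    | hc => exact isClosed_eq (by fun_prop) (by fun_prop)
    | h a => simp only [starCompl_coe, P.starMap_starMap h h']

/-- The product `x* y` on the completed fibers. -/
def smCompl {t : G} (x y : n.ComplFib t) : n.ComplFib 1 :=
  n.mulCompl (inv_mul_cancel t) (n.starCompl rfl x) y

theorem smCompl_coe {t : G} (a b : P.fiber t) :
    n.smCompl (n.toComplFib a) (n.toComplFib b) = n.toComplFib (P.starMul a b) := by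
  rw [smCompl, starCompl_coe, mulCompl_coe]
  rfl

theorem continuous_smCompl {t : G} : Continuous fun x : n.ComplFib t => n.smCompl x x := by
  unfold smCompl
  fun_prop

/-- The norm of the completed bundle. -/
def complNorm : n.complBundle.CStarNorm where
  nrm t := normSeminorm ℂ (n.ComplFib t)
  eq_zero t a h := norm_eq_zero (E := n.ComplFib t) |>.mp h
  mul_le {s t r} h a b := by
    change ‖n.mulCompl h a b‖ ≤ norm (E := n.ComplFib s) a * norm (E := n.ComplFib t) b
    induction a using n.complFib_induction with
    | hc => exact isClosed_le (by fun_prop) (by fun_prop)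
    | h a =>
    induction b using n.complFib_induction with
    | hc => exact isClosed_le (by fun_prop) (by fun_prop)
    | h b => simpa only [mulCompl_coe, norm_toComplFib] using n.mul_le h a b
  starMul_self t a := by
    change ‖n.smCompl a a‖ = norm (E := n.ComplFib t) a ^ 2
    induction a using n.complFib_induction with
    | hc => exact isClosed_eq n.continuous_smCompl.norm (by fun_prop)
    | h a => rw [smCompl_coe, norm_toComplFib, norm_toComplFib, n.starMul_self]
  pos t a ε hε := by
    obtain ⟨b, hb⟩ : ∃ b : P.fiber t,
        ‖n.smCompl a a - n.smCompl (n.toComplFib b) (n.toComplFib b)‖ < ε / 2 := by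
      have ho : IsOpen {x : n.ComplFib t | ‖n.smCompl a a - n.smCompl x x‖ < ε / 2} :=
        isOpen_lt (continuous_const.sub n.continuous_smCompl).norm continuous_const
      exact (Completion.denseRange_coe (α := n.Fib t)).exists_mem_open ho
        ⟨a, by
          change ‖n.smCompl a a - n.smCompl a a‖ < ε / 2
          rw [sub_self, norm_zero]
          exact half_pos hε⟩
    obtain ⟨c, hc⟩ := n.pos t b (ε / 2) (half_pos hε)
    refine ⟨n.toComplFib c, ?_⟩
    change ‖n.smCompl a a - n.smCompl (n.toComplFib c) (n.toComplFib c)‖ < ε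
    rw [smCompl_coe] at hb ⊢
    rw [← norm_toComplFib, map_sub] at hc
    calc _ ≤ ‖n.smCompl a a - n.toComplFib (P.starMul b b)‖ +
          ‖n.toComplFib (P.starMul b b) - n.toComplFib (P.starMul c c)‖ :=
          norm_sub_le_norm_sub_add_norm_sub _ _ _
      _ < ε := by linarith

/-- The Fell bundle obtained by completing a *-algebraic bundle for a C*-norm. -/
def compl : FellBundle.{u, v} G where
  toStarBundle := n.complBundle
  cstarNorm := n.complNorm
  complete t := by
    let e : n.ComplFib t ≃ᵢ n.complNorm.Fib t :=
      ⟨Equiv.refl _, Isometry.of_dist_eq fun x y =>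
        (dist_eq_norm (E := n.complNorm.Fib t) x y).trans
          (dist_eq_norm (E := n.ComplFib t) x y).symm⟩
    exact e.completeSpace_iff.mp inferInstance

/-- The canonical map of a fiber into the corresponding fiber of the completion. -/
def toCompl {t : G} : P.fiber t →ₗ[ℂ] n.compl.fiber t := n.toComplFib

end StarBundle.CStarNorm

/-! ### The maximal tensor product of C*-algebras -/

/-- The *-ring structure of the algebraic tensor product, `(a ⊗ b)* = a* ⊗ b*`. -/
instance tensorStarRing {A B : Type*} [NonUnitalRing A] [StarRing A] [Module ℂ A] [StarModule ℂ A]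
    [SMulCommClass ℂ A A] [IsScalarTower ℂ A A]
    [NonUnitalRing B] [StarRing B] [Module ℂ B] [StarModule ℂ B]
    [SMulCommClass ℂ B B] [IsScalarTower ℂ B B] : StarRing (A ⊗[ℂ] B) where
  star_mul x y := by
    induction x with
    | zero => simp
    | add x x' h h' => rw [add_mul, star_add, h, h', star_add, mul_add]
    | tmul a b =>
    induction y with
    | zero => simp
    | add y y' h h' => rw [mul_add, star_add, h, h', star_add, add_mul]
    | tmul c d => simp [star_mul]
  star_add := star_add

section Cross

variable {A B : Type*} [NonUnitalCStarAlgebra A] [NonUnitalCStarAlgebra B]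

theorem exists_bound_of_pos_left {D : Type*} [NonUnitalCStarAlgebra D] [PartialOrder D]
    [StarOrderedRing D] (β : A →ₗ[ℂ] B →ₗ[ℂ] D)
    (hβ : ∀ a b, 0 ≤ β (star a * a) (star b * b)) (b : B) :
    ∃ C, ∀ a, ‖β a b‖ ≤ C * ‖a‖ := by
  let := CStarAlgebra.spectralOrder A
  let := CStarAlgebra.spectralOrderedRing A
  let := CStarAlgebra.spectralOrder B
  let := CStarAlgebra.spectralOrderedRing B
  have h1 : ∀ c : B, 0 ≤ c → ∃ C, ∀ a, ‖β a c‖ ≤ C * ‖a‖ := by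
    intro c hc
    obtain ⟨d, rfl⟩ := CStarAlgebra.nonneg_iff_eq_star_mul_self.mp hc
    obtain ⟨C, hC⟩ := PositiveLinearMap.exists_norm_apply_le
      (PositiveLinearMap.mk₀ (β.flip (star d * d)) fun a ha => by
        obtain ⟨e, rfl⟩ := CStarAlgebra.nonneg_iff_eq_star_mul_self.mp ha
        exact hβ e d)
    exact ⟨C, hC⟩
  obtain ⟨y, hy, -, hb⟩ := CStarAlgebra.exists_sum_four_nonneg b
  choose C hC using fun i => h1 (y i) (hy i)
  refine ⟨∑ i, C i, fun a => ?_⟩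
  rw [hb, map_sum, Finset.sum_mul]
  refine (norm_sum_le _ _).trans (Finset.sum_le_sum fun i _ => ?_)
  rw [map_smul, norm_smul, norm_pow, Complex.norm_I, one_pow, one_mul]
  exact hC i a

theorem exists_bound_of_pos {D : Type*} [NonUnitalCStarAlgebra D] [PartialOrder D]
    [StarOrderedRing D] (β : A →ₗ[ℂ] B →ₗ[ℂ] D)
    (hβ : ∀ a b, 0 ≤ β (star a * a) (star b * b)) :
    ∃ C, ∀ a b, ‖β a b‖ ≤ C * ‖a‖ * ‖b‖ := by
  choose K hK using exists_bound_of_pos_left β hβ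
  choose L hL using exists_bound_of_pos_left β.flip fun b a => hβ a b
  let T : {b : B // ‖b‖ ≤ 1} → A →L[ℂ] D := fun b =>
    (β.flip b.1).mkContinuous (K b.1) fun a => hK b.1 a
  obtain ⟨C, hC⟩ := banach_steinhaus (g := T) fun a =>
    ⟨|L a|, fun b => (hL a b.1).trans <| by
      have := mul_le_mul (le_abs_self (L a)) b.2 (norm_nonneg _) (abs_nonneg _)
      simpa using this⟩
  refine ⟨C, fun a b => ?_⟩
  rcases eq_or_ne b 0 with rfl | hb
  · simp
  have hb' : 0 < ‖b‖ := norm_pos_iff.mpr hb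
  have h1 : ‖((‖b‖⁻¹ : ℝ) : ℂ) • b‖ ≤ 1 := by
    rw [norm_smul, Complex.norm_real, norm_inv, norm_norm, inv_mul_cancel₀ hb'.ne']
  have h2 : ‖β a (((‖b‖⁻¹ : ℝ) : ℂ) • b)‖ ≤ C * ‖a‖ :=
    ((T ⟨_, h1⟩).le_opNorm a).trans (by gcongr; exact hC ⟨_, h1⟩)
  rw [map_smul, norm_smul, Complex.norm_real, norm_inv, norm_norm, inv_mul_le_iff₀ hb'] at h2
  linarith

theorem le_of_forall_pow_le {r s C : ℝ} (hs : 0 ≤ s)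
    (h : ∀ n : ℕ, r ^ 2 ^ n ≤ C * s ^ 2 ^ n) : r ≤ s := by
  by_contra! hlt
  rcases hs.eq_or_lt with rfl | hs
  · have := h 0
    simp at this
    linarith
  have h1 : 1 < r / s := (one_lt_div hs).mpr hlt
  obtain ⟨n, hn⟩ := ((tendsto_pow_atTop_atTop_of_one_lt h1).eventually_gt_atTop C).exists
  have h2 : (r / s) ^ n ≤ (r / s) ^ 2 ^ n := pow_le_pow_right₀ h1.le Nat.lt_two_pow_self.le
  have h3 : (r / s) ^ 2 ^ n ≤ C := by
    rw [div_pow, div_le_iff₀ (by positivity)]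
    exact h n
  linarith

/-- Every C*-seminorm on the algebraic tensor product of C*-algebras is a subcross seminorm. -/
theorem CStarSeminorm.tmul_le (p : CStarSeminorm (A ⊗[ℂ] B)) (a : A) (b : B) :
    p (a ⊗ₜ b) ≤ ‖a‖ * ‖b‖ := by
  let := CStarAlgebra.spectralOrder p.Compl
  let := CStarAlgebra.spectralOrderedRing p.Compl
  obtain ⟨C, hC⟩ := exists_bound_of_pos
    ((TensorProduct.mk ℂ A B).compr₂ p.toCompl) fun a b => by
      have : p.of (star (a ⊗ₜ[ℂ] b) * (a ⊗ₜ[ℂ] b)) = star (p.of (a ⊗ₜ b)) * p.of (a ⊗ₜ b) := by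
        rw [map_mul, map_star]
      change 0 ≤ p.of ((star a * a) ⊗ₜ (star b * b))
      rw [TensorProduct.star_tmul, Algebra.TensorProduct.tmul_mul_tmul] at this
      rw [this]
      exact star_mul_self_nonneg _
  have hC' : ∀ a b, p (a ⊗ₜ b) ≤ C * ‖a‖ * ‖b‖ := fun a b => (p.norm_of _).symm.trans_le (hC a b)
  have key : ∀ (n : ℕ) (a : A) (b : B), p (a ⊗ₜ b) ^ 2 ^ n ≤ C * (‖a‖ * ‖b‖) ^ 2 ^ n := by
    intro n
    induction n with
    | zero => intro a b; simpa [mul_assoc] using hC' a b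
    | succ n ih =>
      intro a b
      have h := ih (star a * a) (star b * b)
      rw [← Algebra.TensorProduct.tmul_mul_tmul, ← TensorProduct.star_tmul, p.star_mul_self,
        CStarRing.norm_star_mul_self, CStarRing.norm_star_mul_self] at h
      rw [pow_succ', pow_mul, pow_mul]
      convert h using 3
      ring
  exact le_of_forall_pow_le (by positivity) fun n => key n a b

variable (A B) in
/-- The maximal C*-norm on the algebraic tensor product of two C*-algebras: the supremum of all
C*-seminorms. -/
def maxTensorNorm : CStarSeminorm (A ⊗[ℂ] B) :=
  CStarSeminorm.sup (fun p : CStarSeminorm (A ⊗[ℂ] B) => p) fun x => by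
    induction x with
    | zero => exact ⟨0, by rintro _ ⟨p, rfl⟩; exact (map_zero p.toSeminorm).le⟩
    | tmul a b => exact ⟨‖a‖ * ‖b‖, by rintro _ ⟨p, rfl⟩; exact p.tmul_le a b⟩
    | add x y hx hy =>
      obtain ⟨c, hc⟩ := hx
      obtain ⟨d, hd⟩ := hy
      refine ⟨c + d, ?_⟩
      rintro _ ⟨p, rfl⟩
      exact (map_add_le_add p.toSeminorm x y).trans (add_le_add (hc ⟨p, rfl⟩) (hd ⟨p, rfl⟩))

end Cross

/-- The maximal tensor product of two C*-algebras. -/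
abbrev MaxTensor (A B : Type*) [NonUnitalCStarAlgebra A] [NonUnitalCStarAlgebra B] : Type _ :=
  (maxTensorNorm A B).Compl

/-! ### The cross-sectional C*-algebra -/

namespace FellBundle

variable {G : Type u} [Group G] (A : FellBundle.{u, v} G)

theorem seminorm_δ_le (p : CStarSeminorm A.Cc) (t : G) (a : A.fiber t) :
    p (A.δ t a) ≤ A.cstarNorm.nrm t a := by
  let φ : A.UnitFiber →⋆ₙₐ[ℂ] p.Compl :=
    { toFun := fun a => p.of (A.δ 1 a)
      map_smul' := fun c a => (congrArg p.of (map_smul (A.δ 1) c a)).trans (map_smul p.of c _)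
      map_zero' := (congrArg p.of (map_zero (A.δ 1))).trans (map_zero p.of)
      map_add' := fun a b =>
        (congrArg p.of (map_add (A.δ 1) a b)).trans (map_add p.of (A.δ 1 a) (A.δ 1 b))
      map_mul' := fun a b =>
        (congrArg p.of (A.δ_mul_δ (one_mul 1) a b).symm).trans (map_mul p.of (A.δ 1 a) (A.δ 1 b))
      map_star' := fun a =>
        (congrArg p.of (A.star_δ inv_one a).symm).trans (map_star p.of (A.δ 1 a)) }
  have h : p (A.δ 1 (A.starMul a a)) ≤ A.cstarNorm.nrm 1 (A.starMul a a) :=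
    (p.norm_of _).symm.trans_le (NonUnitalStarAlgHom.norm_apply_le φ (A.starMulUnit a a))
  rw [A.cstarNorm.starMul_self, A.starMul_apply rfl (inv_mul_cancel t),
    ← A.δ_mul_δ, ← A.star_δ rfl, p.star_mul_self] at h
  exact le_of_sq_le_sq h (apply_nonneg _ _)

/-- The norm of the cross-sectional C*-algebra on `C_c(A)`: the supremum of all C*-seminorms. -/
def univNorm : CStarSeminorm A.Cc :=
  CStarSeminorm.sup (fun p : CStarSeminorm A.Cc => p) fun f => by
    induction f using A.Cc_induction with
    | h0 => exact ⟨0, by rintro _ ⟨p, rfl⟩; exact (map_zero p.toSeminorm).le⟩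
    | hδ t a => exact ⟨A.cstarNorm.nrm t a, by rintro _ ⟨p, rfl⟩; exact A.seminorm_δ_le p t a⟩
    | hadd x y hx hy =>
      obtain ⟨c, hc⟩ := hx
      obtain ⟨d, hd⟩ := hy
      refine ⟨c + d, ?_⟩
      rintro _ ⟨p, rfl⟩
      exact (map_add_le_add p.toSeminorm x y).trans (add_le_add (hc ⟨p, rfl⟩) (hd ⟨p, rfl⟩))

/-- The (full) cross-sectional C*-algebra `C*(A)`: the enveloping C*-algebra of `C_c(A)`. -/
abbrev CStar : Type (max u v) := A.univNorm.Compl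

/-- The canonical map `C_c(A) → C*(A)`. -/
def toCStar : A.Cc →⋆ₙₐ[ℂ] A.CStar := A.univNorm.of

end FellBundle

/-! ### Hilbert modules and adjointable operators -/

/-- A positive sesquilinear form on a complex vector space with values in a C*-algebra,
conjugate linear in the first variable. -/
structure PosForm (V D : Type*) [AddCommGroup V] [Module ℂ V] [NonUnitalCStarAlgebra D]
    [PartialOrder D] [StarOrderedRing D] where
  /-- The form. -/
  ip : V →ₗ⋆[ℂ] V →ₗ[ℂ] D
  star_ip : ∀ x y, star (ip x y) = ip y x
  nonneg : ∀ x, 0 ≤ ip x x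

namespace PosForm

variable {V D : Type*} [AddCommGroup V] [Module ℂ V] [NonUnitalCStarAlgebra D]
    [PartialOrder D] [StarOrderedRing D] (F : PosForm V D)

theorem norm_ip_add_le (x y : V) (c : ℝ) (hc : 0 < c) :
    ‖F.ip (x + y) (x + y)‖ ≤ (1 + c ^ 2) * ‖F.ip x x‖ + (1 + (c⁻¹) ^ 2) * ‖F.ip y y‖ := by
  have h0 := F.nonneg ((c : ℂ) • x - ((c⁻¹ : ℝ) : ℂ) • y)
  have hcc : (c : ℂ) * ((c⁻¹ : ℝ) : ℂ) = 1 := by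
    rw [← Complex.ofReal_mul, mul_inv_cancel₀ hc.ne', Complex.ofReal_one]
  have hcc' : ((c⁻¹ : ℝ) : ℂ) * (c : ℂ) = 1 := by rw [mul_comm, hcc]
  have h1 : F.ip ((c : ℂ) • x - ((c⁻¹ : ℝ) : ℂ) • y) ((c : ℂ) • x - ((c⁻¹ : ℝ) : ℂ) • y) =
      ((c ^ 2 : ℝ) : ℂ) • F.ip x x + (((c⁻¹) ^ 2 : ℝ) : ℂ) • F.ip y y - F.ip x y - F.ip y x := by
    simp only [map_sub, LinearMap.map_smulₛₗ, LinearMap.sub_apply, LinearMap.smul_apply, map_smul,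
      Complex.conj_ofReal, smul_sub, smul_smul, hcc, hcc', one_smul]
    rw [← Complex.ofReal_mul, ← Complex.ofReal_mul, ← sq, ← sq]
    abel
  have h2 : F.ip (x + y) (x + y) ≤
      ((1 + c ^ 2 : ℝ) : ℂ) • F.ip x x + ((1 + (c⁻¹) ^ 2 : ℝ) : ℂ) • F.ip y y := by
    rw [← sub_nonneg]
    convert h0 using 1
    rw [h1, Complex.ofReal_add, Complex.ofReal_add, add_smul, add_smul, Complex.ofReal_one,
      one_smul, one_smul, map_add, map_add, LinearMap.add_apply, LinearMap.add_apply]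
    abel
  refine (CStarAlgebra.norm_le_norm_of_nonneg_of_le (F.nonneg _) h2).trans
    ((norm_add_le _ _).trans (le_of_eq ?_))
  rw [norm_smul, norm_smul, Complex.norm_real, Complex.norm_real,
    Real.norm_of_nonneg (by positivity), Real.norm_of_nonneg (by positivity)]

/-- The seminorm `x ↦ ‖⟨x, x⟩‖^{1/2}`. -/
def nrm (x : V) : ℝ := √‖F.ip x x‖

theorem sq_nrm (x : V) : F.nrm x ^ 2 = ‖F.ip x x‖ := Real.sq_sqrt (norm_nonneg _)

theorem nrm_nonneg (x : V) : 0 ≤ F.nrm x := Real.sqrt_nonneg _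

theorem nrm_add_le (x y : V) : F.nrm (x + y) ≤ F.nrm x + F.nrm y := by
  refine le_of_forall_pos_le_add fun ε hε => ?_
  have ha := F.nrm_nonneg x
  have hb := F.nrm_nonneg y
  set a := F.nrm x + ε / 2 with ha'
  set b := F.nrm y + ε / 2 with hb'
  have ha0 : 0 < a := by positivity
  have hb0 : 0 < b := by positivity
  have hsq : √(b / a) ^ 2 = b / a := Real.sq_sqrt (by positivity)
  have h := F.norm_ip_add_le x y (√(b / a)) (Real.sqrt_pos.mpr (by positivity))
  rw [inv_pow, hsq, inv_div, ← sq_nrm, ← sq_nrm, ← sq_nrm] at h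
  have h3 : F.nrm (x + y) ^ 2 ≤ (a + b) ^ 2 := by
    calc _ ≤ _ := h
      _ ≤ (1 + b / a) * a ^ 2 + (1 + a / b) * b ^ 2 := by
        gcongr <;> linarith
      _ = (a + b) ^ 2 := by field_simp; ring
  have h4 := le_of_sq_le_sq h3 (by positivity)
  linarith

theorem nrm_smul (c : ℂ) (x : V) : F.nrm (c • x) = ‖c‖ * F.nrm x := by
  have : ‖F.ip (c • x) (c • x)‖ = ‖c‖ ^ 2 * ‖F.ip x x‖ := by
    simp only [LinearMap.map_smulₛₗ, LinearMap.smul_apply, map_smul, norm_smul, RCLike.norm_conj]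
    ring
  rw [nrm, this, Real.sqrt_mul (by positivity), Real.sqrt_sq (norm_nonneg c), nrm]

theorem norm_ip_le (x y : V) : ‖F.ip x y‖ ≤ 4 * F.nrm x * F.nrm y := by
  have h1 : ∀ x y, ‖F.ip x y‖ ≤ (F.nrm x + F.nrm y) ^ 2 := by
    intro x y
    have hq : ∀ d : ℂ, ‖d‖ = 1 → ‖F.ip (x + d • y) (x + d • y)‖ ≤ (F.nrm x + F.nrm y) ^ 2 := by
      intro d hd
      rw [← sq_nrm]
      refine pow_le_pow_left₀ (F.nrm_nonneg _) ((F.nrm_add_le _ _).trans ?_) 2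
      rw [nrm_smul, hd, one_mul]
    have hpol : (4 : ℂ) • F.ip x y =
        (F.ip (x + (1 : ℂ) • y) (x + (1 : ℂ) • y) -
          F.ip (x + (-1 : ℂ) • y) (x + (-1 : ℂ) • y)) -
        Complex.I • (F.ip (x + Complex.I • y) (x + Complex.I • y) -
          F.ip (x + (-Complex.I) • y) (x + (-Complex.I) • y)) := by
      simp only [map_add, LinearMap.map_smulₛₗ, LinearMap.add_apply, LinearMap.smul_apply,
        map_smul, map_one, map_neg, Complex.conj_I, smul_add, smul_sub, smul_smul]
      simp only [mul_neg, neg_mul, Complex.I_mul_I, neg_neg, mul_one, one_smul,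
        neg_smul]
      module
    have h4 : ‖(4 : ℂ) • F.ip x y‖ = 4 * ‖F.ip x y‖ := by rw [norm_smul]; norm_num
    have h5 := congrArg norm hpol
    rw [h4] at h5
    have h6 := hq 1 (by simp)
    have h7 := hq (-1) (by simp)
    have h8 := hq Complex.I (by simp)
    have h9 := hq (-Complex.I) (by simp)
    have h10 := norm_sub_le (F.ip (x + (1 : ℂ) • y) (x + (1 : ℂ) • y) -
          F.ip (x + (-1 : ℂ) • y) (x + (-1 : ℂ) • y))
        (Complex.I • (F.ip (x + Complex.I • y) (x + Complex.I • y) -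
          F.ip (x + (-Complex.I) • y) (x + (-Complex.I) • y)))
    have h11 := norm_sub_le (F.ip (x + (1 : ℂ) • y) (x + (1 : ℂ) • y))
      (F.ip (x + (-1 : ℂ) • y) (x + (-1 : ℂ) • y))
    have h12 := norm_sub_le (F.ip (x + Complex.I • y) (x + Complex.I • y))
      (F.ip (x + (-Complex.I) • y) (x + (-Complex.I) • y))
    rw [norm_smul, Complex.norm_I, one_mul] at h10
    linarith
  have h2 : ∀ ε > 0, ‖F.ip x y‖ ≤ 4 * (F.nrm x + ε) * (F.nrm y + ε) := by
    intro ε hε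
    have ha := F.nrm_nonneg x
    have hb := F.nrm_nonneg y
    set a := F.nrm x + ε with ha'
    set b := F.nrm y + ε with hb'
    have ha0 : 0 < a := by positivity
    have hb0 : 0 < b := by positivity
    have hc0 : 0 < √(b / a) := Real.sqrt_pos.mpr (by positivity)
    have hsq : √(b / a) ^ 2 = b / a := Real.sq_sqrt (by positivity)
    have hcc : (((√(b / a))⁻¹ : ℝ) : ℂ) * ((√(b / a) : ℝ) : ℂ) = 1 := by
      rw [← Complex.ofReal_mul, inv_mul_cancel₀ hc0.ne', Complex.ofReal_one]
    have h3 := h1 (((√(b / a) : ℝ) : ℂ) • x) ((((√(b / a))⁻¹ : ℝ) : ℂ) • y)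
    rw [map_smul (F.ip _), LinearMap.map_smulₛₗ F.ip, LinearMap.smul_apply, Complex.conj_ofReal,
      smul_smul, hcc, one_smul, nrm_smul, nrm_smul, Complex.norm_real, Complex.norm_real,
      norm_inv, Real.norm_of_nonneg hc0.le] at h3
    have h4 : √(b / a) * a = (√(b / a))⁻¹ * b := by
      rw [eq_inv_mul_iff_mul_eq₀ hc0.ne', ← mul_assoc, ← sq, hsq, div_mul_cancel₀ _ ha0.ne']
    calc _ ≤ _ := h3
      _ ≤ (√(b / a) * a + (√(b / a))⁻¹ * b) ^ 2 := by
        gcongr <;> linarith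
      _ = (2 * (√(b / a) * a)) ^ 2 := by rw [← h4]; ring
      _ = 4 * √(b / a) ^ 2 * a ^ 2 := by ring
      _ = 4 * a * b := by rw [hsq]; field_simp
  have h5 : Filter.Tendsto (fun ε : ℝ => 4 * (F.nrm x + ε) * (F.nrm y + ε))
      (nhdsWithin 0 (Set.Ioi 0)) (nhds (4 * (F.nrm x + 0) * (F.nrm y + 0))) :=
    (Continuous.tendsto (by fun_prop) 0).mono_left nhdsWithin_le_nhds
  rw [add_zero, add_zero] at h5
  exact ge_of_tendsto h5 (eventually_nhdsWithin_of_forall h2)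

/-- The space `V`, regarded as a seminormed space with the norm `‖⟨x, x⟩‖^{1/2}`. -/
def Pre (_F : PosForm V D) : Type _ := V

instance : SeminormedAddCommGroup F.Pre :=
  AddGroupSeminorm.toSeminormedAddCommGroup (E := V)
    { toFun := F.nrm
      map_zero' := by simp [nrm]
      add_le' := F.nrm_add_le
      neg' := fun x => by simp [nrm] }

instance : NormedSpace ℂ F.Pre where
  __ := (inferInstance : Module ℂ V)
  norm_smul_le c x := (F.nrm_smul c x).le

/-- The Hilbert module given by a positive form: the separated completion of `V`. -/
def Hilb : Type _ := Completion F.Pre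

instance : NormedAddCommGroup F.Hilb := inferInstanceAs (NormedAddCommGroup (Completion F.Pre))
instance : NormedSpace ℂ F.Hilb := inferInstanceAs (NormedSpace ℂ (Completion F.Pre))
instance : CompleteSpace F.Hilb := inferInstanceAs (CompleteSpace (Completion F.Pre))

/-- The canonical map of `V` into the Hilbert module. -/
def toHilb : V →ₗ[ℂ] F.Hilb := (Completion.toComplₗᵢ : F.Pre →ₗᵢ[ℂ] F.Hilb).toLinearMap

theorem denseRange_toHilb : DenseRange F.toHilb := Completion.denseRange_coe (α := F.Pre)

theorem norm_toHilb (x : V) : ‖F.toHilb x‖ = F.nrm x := Completion.norm_coe (E := F.Pre) x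

theorem hilb_induction {q : F.Hilb → Prop} (hc : IsClosed {x | q x})
    (h : ∀ x : V, q (F.toHilb x)) (x : F.Hilb) : q x :=
  Completion.induction_on (α := F.Pre) x hc h

/-- The inner product of the Hilbert module. -/
def inner : F.Hilb →L⋆[ℂ] F.Hilb →L[ℂ] D :=
  bilinExt (V := F.Pre) (W := F.Pre) F.ip ⟨4, F.norm_ip_le⟩

theorem inner_coe (x y : V) : F.inner (F.toHilb x) (F.toHilb y) = F.ip x y :=
  bilinExt_coe (V := F.Pre) (W := F.Pre) _ _ x y

theorem star_inner (x y : F.Hilb) : star (F.inner x y) = F.inner y x := by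
  induction x using F.hilb_induction with
  | hc => exact isClosed_eq (by fun_prop) (by fun_prop)
  | h x =>
  induction y using F.hilb_induction with
  | hc => exact isClosed_eq (by fun_prop) (by fun_prop)
  | h y => rw [inner_coe, inner_coe, star_ip]

theorem norm_inner_self (x : F.Hilb) : ‖F.inner x x‖ = ‖x‖ ^ 2 := by
  induction x using F.hilb_induction with
  | hc => exact isClosed_eq (by fun_prop) (by fun_prop)
  | h x => rw [inner_coe, norm_toHilb, sq_nrm]

theorem norm_inner_le (x y : F.Hilb) : ‖F.inner x y‖ ≤ 4 * ‖x‖ * ‖y‖ := by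
  induction x using F.hilb_induction with
  | hc => exact isClosed_le (by fun_prop) (by fun_prop)
  | h x =>
  induction y using F.hilb_induction with
  | hc => exact isClosed_le (by fun_prop) (by fun_prop)
  | h y => rw [inner_coe, norm_toHilb, norm_toHilb]; exact F.norm_ip_le x y

theorem ext_inner {x y : F.Hilb} (h : ∀ z, F.inner z x = F.inner z y) : x = y := by
  have h1 : F.inner (x - y) (x - y) = 0 := by rw [map_sub (F.inner (x - y)), h, sub_self]
  have h2 := F.norm_inner_self (x - y)
  rw [h1, norm_zero] at h2
  exact sub_eq_zero.mp (norm_eq_zero.mp (pow_eq_zero_iff two_ne_zero |>.mp h2.symm))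

/-- The adjointable operators, as a subalgebra of the bounded operators on the Hilbert module. -/
def adjSubalgebra : Subalgebra ℂ (F.Hilb →L[ℂ] F.Hilb) where
  carrier := {T | ∃ S : F.Hilb →L[ℂ] F.Hilb, ∀ x y, F.inner (T x) y = F.inner x (S y)}
  mul_mem' := by
    rintro T T' ⟨S, hS⟩ ⟨S', hS'⟩
    exact ⟨S' * S, fun x y => (hS _ _).trans (hS' _ _)⟩
  add_mem' := by
    rintro T T' ⟨S, hS⟩ ⟨S', hS'⟩
    refine ⟨S + S', fun x y => ?_⟩
    simp [hS, hS']
  algebraMap_mem' c := by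
    refine ⟨algebraMap ℂ _ (star c), fun x y => ?_⟩
    simp [Algebra.algebraMap_eq_smul_one]

/-- The algebra of adjointable operators on the Hilbert module, with the operator norm.
(Adjointable operators are automatically module maps.) -/
def Adj : Type _ := F.adjSubalgebra

instance : NormedRing F.Adj := inferInstanceAs (NormedRing F.adjSubalgebra)
instance : NormedAlgebra ℂ F.Adj := inferInstanceAs (NormedAlgebra ℂ F.adjSubalgebra)

/-- An adjointable operator, as a bounded operator. -/
def Adj.op {F : PosForm V D} (T : F.Adj) : F.Hilb →L[ℂ] F.Hilb := Subtype.val T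

/-- The adjoint of an adjointable operator. -/
instance : Star F.Adj where
  star T := (⟨(Subtype.property T).choose, T.op, fun x y => by
    rw [← F.star_inner, ← (Subtype.property T).choose_spec, F.star_inner]
    rfl⟩ : F.adjSubalgebra)

theorem inner_apply_left (T : F.Adj) (x y : F.Hilb) :
    F.inner (T.op x) y = F.inner x ((star T).op y) := (Subtype.property T).choose_spec x y

theorem inner_apply_right (T : F.Adj) (x y : F.Hilb) :
    F.inner x (T.op y) = F.inner ((star T).op x) y := by
  rw [← F.star_inner, inner_apply_left, F.star_inner]

theorem Adj.ext {F : PosForm V D} {S T : F.Adj} (h : ∀ x, S.op x = T.op x) : S = T :=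
  Subtype.ext (ContinuousLinearMap.ext h)

theorem star_eq_of_adjoint {T S : F.Adj} (h : ∀ x y, F.inner (T.op x) y = F.inner x (S.op y)) :
    star T = S :=
  Adj.ext fun y => F.ext_inner fun x => by rw [← inner_apply_left, h]

instance : StarRing F.Adj where
  star_involutive T := F.star_eq_of_adjoint fun x y => (F.inner_apply_right T x y).symm
  star_mul S T := F.star_eq_of_adjoint fun x y =>
    (F.inner_apply_left S _ _).trans (F.inner_apply_left T _ _)
  star_add S T := F.star_eq_of_adjoint fun x y => by
    change F.inner (S.op x + T.op x) y = F.inner x ((star S).op y + (star T).op y)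
    rw [map_add, map_add, add_apply, inner_apply_left, inner_apply_left]

instance : StarModule ℂ F.Adj where
  star_smul c T := F.star_eq_of_adjoint fun x y => by
    change F.inner (c • T.op x) y = F.inner x (star c • (star T).op y)
    rw [map_smulₛₗ, map_smul, smul_apply, inner_apply_left]
    rfl

instance : ContinuousStar F.Adj where
  continuous_star := by
    refine AddMonoidHomClass.continuous_of_bound (starAddEquiv : F.Adj ≃+ F.Adj) 4 fun T => ?_
    change ‖(star T).op‖ ≤ 4 * ‖T.op‖
    refine ContinuousLinearMap.opNorm_le_bound _ (by positivity) fun x => ?_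
    have h := F.norm_inner_le (T.op ((star T).op x)) x
    rw [inner_apply_left, norm_inner_self] at h
    have h2 := T.op.le_opNorm ((star T).op x)
    rcases (norm_nonneg ((star T).op x)).eq_or_lt with h0 | h0
    · rw [← h0]; positivity
    · refine le_of_mul_le_mul_right ?_ h0
      calc _ = ‖(star T).op x‖ ^ 2 := (sq _).symm
        _ ≤ _ := h
        _ ≤ 4 * (‖T.op‖ * ‖(star T).op x‖) * ‖x‖ := by gcongr
        _ = _ := by ring

end PosForm

/-! ### The reduced cross-sectional C*-algebra -/

namespace FellBundle

variable {G : Type u} [Group G] (A : FellBundle.{u, v} G)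

/-- The value at `e` of a section, as an element of the C*-algebra `A_e`. -/
def evUnit : A.Cc →ₗ[ℂ] A.UnitFiber := A.ev 1

theorem evUnit_star (f : A.Cc) : A.evUnit (star f) = star (A.evUnit f) := by
  induction f using A.Cc_induction with
  | h0 => simp
  | hadd f g hf hg => simp [hf, hg]
  | hδ t a =>
    rw [A.star_δ rfl]
    by_cases h : t = 1
    · subst h
      have : A.δ 1⁻¹ (A.starMap rfl a) = A.δ 1 (A.starMap inv_one a) := by
        rw [← A.star_δ rfl, A.star_δ inv_one]
      rw [this]
      exact (A.ev_δ_same _ _).trans (congrArg (A.starMap inv_one) (A.ev_δ_same 1 a)).symm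
    · have h1 : A.evUnit (A.δ t⁻¹ (A.starMap rfl a)) = 0 :=
        A.ev_δ_ne (fun h' => h (inv_eq_one.mp h')) _
      have h2 : A.evUnit (A.δ t a) = 0 := A.ev_δ_ne h a
      rw [h1, h2, star_zero]

open scoped Classical in
theorem evUnit_star_mul (f g : A.Cc) (S : Finset G) (hf : ∀ t ∉ S, A.ev t f = 0) :
    A.evUnit (star f * g) = ∑ t ∈ S, A.starMulUnit (A.ev t f) (A.ev t g) :=
  A.ev_one_star_mul f g S hf

theorem exists_support (f : A.Cc) : ∃ S : Finset G, ∀ t ∉ S, A.ev t f = 0 := by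
  classical
  exact ⟨DFinsupp.support (show Π₀ t, A.fiber t from f), fun t ht =>
    DFinsupp.notMem_support_iff.mp ht⟩

/-- The `A_e`-valued inner product `⟨f, g⟩ = (f* * g)(e) = ∑ₜ f(t)* g(t)` on `C_c(A)`. -/
def l2Form : PosForm A.Cc A.UnitFiber where
  ip := ((LinearMap.mul ℂ A.Cc).compr₂ A.evUnit).comp
    (starLinearEquiv ℂ (A := A.Cc) : A.Cc →ₗ⋆[ℂ] A.Cc)
  star_ip f g := by
    change star (A.evUnit (star f * g)) = A.evUnit (star g * f)
    rw [← evUnit_star, star_mul, star_star]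
  nonneg f := by
    change 0 ≤ A.evUnit (star f * f)
    obtain ⟨S, hS⟩ := A.exists_support f
    rw [A.evUnit_star_mul f f S hS]
    exact Finset.sum_nonneg fun t _ => A.starMulUnit_nonneg _

theorem l2Form_ip (f g : A.Cc) : A.l2Form.ip f g = A.evUnit (star f * g) := rfl

/-- The right Hilbert `A_e`-module `ℓ²(A)`, as the completion of `C_c(A)`. -/
abbrev L2 : Type (max u v) := A.l2Form.Hilb

/-- The canonical map `C_c(A) → ℓ²(A)`. -/
def toL2 : A.Cc →ₗ[ℂ] A.L2 := A.l2Form.toHilb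

/-- The algebra `𝓛(ℓ²(A))` of adjointable operators on `ℓ²(A)`. -/
abbrev AdjL2 : Type (max u v) := A.l2Form.Adj

/-- Left convolution by `δ_b`, `b ∈ A_t`, is the operator `ξ ↦ (s ↦ b ξ(t⁻¹s))`. -/
theorem ev_δ_mul {s t : G} (b : A.fiber t) (ξ : A.Cc) :
    A.ev s (A.δ t b * ξ) = A.mulMap (mul_inv_cancel_left t s) b (A.ev (t⁻¹ * s) ξ) := by
  induction ξ using A.Cc_induction with
  | h0 => simp
  | hadd f g hf hg => rw [mul_add, map_add, hf, hg, map_add, map_add]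
  | hδ r a =>
    by_cases h : r = t⁻¹ * s
    · subst h
      rw [A.δ_mul_δ (mul_inv_cancel_left t s), A.ev_δ_same, A.ev_δ_same]
    · rw [A.δ_mul_δ rfl, A.ev_δ_ne, A.ev_δ_ne h, map_zero]
      rintro rfl
      exact h (inv_mul_cancel_left t r).symm

theorem norm_id_le (h : A.UnitFiber) (hsa : IsSelfAdjoint h) {x : ℝ}
    (hx : x ∈ quasispectrum ℝ h) : |x| ≤ ‖h‖ := by
  have := norm_apply_le_norm_cfcₙ (𝕜 := ℝ) (id : ℝ → ℝ) h hx
  rwa [cfcₙ_id ℝ h] at this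

theorem exists_contraction (h : A.UnitFiber) (h0 : 0 ≤ h) (h1 : ‖h‖ ≤ 1) :
    ∃ k : A.UnitFiber, star k = k ∧ k + k - k * k = h := by
  let f : ℝ → ℝ := fun x => 1 - √(1 - x)
  have hf : Continuous f := by fun_prop
  have hf0 : f 0 = 0 := by simp [f]
  have hsa : IsSelfAdjoint h := .of_nonneg h0
  refine ⟨cfcₙ f h, cfcₙ_predicate f h, ?_⟩
  rw [← cfcₙ_add .., ← cfcₙ_mul .., ← cfcₙ_sub ..]
  conv_rhs => rw [← cfcₙ_id ℝ h]
  refine cfcₙ_congr fun x hx => ?_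
  have hx1 : x ≤ 1 :=
    (le_abs_self x).trans ((A.norm_id_le h hsa hx).trans h1)
  have := Real.sq_sqrt (sub_nonneg.mpr hx1)
  simp only [f, id]
  nlinarith

/-- The inclusion of the unit fiber into `C_c(A)`. -/
def δUnit : A.UnitFiber →ₗ[ℂ] A.Cc := A.δ 1

theorem star_δUnit (k : A.UnitFiber) : star (A.δUnit k) = A.δUnit (star k) :=
  A.star_δ inv_one _

theorem δUnit_mul (k l : A.UnitFiber) : A.δUnit k * A.δUnit l = A.δUnit (k * l) :=
  A.δ_mul_δ (one_mul 1) _ _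

theorem ip_δ_le (h : A.UnitFiber) (h0 : 0 ≤ h) (h1 : ‖h‖ ≤ 1) (ξ : A.Cc) :
    A.l2Form.ip ξ (A.δUnit h * ξ) ≤ A.l2Form.ip ξ ξ := by
  obtain ⟨k, hk, hkh⟩ := A.exists_contraction h h0 h1
  have hs : star (A.δUnit k) = A.δUnit k := by rw [star_δUnit, hk]
  have hm : A.δUnit k + A.δUnit k - A.δUnit k * A.δUnit k = A.δUnit h := by
    rw [δUnit_mul, ← map_add, ← map_sub, hkh]
  have hp := A.l2Form.nonneg (ξ - A.δUnit k * ξ)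
  rw [← sub_nonneg]
  convert hp using 1
  simp only [l2Form_ip]
  rw [← map_sub, ← hm]
  congr 1
  simp only [star_sub, star_mul, hs]
  noncomm_ring

/-- Left convolution by a section is bounded for the norm of `ℓ²(A)`. -/
theorem exists_bound_mul (f : A.Cc) :
    ∃ C : ℝ, ∀ ξ : A.Cc, ‖A.toL2 (f * ξ)‖ ≤ C * A.l2Form.nrm ξ := by
  induction f using A.Cc_induction with
  | h0 => exact ⟨0, fun ξ => by simp⟩
  | hadd f g hf hg =>
    obtain ⟨C, hC⟩ := hf
    obtain ⟨D, hD⟩ := hg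
    refine ⟨C + D, fun ξ => ?_⟩
    rw [add_mul, map_add, add_mul]
    exact (norm_add_le _ _).trans (add_le_add (hC ξ) (hD ξ))
  | hδ t b =>
    let h : A.UnitFiber := A.starMulUnit b b
    have hh : 0 ≤ h := A.starMulUnit_nonneg b
    let K : ℝ := ‖h‖ + 1
    have hK : 0 < K := by positivity
    refine ⟨√K, fun ξ => ?_⟩
    have h1 : (0 : A.UnitFiber) ≤ K⁻¹ • h := smul_nonneg (by positivity) hh
    have h2 : ‖K⁻¹ • h‖ ≤ 1 := by
      rw [norm_smul, norm_inv, Real.norm_of_nonneg hK.le, inv_mul_le_iff₀ hK]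
      simp [K]
    have h3 := A.ip_δ_le (K⁻¹ • h) h1 h2 ξ
    have h4 : A.l2Form.ip (A.δ t b * ξ) (A.δ t b * ξ) =
        ((K : ℝ) : ℂ) • A.l2Form.ip ξ (A.δUnit (K⁻¹ • h) * ξ) := by
      have h5 : star (A.δ t b) * A.δ t b = A.δUnit h := by
        rw [A.star_δ rfl, A.δ_mul_δ (inv_mul_cancel t)]
        rfl
      have h6 : (K⁻¹ • h : A.UnitFiber) = ((K⁻¹ : ℝ) : ℂ) • h := rfl
      have h7 : A.δUnit (K⁻¹ • h : A.UnitFiber) = ((K⁻¹ : ℝ) : ℂ) • A.δUnit h := by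
        rw [h6]
        exact map_smul A.δUnit _ _
      rw [h7, smul_mul_assoc, map_smul, smul_smul, ← Complex.ofReal_mul,
        mul_inv_cancel₀ hK.ne', Complex.ofReal_one, one_smul, l2Form_ip, l2Form_ip, ← h5,
        star_mul, mul_assoc, mul_assoc]
    have h8 : 0 ≤ A.l2Form.ip ξ (A.δUnit (K⁻¹ • h) * ξ) := by
      have h9 := A.l2Form.nonneg (A.δ t b * ξ)
      have h10 : A.l2Form.ip ξ (A.δUnit (K⁻¹ • h) * ξ) =
          K⁻¹ • A.l2Form.ip (A.δ t b * ξ) (A.δ t b * ξ) := by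
        rw [h4, Complex.coe_smul, smul_smul, inv_mul_cancel₀ hK.ne', one_smul]
      rw [h10]
      exact smul_nonneg (by positivity) h9
    have h11 := CStarAlgebra.norm_le_norm_of_nonneg_of_le h8 h3
    rw [toL2, PosForm.norm_toHilb, PosForm.nrm, PosForm.nrm, h4, norm_smul, Complex.norm_real,
      Real.norm_of_nonneg hK.le, ← Real.sqrt_mul hK.le]
    gcongr

/-- The operator on `ℓ²(A)` that extends left convolution by `f ∈ C_c(A)`. -/
def leftConv (f : A.Cc) : A.L2 →L[ℂ] A.L2 :=
  linExt (V := A.l2Form.Pre)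
    (A.toL2.comp (LinearMap.mulLeft ℂ f) : A.Cc →ₗ[ℂ] A.L2)

theorem leftConv_toL2 (f ξ : A.Cc) : A.leftConv f (A.toL2 ξ) = A.toL2 (f * ξ) :=
  linExt_coe (V := A.l2Form.Pre) (F := A.L2)
    (A.toL2.comp (LinearMap.mulLeft ℂ f) : A.Cc →ₗ[ℂ] A.L2) (A.exists_bound_mul f) ξ

theorem inner_leftConv (f : A.Cc) (x y : A.L2) :
    A.l2Form.inner (A.leftConv f x) y = A.l2Form.inner x (A.leftConv (star f) y) := by
  induction x using A.l2Form.hilb_induction with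
  | hc => exact isClosed_eq (by fun_prop) (by fun_prop)
  | h x =>
  induction y using A.l2Form.hilb_induction with
  | hc => exact isClosed_eq (by fun_prop) (by fun_prop)
  | h y =>
    change A.l2Form.inner (A.leftConv f (A.toL2 x)) (A.toL2 y) =
      A.l2Form.inner (A.toL2 x) (A.leftConv (star f) (A.toL2 y))
    rw [leftConv_toL2, leftConv_toL2, toL2, PosForm.inner_coe, PosForm.inner_coe, l2Form_ip,
      l2Form_ip, star_mul, mul_assoc]

theorem leftConv_ext {S T : A.L2 →L[ℂ] A.L2} (h : ∀ ξ, S (A.toL2 ξ) = T (A.toL2 ξ)) : S = T := by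
  ext x
  induction x using A.l2Form.hilb_induction with
  | hc => exact isClosed_eq (by fun_prop) (by fun_prop)
  | h x => exact h x

/-- The operator of left convolution by `f ∈ C_c(A)`, as an adjointable operator. -/
def leftConvAdj (f : A.Cc) : A.AdjL2 :=
  (⟨A.leftConv f, A.leftConv (star f), A.inner_leftConv f⟩ : A.l2Form.adjSubalgebra)

/-- The left regular representation of `C_c(A)` on `ℓ²(A)`. -/
def regRep : A.Cc →⋆ₙₐ[ℂ] A.AdjL2 where
  toFun f := A.leftConvAdj f
  map_smul' c f := Subtype.ext <| A.leftConv_ext fun ξ => by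
    change A.leftConv (c • f) (A.toL2 ξ) = c • A.leftConv f (A.toL2 ξ)
    rw [leftConv_toL2, leftConv_toL2, smul_mul_assoc, map_smul]
  map_zero' := Subtype.ext <| A.leftConv_ext fun ξ => by
    change A.leftConv 0 (A.toL2 ξ) = 0
    rw [leftConv_toL2, zero_mul, map_zero]
  map_add' f g := Subtype.ext <| A.leftConv_ext fun ξ => by
    change A.leftConv (f + g) (A.toL2 ξ) = A.leftConv f (A.toL2 ξ) + A.leftConv g (A.toL2 ξ)
    rw [leftConv_toL2, leftConv_toL2, leftConv_toL2, add_mul, map_add]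
  map_mul' f g := Subtype.ext <| A.leftConv_ext fun ξ => by
    change A.leftConv (f * g) (A.toL2 ξ) = A.leftConv f (A.leftConv g (A.toL2 ξ))
    rw [leftConv_toL2, leftConv_toL2, leftConv_toL2, mul_assoc]
  map_star' f := (A.l2Form.star_eq_of_adjoint
    (T := A.leftConvAdj f) (S := A.leftConvAdj (star f))
    (A.inner_leftConv f)).symm

/-- The reduced cross-sectional C*-algebra `C*_r(A)`: the closed *-subalgebra of `𝓛(ℓ²(A))`
generated by the operators `Λ(b)`, `b ∈ A_t`, `t ∈ G`. -/
def CStarRed : NonUnitalStarSubalgebra ℂ A.AdjL2 :=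
  (NonUnitalStarAlgebra.adjoin ℂ
    {T | ∃ (t : G) (b : A.fiber t), T = A.regRep (A.δ t b)}).topologicalClosure

end FellBundle

/-! ### Tensor products of Fell bundles -/

namespace StarBundle

variable {G : Type u₁} [Group G] {H : Type u₂} [Group H]

/-- The algebraic tensor product of two *-algebraic bundles: the *-algebraic bundle over `G × H`
with the fibers `A_t ⊙ B_s`, the product `(a ⊗ b)(a' ⊗ b') = aa' ⊗ bb'` and the involution
`(a ⊗ b)* = a* ⊗ b*`. -/
def tensor (P : StarBundle.{u₁, v₁} G) (Q : StarBundle.{u₂, v₂} H) :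
    StarBundle.{max u₁ u₂, max v₁ v₂} (G × H) where
  fiber r := P.fiber r.1 ⊗[ℂ] Q.fiber r.2
  mulMap h := TensorProduct.map₂ (P.mulMap (congrArg Prod.fst h)) (Q.mulMap (congrArg Prod.snd h))
  starMap h := TensorProduct.map (P.starMap (congrArg Prod.fst h)) (Q.starMap (congrArg Prod.snd h))
  mulMap_assoc h₁ h₂ h₃ h₄ x y z := by
    induction x with
    | zero => simp
    | add x x' h h' => simp only [map_add, LinearMap.add_apply, h, h']
    | tmul a b =>
    induction y with
    | zero => simp
    | add x x' h h' => simp only [map_add, LinearMap.add_apply, h, h']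
    | tmul a' b' =>
    induction z with
    | zero => simp
    | add x x' h h' => simp only [map_add, h, h']
    | tmul a'' b'' =>
      simp only [TensorProduct.map₂_apply_tmul, TensorProduct.map_tmul]
      rw [P.mulMap_assoc _ _ (congrArg Prod.fst h₃) (congrArg Prod.fst h₄),
        Q.mulMap_assoc _ _ (congrArg Prod.snd h₃) (congrArg Prod.snd h₄)]
  starMap_mulMap h hs ht hr h' x y := by
    induction x with
    | zero => simp
    | add x x' h h' => simp only [map_add, LinearMap.add_apply, h, h']
    | tmul a b =>
    induction y with
    | zero => simp
    | add x x' h h' => simp only [map_add, LinearMap.add_apply, h, h']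
    | tmul a' b' =>
      simp only [TensorProduct.map₂_apply_tmul, TensorProduct.map_tmul]
      rw [P.starMap_mulMap _ (congrArg Prod.fst hs) (congrArg Prod.fst ht) _
          (congrArg Prod.fst h'),
        Q.starMap_mulMap _ (congrArg Prod.snd hs) (congrArg Prod.snd ht) _
          (congrArg Prod.snd h')]
  starMap_starMap h h' x := by
    induction x with
    | zero => simp
    | add x x' h h' => simp only [map_add, h, h']
    | tmul a b => simp only [TensorProduct.map_tmul, starMap_starMap]

variable (P : StarBundle.{u₁, v₁} G) (Q : StarBundle.{u₂, v₂} H)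

/-- The elementary tensor `a ⊗ b ∈ A_t ⊙ B_s`. -/
def tmul {t : G} {s : H} : P.fiber t →ₗ[ℂ] Q.fiber s →ₗ[ℂ] (P.tensor Q).fiber (t, s) :=
  TensorProduct.mk ℂ (P.fiber t) (Q.fiber s)

theorem starMul_tmul {t : G} {s : H} (a a' : P.fiber t) (b b' : Q.fiber s) :
    (P.tensor Q).starMul (P.tmul Q a b) (P.tmul Q a' b') =
      P.tmul Q (P.starMul a a') (Q.starMul b b') := rfl

end StarBundle

/-! ### The reduced tensor product -/

namespace FellBundle

variable {G : Type u₁} [Group G] {H : Type u₂} [Group H]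
  (A : FellBundle.{u₁, v₁} G) (B : FellBundle.{u₂, v₂} H)

/-- The algebraic tensor product `A ⊙ B` of two Fell bundles, a *-algebraic bundle over `G × H`. -/
abbrev tensor : StarBundle.{max u₁ u₂, max v₁ v₂} (G × H) := A.toStarBundle.tensor B.toStarBundle

end FellBundle

namespace StarBundle.CStarNorm

variable {G : Type u₁} [Group G] {H : Type u₂} [Group H]
  {A : FellBundle.{u₁, v₁} G} {B : FellBundle.{u₂, v₂} H} (α : (A.tensor B).CStarNorm)

/-- The Fell bundle `A ⊗_α B` over `G × H`. -/
abbrev tensorBundle : FellBundle.{max u₁ u₂, max v₁ v₂} (G × H) := α.compl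

/-- The elementary tensor `a ⊗ b ∈ A_t ⊗_α B_s`. -/
def tmul {t : G} {s : H} : A.fiber t →ₗ[ℂ] B.fiber s →ₗ[ℂ] α.tensorBundle.fiber (t, s) :=
  (A.toStarBundle.tmul B.toStarBundle).compr₂ α.toCompl

/-- The map `(a, b) ↦ a ⊗ b`, from `A_e` and `B_e` to the C*-algebra `A_e ⊗_α B_e`. -/
def tmulUnit : A.UnitFiber →ₗ[ℂ] B.UnitFiber →ₗ[ℂ] α.tensorBundle.UnitFiber :=
  (α.tmul : A.fiber 1 →ₗ[ℂ] B.fiber 1 →ₗ[ℂ] α.tensorBundle.fiber (1, 1))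

theorem tmulUnit_starMul {t : G} {s : H} (a a' : A.fiber t) (b b' : B.fiber s) :
    α.tmulUnit (A.starMulUnit a a') (B.starMulUnit b b') =
      α.tensorBundle.starMulUnit (α.tmul a b) (α.tmul a' b') :=
  (α.smCompl_coe (t := (t, s)) (A.toStarBundle.tmul B.toStarBundle a b)
    (A.toStarBundle.tmul B.toStarBundle a' b')).symm

theorem star_tmulUnit (a : A.UnitFiber) (b : B.UnitFiber) :
    star (α.tmulUnit a b) = α.tmulUnit (star a) (star b) :=
  α.starCompl_coe (s := ((1, 1) : G × H)) (t := (1, 1)) inv_one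
    (A.toStarBundle.tmul B.toStarBundle (t := 1) (s := 1) a b)

theorem exists_bound_tmulUnit :
    ∃ C, ∀ a b, ‖α.tmulUnit a b‖ ≤ C * ‖a‖ * ‖b‖ :=
  exists_bound_of_pos α.tmulUnit fun a b => by
    have ha : star a * a = A.starMulUnit (t := 1) a a :=
      (A.starMul_apply inv_one (one_mul 1) a a).symm
    have hb : star b * b = B.starMulUnit (t := 1) b b :=
      (B.starMul_apply inv_one (one_mul 1) b b).symm
    rw [ha, hb]
    exact (α.tensorBundle.starMulUnit_nonneg _).trans_eq (α.tmulUnit_starMul a a b b).symm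

/-- The form `⟨ξ ⊗ η, ξ' ⊗ η'⟩ = ⟨ξ, ξ'⟩ ⊗ ⟨η, η'⟩` on `ℓ²(A) ⊙ ℓ²(B)`. -/
def tensorIp : A.L2 ⊗[ℂ] B.L2 →ₗ⋆[ℂ] A.L2 ⊗[ℂ] B.L2 →ₗ[ℂ] α.tensorBundle.UnitFiber :=
  TensorProduct.lift <| LinearMap.mk₂'ₛₗ (starRingEnd ℂ) (starRingEnd ℂ)
    (fun x y => TensorProduct.lift
      (α.tmulUnit.compl₁₂ (A.l2Form.inner x).toLinearMap (B.l2Form.inner y).toLinearMap))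
    (fun x x' y => by ext z w; simp)
    (fun c x y => by ext z w; simp)
    (fun x y y' => by ext z w; simp)
    (fun c x y => by ext z w; simp)

theorem tensorIp_tmul (x z : A.L2) (y w : B.L2) :
    α.tensorIp (x ⊗ₜ y) (z ⊗ₜ w) = α.tmulUnit (A.l2Form.inner x z) (B.l2Form.inner y w) := by
  simp [tensorIp]

theorem tensorIp_sum {ι : Type*} (S : Finset ι) (x : ι → A.L2) (y : ι → B.L2) :
    α.tensorIp (∑ i ∈ S, x i ⊗ₜ y i) (∑ i ∈ S, x i ⊗ₜ y i) =
      ∑ i ∈ S, ∑ j ∈ S, α.tmulUnit (A.l2Form.inner (x i) (x j)) (B.l2Form.inner (y i) (y j)) := by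
  simp only [map_sum, LinearMap.sum_apply, tensorIp_tmul]
  exact Finset.sum_comm

theorem sum_tmulUnit_nonneg {ι : Type*} (S : Finset ι) (f : ι → A.Cc) (g : ι → B.Cc) :
    0 ≤ ∑ i ∈ S, ∑ j ∈ S,
      α.tmulUnit (A.l2Form.ip (f i) (f j)) (B.l2Form.ip (g i) (g j)) := by
  classical
  choose S₁ h₁ using fun i => A.exists_support (f i)
  choose S₂ h₂ using fun i => B.exists_support (g i)
  have e₁ : ∀ i ∈ S, ∀ j, A.l2Form.ip (f i) (f j) =
      ∑ t ∈ S.biUnion S₁, A.starMulUnit (A.ev t (f i)) (A.ev t (f j)) := fun i hi j =>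
    A.evUnit_star_mul _ _ _ fun t ht => h₁ i t fun h => ht (Finset.mem_biUnion.mpr ⟨i, hi, h⟩)
  have e₂ : ∀ i ∈ S, ∀ j, B.l2Form.ip (g i) (g j) =
      ∑ s ∈ S.biUnion S₂, B.starMulUnit (B.ev s (g i)) (B.ev s (g j)) := fun i hi j =>
    B.evUnit_star_mul _ _ _ fun t ht => h₂ i t fun h => ht (Finset.mem_biUnion.mpr ⟨i, hi, h⟩)
  have e : ∑ i ∈ S, ∑ j ∈ S, α.tmulUnit (A.l2Form.ip (f i) (f j)) (B.l2Form.ip (g i) (g j)) =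
      ∑ t ∈ S.biUnion S₁, ∑ s ∈ S.biUnion S₂, α.tensorBundle.starMulUnit
        (∑ i ∈ S, α.tmul (A.ev t (f i)) (B.ev s (g i)))
        (∑ i ∈ S, α.tmul (A.ev t (f i)) (B.ev s (g i))) := by
    have e₃ : ∀ i ∈ S, ∀ j ∈ S,
        α.tmulUnit (A.l2Form.ip (f i) (f j)) (B.l2Form.ip (g i) (g j)) =
        ∑ t ∈ S.biUnion S₁, ∑ s ∈ S.biUnion S₂, α.tensorBundle.starMulUnit
          (α.tmul (A.ev t (f i)) (B.ev s (g i))) (α.tmul (A.ev t (f j)) (B.ev s (g j))) := by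
      intro i hi j _
      rw [e₁ i hi, e₂ i hi]
      simp only [map_sum, LinearMap.sum_apply, tmulUnit_starMul]
      rw [Finset.sum_comm]
    rw [Finset.sum_congr rfl fun i hi => Finset.sum_congr rfl (e₃ i hi)]
    simp only [map_sum, LinearMap.sum_apply]
    rw [Finset.sum_congr rfl fun i _ => Finset.sum_comm, Finset.sum_comm]
    refine Finset.sum_congr rfl fun t _ => ?_
    rw [Finset.sum_congr rfl fun i _ => Finset.sum_comm, Finset.sum_comm]
    exact Finset.sum_congr rfl fun s _ => Finset.sum_comm
  rw [e]
  exact Finset.sum_nonneg fun t _ => Finset.sum_nonneg fun s _ =>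
    α.tensorBundle.starMulUnit_nonneg _

theorem continuous_tmulUnit {X : Type*} [TopologicalSpace X] {f : X → A.UnitFiber}
    {g : X → B.UnitFiber} (hf : Continuous f) (hg : Continuous g) :
    Continuous fun x => α.tmulUnit (f x) (g x) := by
  obtain ⟨C, hC⟩ := α.exists_bound_tmulUnit
  exact ((α.tmulUnit.mkContinuous₂ C hC).continuous₂.comp (hf.prodMk hg) :)

theorem sum_tmulUnit_inner_nonneg {ι : Type*} (S : Finset ι) (x : ι → A.L2) (y : ι → B.L2) :
    0 ≤ ∑ i ∈ S, ∑ j ∈ S,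
      α.tmulUnit (A.l2Form.inner (x i) (x j)) (B.l2Form.inner (y i) (y j)) := by
  have hd : DenseRange (Prod.map (fun f : ι → A.Cc => fun i => A.toL2 (f i))
      (fun g : ι → B.Cc => fun i => B.toL2 (g i))) :=
    DenseRange.prodMap (DenseRange.piMap fun _ => A.l2Form.denseRange_toHilb)
      (DenseRange.piMap fun _ => B.l2Form.denseRange_toHilb)
  refine hd.induction_on (p := fun z : (ι → A.L2) × (ι → B.L2) => 0 ≤ ∑ i ∈ S, ∑ j ∈ S,
    α.tmulUnit (A.l2Form.inner (z.1 i) (z.1 j)) (B.l2Form.inner (z.2 i) (z.2 j))) (x, y) ?_ ?_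
  · refine (CStarAlgebra.isClosed_nonneg (A := α.tensorBundle.UnitFiber)).preimage ?_
    refine continuous_finsetSum _ fun i _ => continuous_finsetSum _ fun j _ =>
      α.continuous_tmulUnit ?_ ?_ <;> fun_prop
  · rintro ⟨f, g⟩
    have := α.sum_tmulUnit_nonneg S f g
    simpa only [Prod.map, FellBundle.toL2, PosForm.inner_coe] using this

/-- The positive form that defines the Hilbert `A_e ⊗_α B_e`-module `ℓ²(A) ⊗_α ℓ²(B)`. -/
def tensorForm : PosForm (A.L2 ⊗[ℂ] B.L2) α.tensorBundle.UnitFiber where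
  ip := α.tensorIp
  star_ip z w := by
    induction z with
    | zero => simp
    | add z z' h h' => simp only [map_add, LinearMap.add_apply, star_add, h, h']
    | tmul x y =>
    induction w with
    | zero => simp
    | add z z' h h' => simp only [map_add, LinearMap.add_apply, star_add, h, h']
    | tmul x' y' =>
      rw [tensorIp_tmul, tensorIp_tmul, star_tmulUnit, PosForm.star_inner, PosForm.star_inner]
  nonneg z := by
    obtain ⟨S, rfl⟩ := TensorProduct.exists_finset z
    rw [tensorIp_sum α S (fun i => i.1) (fun i => i.2)]
    exact α.sum_tmulUnit_inner_nonneg S (fun i => i.1) (fun i => i.2)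

/-- The Hilbert `A_e ⊗_α B_e`-module `ℓ²(A) ⊗_α ℓ²(B)`. -/
abbrev TensorL2 : Type _ := α.tensorForm.Hilb

/-- The canonical map of `ℓ²(A) ⊙ ℓ²(B)` to `ℓ²(A) ⊗_α ℓ²(B)`. -/
def toTensorL2 : A.L2 ⊗[ℂ] B.L2 →ₗ[ℂ] α.TensorL2 := α.tensorForm.toHilb

/-- The operator `R` on `ℓ²(A) ⊗_α ℓ²(B)` is the tensor product `T ⊗ S` of the operators `T` on
`ℓ²(A)` and `S` on `ℓ²(B)`. -/
def IsTensor (T : A.AdjL2) (S : B.AdjL2) (R : α.tensorForm.Adj) : Prop :=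
  ∀ (x : A.L2) (y : B.L2), R.op (α.toTensorL2 (x ⊗ₜ y)) = α.toTensorL2 (T.op x ⊗ₜ S.op y)

/-- The C*-algebra `C*_r(A) ⊗_α̂ C*_r(B)`: the closed *-subalgebra of `𝓛(ℓ²(A) ⊗_α ℓ²(B))`
generated by the operators `T ⊗ S` with `T ∈ C*_r(A)` and `S ∈ C*_r(B)`. -/
def redTensor : NonUnitalStarSubalgebra ℂ α.tensorForm.Adj :=
  (NonUnitalStarAlgebra.adjoin ℂ
    {R | ∃ T ∈ A.CStarRed, ∃ S ∈ B.CStarRed, α.IsTensor T S R}).topologicalClosure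

end StarBundle.CStarNorm

end

noncomputable section

/-! ### The C*-algebra of adjointable operators -/

namespace PosForm

variable {V D : Type*} [AddCommGroup V] [Module ℂ V] [NonUnitalCStarAlgebra D]
    [PartialOrder D] [StarOrderedRing D] (F : PosForm V D)

/-! The norm `max` has to satisfy ‖z‖² = ‖z* z‖_max on every fiber A_t ⊙ B_s, with z* z in A_e ⊙
B_e, so this formula is its definition. For z = Σ aᵢ ⊗ bᵢ the matrices (aᵢ* aⱼ) and (bᵢ* bⱼ) are
positive, hence Gram matrices over A_e and B_e (`exists_gram`). So z* z is a sum of elements y* y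
with y in A_e ⊙ B_e (`exists_starMulTensor_eq_sum`), and A_t ⊙ B_s carries a positive form with
values in A_e ⊗_max B_e. The triangle inequality belongs to that form. Submultiplicativity follows
from (xy)* (xy) = y* (x* x) y, because A_e ⊙ B_e acts on the fiber by a *-representation, and such a
representation is bounded by the maximal norm (`nrm_unitMulTensor_le`). Definiteness is obtained by
slicing with positive functionals (`eq_zero_of_sliceForm`, `eq_zero_of_maxTensorNorm_eq_zero`).

Every *-homomorphism of C_c(A ⊙ B) into a C*-algebra restricts to a *-homomorphism of A_e ⊙ B_e. It
is therefore contractive there for `max`, hence contractive on every fiber by the C*-identity, and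
extends to C*(A ⊗_max B). This universal property (`liftMax`) gives Θ for every α, and also Φ,
through C_c(A ⊙ B) ≅ C_c(A) ⊙ C_c(B). That Φ is isometric means that every *-homomorphism π of
C_c(A) ⊙ C_c(B) is bounded by the maximal norm of C*(A) ⊙ C*(B) (`norm_le_maxTensorNorm_toCStar`).
There are no units through which π could be restricted to the two factors. Instead C_c(A) and C_c(B)
act by commuting left multiplications on the Hilbert module of the form π(x)* π(y); these actions
extend to C*(A) and C*(B), and evaluation at z* recovers ‖π z‖.

On the reduced side, δ_a ⊗ δ_b ↦ δ_{a ⊗ b} preserves inner products and has dense domain and range,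
so it extends to a unitary ℓ²(A) ⊗_α ℓ²(B) ≅ ℓ²(A ⊗_α B) (`inner_ccTensorL2`). Conjugation by it
turns Λ(f) ⊗ Λ(g) into left convolution by f ⊗ g (`tensorAdjEquiv_tensorRegRep`). This is the
commutativity of the diagram on a dense subalgebra, hence everywhere, and Ψ is the restriction of
the conjugation. Surjectivity rests throughout on the closedness of the range of a *-homomorphism
between C*-algebras (`isClosed_range_starHom`), for which the adjointable operators must first be
seen to form a C*-algebra. -/

theorem two_smul_ip_le {x y : V} (h : 0 ≤ F.ip x y) {c : ℝ} (hc : 0 < c) :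
    (2 : ℂ) • F.ip x y ≤ ((c ^ 2 : ℝ) : ℂ) • F.ip x x + (((c⁻¹) ^ 2 : ℝ) : ℂ) • F.ip y y := by
  -- The form at c x - c⁻¹ y is nonnegative; its cross terms coincide because a positive inner
  -- product is self-adjoint.
  have h0 := F.nonneg ((c : ℂ) • x - ((c⁻¹ : ℝ) : ℂ) • y)
  have hs : F.ip y x = F.ip x y := by
    rw [← F.star_ip]; exact (IsSelfAdjoint.of_nonneg h).star_eq
  have hcc : (c : ℂ) * ((c⁻¹ : ℝ) : ℂ) = 1 := by
    rw [← Complex.ofReal_mul, mul_inv_cancel₀ hc.ne', Complex.ofReal_one]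
  have hcc' : ((c⁻¹ : ℝ) : ℂ) * (c : ℂ) = 1 := by rw [mul_comm, hcc]
  rw [← sub_nonneg]
  convert h0 using 1
  simp only [map_sub, LinearMap.map_smulₛₗ, LinearMap.sub_apply, LinearMap.smul_apply, map_smul,
    Complex.conj_ofReal, smul_sub, smul_smul, hcc, hcc', one_smul, hs, two_smul]
  rw [← Complex.ofReal_mul, ← Complex.ofReal_mul, ← sq, ← sq]
  abel

/-- The Cauchy–Schwarz inequality for vectors with a positive inner product. -/
theorem norm_ip_le_of_nonneg {x y : V} (h : 0 ≤ F.ip x y) :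
    ‖F.ip x y‖ ≤ F.nrm x * F.nrm y := by
  have h2 : ∀ ε > 0, ‖F.ip x y‖ ≤ (F.nrm x + ε) * (F.nrm y + ε) := by
    intro ε hε
    have ha := F.nrm_nonneg x
    have hb := F.nrm_nonneg y
    -- Adding ε keeps b / a meaningful when a vector has norm zero. The weight c² = b / a bounds
    -- each of the two terms by a b.
    set a := F.nrm x + ε with ha'
    set b := F.nrm y + ε with hb'
    have ha0 : 0 < a := by positivity
    have hb0 : 0 < b := by positivity
    have hc0 : 0 < √(b / a) := Real.sqrt_pos.mpr (by positivity)
    have hsq : √(b / a) ^ 2 = b / a := Real.sq_sqrt (by positivity)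
    have h3 := F.two_smul_ip_le h hc0
    have h20 : (0 : D) ≤ (2 : ℂ) • F.ip x y := by
      rw [two_smul]; exact add_nonneg h h
    have h4 := (CStarAlgebra.norm_le_norm_of_nonneg_of_le h20 h3).trans (norm_add_le _ _)
    rw [norm_smul, norm_smul, norm_smul, Complex.norm_real, Complex.norm_real, inv_pow, hsq,
      inv_div, Real.norm_of_nonneg (by positivity), Real.norm_of_nonneg (by positivity), ← sq_nrm,
      ← sq_nrm, Complex.norm_ofNat] at h4
    have h5 : b / a * F.nrm x ^ 2 + a / b * F.nrm y ^ 2 ≤ b / a * a ^ 2 + a / b * b ^ 2 := by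
      gcongr <;> linarith
    have h6 : b / a * a ^ 2 + a / b * b ^ 2 = 2 * (a * b) := by field_simp; ring
    linarith
  have h5 : Filter.Tendsto (fun ε : ℝ => (F.nrm x + ε) * (F.nrm y + ε))
      (nhdsWithin 0 (Set.Ioi 0)) (nhds ((F.nrm x + 0) * (F.nrm y + 0))) :=
    (Continuous.tendsto (by fun_prop) 0).mono_left nhdsWithin_le_nhds
  rw [add_zero, add_zero] at h5
  exact ge_of_tendsto h5 (eventually_nhdsWithin_of_forall h2)

theorem inner_self_nonneg (x : F.Hilb) : 0 ≤ F.inner x x := by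
  induction x using F.hilb_induction with
  | hc =>
    exact IsClosed.preimage (f := fun x => F.inner x x) (by fun_prop)
      (CStarAlgebra.isClosed_nonneg (A := D))
  | h x => rw [inner_coe]; exact F.nonneg x

/-- The inner product of the Hilbert module, as a positive form. -/
def hilbForm : PosForm F.Hilb D where
  ip := (ContinuousLinearMap.coeLM ℂ).comp F.inner.toLinearMap
  star_ip x y := F.star_inner x y
  nonneg x := F.inner_self_nonneg x

theorem hilbForm_nrm (x : F.Hilb) : F.hilbForm.nrm x = ‖x‖ := by
  change √‖F.inner x x‖ = ‖x‖
  rw [norm_inner_self, Real.sqrt_sq (norm_nonneg x)]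

theorem norm_inner_le_of_nonneg {x y : F.Hilb} (h : 0 ≤ F.inner x y) :
    ‖F.inner x y‖ ≤ ‖x‖ * ‖y‖ := by
  rw [← hilbForm_nrm, ← hilbForm_nrm]
  exact F.hilbForm.norm_ip_le_of_nonneg h

theorem mul_op (S T : F.Adj) (x : F.Hilb) : (S * T).op x = S.op (T.op x) := rfl

/-- The vectors x and T* T x have the positive inner product ⟨Tx, Tx⟩, so Cauchy–Schwarz holds for
them with constant 1. The constant 4 of `norm_inner_le` would not give the C*-identity. -/
theorem norm_adj_sq_le (T : F.Adj) : ‖T‖ ^ 2 ≤ ‖star T * T‖ := by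
  have h : ‖T.op‖ ≤ √‖star T * T‖ := by
    refine ContinuousLinearMap.opNorm_le_bound _ (Real.sqrt_nonneg _) fun x => ?_
    refine le_of_sq_le_sq ?_ (by positivity)
    have h1 : F.inner (T.op x) (T.op x) = F.inner x ((star T * T).op x) := by
      rw [inner_apply_left, mul_op]
    rw [mul_pow, Real.sq_sqrt (norm_nonneg _), ← F.norm_inner_self, h1]
    refine (F.norm_inner_le_of_nonneg (h1 ▸ F.inner_self_nonneg _)).trans ?_
    calc _ ≤ ‖x‖ * (‖star T * T‖ * ‖x‖) := by
          gcongr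
          exact (star T * T).op.le_opNorm x
      _ = _ := by ring
  calc _ ≤ √‖star T * T‖ ^ 2 := pow_le_pow_left₀ (norm_nonneg _) h 2
    _ = _ := Real.sq_sqrt (norm_nonneg _)

theorem norm_star_adj (T : F.Adj) : ‖star T‖ = ‖T‖ := by
  have key : ∀ S : F.Adj, ‖S‖ ≤ ‖star S‖ := by
    intro S
    rcases (norm_nonneg S).eq_or_lt with h | h
    · rw [← h]; exact norm_nonneg _
    · have := (F.norm_adj_sq_le S).trans (norm_mul_le _ _)
      rw [sq] at this
      exact le_of_mul_le_mul_right this h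
  refine le_antisymm ?_ (key T)
  simpa using key (star T)

/-- The involution is isometric, so along a norm convergent sequence of adjointable operators the
adjoints converge as well, and their limit is an adjoint of the limit. -/
instance : CompleteSpace F.Adj := by
  have hc : IsClosed (F.adjSubalgebra : Set (F.Hilb →L[ℂ] F.Hilb)) := by
    refine IsSeqClosed.isClosed fun u T hu hT => ?_
    let w : ℕ → F.Adj := fun n => ⟨u n, hu n⟩
    have hw : CauchySeq w := by
      have := hT.cauchySeq
      rw [Metric.cauchySeq_iff'] at this ⊢
      exact this
    have hw' : CauchySeq fun n => (star (w n)).op := by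
      rw [Metric.cauchySeq_iff'] at hw ⊢
      intro ε hε
      obtain ⟨N, hN⟩ := hw ε hε
      refine ⟨N, fun n hn => ?_⟩
      have h1 := hN n hn
      rw [dist_eq_norm, ← norm_star_adj, star_sub] at h1
      rw [dist_eq_norm]
      exact h1
    obtain ⟨S, hS⟩ := cauchySeq_tendsto_of_complete hw'
    refine ⟨S, fun x y => ?_⟩
    have h1 : Filter.Tendsto (fun n => F.inner (u n x) y) Filter.atTop (nhds (F.inner (T x) y)) :=
      ((Continuous.tendsto (f := fun T : F.Hilb →L[ℂ] F.Hilb => F.inner (T x) y)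
        (by fun_prop) T).comp hT :)
    have h2 : Filter.Tendsto (fun n => F.inner x ((star (w n)).op y)) Filter.atTop
        (nhds (F.inner x (S y))) :=
      ((Continuous.tendsto (f := fun T : F.Hilb →L[ℂ] F.Hilb => F.inner x (T y))
        (by fun_prop) S).comp hS :)
    refine tendsto_nhds_unique h1 (h2.congr fun n => ?_)
    exact (F.inner_apply_left (w n) x y).symm
  exact hc.completeSpace_coe

/-- The algebra of adjointable operators is a C*-algebra. -/
instance : CStarAlgebra F.Adj where
  __ := (inferInstance : NormedRing F.Adj)
  __ := (inferInstance : StarRing F.Adj)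
  __ := (inferInstance : CompleteSpace F.Adj)
  __ := (inferInstance : NormedAlgebra ℂ F.Adj)
  __ := (inferInstance : StarModule ℂ F.Adj)
  norm_mul_self_le T := by
    rw [← sq]
    exact F.norm_adj_sq_le T

end PosForm

/-! ### *-homomorphisms -/

theorem continuous_starHom {A E : Type*} [NonUnitalCStarAlgebra A] [NonUnitalCStarAlgebra E]
    (φ : A →⋆ₙₐ[ℂ] E) : Continuous φ :=
  AddMonoidHomClass.continuous_of_bound φ 1 fun a => by
    rw [one_mul]; exact NonUnitalStarAlgHom.norm_apply_le φ a

/-! ### Universal properties of the completions for C*-seminorms. -/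

section Hom

variable {R E : Type*} [NonUnitalRing R] [StarRing R] [Module ℂ R]
  [NonUnitalCStarAlgebra E]

namespace CStarSeminorm

/-- The C*-seminorm given by a *-homomorphism into a C*-algebra. -/
def comap (π : R →⋆ₙₐ[ℂ] E) : CStarSeminorm R where
  toFun x := ‖π x‖
  map_zero' := by simp
  add_le' x y := by simpa using norm_add_le (π x) (π y)
  neg' x := by
    have : π (-x) = -π x := map_neg π x
    simp [this]
  smul' c x := by rw [map_smul, norm_smul]
  mul_le x y := by simpa using norm_mul_le (π x) (π y)
  star_mul_self x := by
    rw [map_mul, map_star, CStarRing.norm_star_mul_self, sq]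

variable [IsScalarTower ℂ R R] [SMulCommClass ℂ R R] [StarModule ℂ R]

/-- The extension of a *-homomorphism to the completion for a C*-seminorm. -/
def lift (p : CStarSeminorm R) (π : R →⋆ₙₐ[ℂ] E) (h : ∀ x, ‖π x‖ ≤ p x) : p.Compl →⋆ₙₐ[ℂ] E :=
  have hb : ∃ C, ∀ x : p.Pre, ‖π x‖ ≤ C * ‖x‖ := ⟨1, fun x => by rw [one_mul]; exact h x⟩
  let L : p.Compl →L[ℂ] E := linExt (V := p.Pre) (F := E)
    ((π : R →ₗ[ℂ] E) : R →ₗ[ℂ] E)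
  have hL : ∀ x : R, L (p.of x) = π x := fun x =>
    linExt_coe (V := p.Pre) (F := E) ((π : R →ₗ[ℂ] E) : R →ₗ[ℂ] E) hb x
  { toFun := L
    map_smul' := map_smul L
    map_zero' := map_zero L
    map_add' := map_add L
    map_mul' := fun x y => by
      induction x using p.compl_induction with
      | hc => exact isClosed_eq (by fun_prop) (by fun_prop)
      | h x =>
      induction y using p.compl_induction with
      | hc => exact isClosed_eq (by fun_prop) (by fun_prop)
      | h y =>
        change L (p.of x * p.of y) = L (p.of x) * L (p.of y)
        rw [← map_mul, hL, hL, hL, map_mul]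
    map_star' := fun x => by
      induction x using p.compl_induction with
      | hc => exact isClosed_eq (by fun_prop) (by fun_prop)
      | h x =>
        change L (star (p.of x)) = star (L (p.of x))
        rw [← map_star, hL, hL, map_star] }

theorem lift_of (p : CStarSeminorm R) (π : R →⋆ₙₐ[ℂ] E) (h : ∀ x, ‖π x‖ ≤ p x) (x : R) :
    p.lift π h (p.of x) = π x :=
  linExt_coe (V := p.Pre) (F := E) ((π : R →ₗ[ℂ] E) : R →ₗ[ℂ] E)
    ⟨1, fun x => by rw [one_mul]; exact h x⟩ x

end CStarSeminorm

/-- The seminorm `comap π` belongs to the family whose supremum is the maximal norm. Bounds by the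
maximal norm are obtained below by exhibiting a suitable π. -/
theorem norm_le_maxTensorNorm {A B : Type*} [NonUnitalCStarAlgebra A] [NonUnitalCStarAlgebra B]
    (π : A ⊗[ℂ] B →⋆ₙₐ[ℂ] E) (x : A ⊗[ℂ] B) : ‖π x‖ ≤ maxTensorNorm A B x :=
  le_ciSup (f := fun p : CStarSeminorm (A ⊗[ℂ] B) => p x) (by
    induction x with
    | zero => exact ⟨0, by rintro _ ⟨p, rfl⟩; exact (map_zero p.toSeminorm).le⟩
    | tmul a b => exact ⟨‖a‖ * ‖b‖, by rintro _ ⟨p, rfl⟩; exact p.tmul_le a b⟩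
    | add x y hx hy =>
      obtain ⟨c, hc⟩ := hx
      obtain ⟨d, hd⟩ := hy
      refine ⟨c + d, ?_⟩
      rintro _ ⟨p, rfl⟩
      exact (map_add_le_add p.toSeminorm x y).trans (add_le_add (hc ⟨p, rfl⟩) (hd ⟨p, rfl⟩)))
    (CStarSeminorm.comap π)

theorem FellBundle.le_univNorm {G : Type u} [Group G] (A : FellBundle.{u, v} G)
    (p : CStarSeminorm A.Cc) (f : A.Cc) : p f ≤ A.univNorm f :=
  le_ciSup (f := fun p : CStarSeminorm A.Cc => p f) (by
    induction f using A.Cc_induction with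
    | h0 => exact ⟨0, by rintro _ ⟨p, rfl⟩; exact (map_zero p.toSeminorm).le⟩
    | hδ t a => exact ⟨A.cstarNorm.nrm t a, by rintro _ ⟨p, rfl⟩; exact A.seminorm_δ_le p t a⟩
    | hadd x y hx hy =>
      obtain ⟨c, hc⟩ := hx
      obtain ⟨d, hd⟩ := hy
      refine ⟨c + d, ?_⟩
      rintro _ ⟨p, rfl⟩
      exact (map_add_le_add p.toSeminorm x y).trans (add_le_add (hc ⟨p, rfl⟩) (hd ⟨p, rfl⟩))) p

/-- The extension to `C*(A)` of a *-homomorphism of `C_c(A)` into a C*-algebra. -/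
def FellBundle.lift {G : Type u} [Group G] (A : FellBundle.{u, v} G) (π : A.Cc →⋆ₙₐ[ℂ] E) :
    A.CStar →⋆ₙₐ[ℂ] E :=
  A.univNorm.lift π fun f => A.le_univNorm (CStarSeminorm.comap π) f

theorem FellBundle.lift_toCStar {G : Type u} [Group G] (A : FellBundle.{u, v} G)
    (π : A.Cc →⋆ₙₐ[ℂ] E) (f : A.Cc) : A.lift π (A.toCStar f) = π f :=
  A.univNorm.lift_of π _ f

end Hom

/-! ### Closedness of the range of a *-homomorphism. -/

section ClosedRange

variable {A E : Type*} [NonUnitalCStarAlgebra A] [NonUnitalCStarAlgebra E]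

/-- Truncate a at ±‖φ a‖ by functional calculus. A *-homomorphism commutes with the functional
calculus, and the truncation is the identity on the spectrum of φ a, so the image does not change.
-/
theorem exists_preimage_of_isSelfAdjoint (φ : A →⋆ₙₐ[ℂ] E) (a : A) (ha : IsSelfAdjoint a) :
    ∃ b, φ b = φ a ∧ ‖b‖ ≤ ‖φ a‖ := by
  set r := ‖φ a‖ with hr
  have hr0 : 0 ≤ r := norm_nonneg _
  let f : ℝ → ℝ := fun x => max (-r) (min x r)
  have hf : Continuous f := by fun_prop
  have hf0 : f 0 = 0 := by simp [f, hr0]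
  have hφa : IsSelfAdjoint (φ a) := ha.map φ
  refine ⟨cfcₙ f a, ?_, ?_⟩
  · rw [NonUnitalStarAlgHomClass.map_cfcₙ (S := ℂ) φ f a (by fun_prop) hf0 (continuous_starHom φ) ha
      hφa]
    conv_rhs => rw [← cfcₙ_id ℝ (φ a)]
    refine cfcₙ_congr fun x hx => ?_
    have h1 := norm_apply_le_norm_cfcₙ (𝕜 := ℝ) (id : ℝ → ℝ) (φ a) hx
    rw [cfcₙ_id ℝ (φ a)] at h1
    have h2 : -r ≤ x ∧ x ≤ r := abs_le.mp h1
    simp only [f, id]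
    rw [min_eq_left h2.2, max_eq_right h2.1]
  · refine norm_cfcₙ_le fun x _ => ?_
    rw [Real.norm_eq_abs, abs_le]
    exact ⟨le_max_left _ _, max_le (by linarith) (min_le_right _ _)⟩

/-- The range of a *-homomorphism of C*-algebras is closed. -/
theorem isClosed_range_starHom (φ : A →⋆ₙₐ[ℂ] E) : IsClosed (Set.range φ) := by
  let f : NormedAddGroupHom A E :=
    { toFun := φ
      map_add' := map_add φ
      bound' := ⟨1, fun a => by rw [one_mul]; exact NonUnitalStarAlgHom.norm_apply_le φ a⟩ }
  -- Real and imaginary parts are lifted separately, each with norm at most ‖φ a‖, hence the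
  -- constant 2. With such controlled lifts, points of the closure of the range are lifted by an
  -- absolutely convergent series.
  have hyp : f.SurjectiveOnWith f.range 2 := by
    rintro _ ⟨a, rfl⟩
    obtain ⟨b, hb, hb'⟩ := exists_preimage_of_isSelfAdjoint φ (realPart a) (realPart a).2
    obtain ⟨c, hc, hc'⟩ := exists_preimage_of_isSelfAdjoint φ (imaginaryPart a) (imaginaryPart a).2
    have h1 : ∀ x : A, ‖φ (realPart x : A)‖ ≤ ‖φ x‖ := by
      intro x
      rw [realPart_apply_coe]
      have : φ ((2⁻¹ : ℝ) • (x + star x)) = (2⁻¹ : ℂ) • (φ x + star (φ x)) := by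
        rw [← map_star, ← map_add, ← map_smul]
        congr 1
        rw [← Complex.coe_smul]
        norm_num
      rw [this, norm_smul]
      have h2 := norm_add_le (φ x) (star (φ x))
      rw [norm_star] at h2
      norm_num
      linarith
    refine ⟨b + Complex.I • c, ?_, ?_⟩
    · change φ _ = φ a
      rw [map_add, map_smul, hb, hc, ← map_smul, ← map_add, realPart_add_I_smul_imaginaryPart]
    · change _ ≤ 2 * ‖φ a‖
      have h3 : ‖φ (imaginaryPart a : A)‖ ≤ ‖φ a‖ := by
        -- The real part of -i a is the imaginary part of a.
        have h4 := h1 ((-Complex.I) • a)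
        rw [map_smul φ, norm_smul, norm_neg, Complex.norm_I, one_mul] at h4
        simpa [realPart_I_smul] using h4
      refine (norm_add_le _ _).trans ?_
      rw [norm_smul, Complex.norm_I, one_mul]
      linarith [h1 a]
  have h := controlled_closure_of_complete two_pos one_pos hyp
  refine isClosed_of_closure_subset fun y hy => ?_
  obtain ⟨a, ha, -⟩ := h y hy
  exact ⟨a, ha⟩

end ClosedRange

/-! ### Representations on Hilbert modules -/

/-- Take k = 1 - √(1 - a* a), so that (1 - k)² = 1 - a* a. The function 1 - √(1 - x) vanishes at 0,
so k exists without a unit, and the identity is expanded so as not to mention one. -/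
theorem exists_contraction_star_mul_self {R : Type*} [NonUnitalCStarAlgebra R] (a : R)
    (ha : ‖a‖ ≤ 1) : ∃ k : R, star k = k ∧ k + k - k * k = star a * a := by
  let f : ℝ → ℝ := fun x => 1 - √(1 - x)
  have hf : Continuous f := by fun_prop
  have hf0 : f 0 = 0 := by simp [f]
  have hsa : IsSelfAdjoint (star a * a) := .star_mul_self a
  refine ⟨cfcₙ f (star a * a), cfcₙ_predicate f (star a * a), ?_⟩
  rw [← cfcₙ_add .., ← cfcₙ_mul .., ← cfcₙ_sub ..]
  conv_rhs => rw [← cfcₙ_id ℝ (star a * a)]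
  refine cfcₙ_congr fun x hx => ?_
  have hx1 : x ≤ 1 := by
    have h1 := norm_apply_le_norm_cfcₙ (𝕜 := ℝ) (id : ℝ → ℝ) (star a * a) hx
    rw [cfcₙ_id ℝ (star a * a), CStarRing.norm_star_mul_self] at h1
    exact (le_abs_self x).trans (h1.trans (mul_le_one₀ ha (norm_nonneg _) ha))
  have := Real.sq_sqrt (sub_nonneg.mpr hx1)
  simp only [f, id]
  nlinarith

namespace PosForm

variable {V D : Type*} [AddCommGroup V] [Module ℂ V] [NonUnitalCStarAlgebra D]
    [PartialOrder D] [StarOrderedRing D] (F : PosForm V D)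

theorem Adj.ext_toHilb {F : PosForm V D} {S T : F.Adj}
    (h : ∀ v, S.op (F.toHilb v) = T.op (F.toHilb v)) : S = T :=
  Adj.ext fun x => by
    induction x using F.hilb_induction with
    | hc => exact isClosed_eq (by fun_prop) (by fun_prop)
    | h x => exact h x

theorem smul_op (c : ℂ) (T : F.Adj) (x : F.Hilb) : (c • T).op x = c • T.op x := rfl

theorem add_op (S T : F.Adj) (x : F.Hilb) : (S + T).op x = S.op x + T.op x := rfl

theorem zero_op (x : F.Hilb) : (0 : F.Adj).op x = 0 := rfl

section Rep

variable {R : Type*} [NonUnitalRing R] [StarRing R] [Module ℂ R]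
  (ρ : R →ₙₐ[ℂ] Module.End ℂ V)
  (hadj : ∀ a x y, F.ip (ρ a x) y = F.ip x (ρ (star a) y))
  (hbd : ∀ a, ∃ C, ∀ x, F.nrm (ρ a x) ≤ C * F.nrm x)

/-- The extension of a bounded operator to the Hilbert module. -/
def extOp (T : Module.End ℂ V) : F.Hilb →L[ℂ] F.Hilb :=
  linExt (V := F.Pre) (F := F.Hilb) (F.toHilb.comp T : V →ₗ[ℂ] F.Hilb)

theorem extOp_toHilb (T : Module.End ℂ V) (hT : ∃ C, ∀ x, F.nrm (T x) ≤ C * F.nrm x) (x : V) :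
    F.extOp T (F.toHilb x) = F.toHilb (T x) :=
  linExt_coe (V := F.Pre) (F := F.Hilb) (F.toHilb.comp T : V →ₗ[ℂ] F.Hilb)
    (by
      obtain ⟨C, hC⟩ := hT
      exact ⟨C, fun x => (F.norm_toHilb _).trans_le (hC x)⟩) x

theorem inner_extOp (S T : Module.End ℂ V) (hS : ∃ C, ∀ x, F.nrm (S x) ≤ C * F.nrm x)
    (hT : ∃ C, ∀ x, F.nrm (T x) ≤ C * F.nrm x) (h : ∀ x y, F.ip (S x) y = F.ip x (T y))
    (x y : F.Hilb) : F.inner (F.extOp S x) y = F.inner x (F.extOp T y) := by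
  induction x using F.hilb_induction with
  | hc => exact isClosed_eq (by fun_prop) (by fun_prop)
  | h x =>
  induction y using F.hilb_induction with
  | hc => exact isClosed_eq (by fun_prop) (by fun_prop)
  | h y => rw [F.extOp_toHilb S hS, F.extOp_toHilb T hT, inner_coe, inner_coe, h]

/-- The representation on the Hilbert module that extends a representation by bounded operators
on the underlying space. -/
def rep : R →⋆ₙₐ[ℂ] F.Adj :=
  let T : R → F.Adj := fun a =>
    (⟨F.extOp (ρ a), F.extOp (ρ (star a)), F.inner_extOp _ _ (hbd a) (hbd _) (hadj a)⟩ :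
      F.adjSubalgebra)
  have hT : ∀ a x, (T a).op (F.toHilb x) = F.toHilb (ρ a x) := fun a x =>
    F.extOp_toHilb (ρ a) (hbd a) x
  { toFun := T
    map_smul' := fun c a => Adj.ext_toHilb fun x => by
      rw [hT, map_smul]
      exact (map_smul F.toHilb c (ρ a x)).trans (congrArg (c • ·) (hT a x).symm)
    map_zero' := Adj.ext_toHilb fun x => by
      rw [hT, map_zero, zero_op, LinearMap.zero_apply, map_zero]
    map_add' := fun a b => Adj.ext_toHilb fun x => by
      rw [hT, map_add, add_op, LinearMap.add_apply, map_add, hT, hT]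
    map_mul' := fun a b => Adj.ext_toHilb fun x => by
      rw [hT, map_mul, mul_op, hT, hT]
      rfl
    map_star' := fun a => (F.star_eq_of_adjoint (T := T a) (S := T (star a))
      (F.inner_extOp _ _ (hbd a) (hbd _) (hadj a))).symm }

theorem rep_toHilb (a : R) (x : V) :
    (F.rep ρ hadj hbd a).op (F.toHilb x) = F.toHilb (ρ a x) :=
  F.extOp_toHilb (ρ a) (hbd a) x

end Rep

/-- A *-representation of a C*-algebra on a space with a positive form is contractive. -/
theorem nrm_rep_le {R : Type*} [NonUnitalCStarAlgebra R] (ρ : R →ₙₐ[ℂ] Module.End ℂ V)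
    (hadj : ∀ a x y, F.ip (ρ a x) y = F.ip x (ρ (star a) y)) (a : R) (x : V) :
    F.nrm (ρ a x) ≤ ‖a‖ * F.nrm x := by
  have key : ∀ a : R, ‖a‖ ≤ 1 → F.nrm (ρ a x) ≤ F.nrm x := by
    intro a ha
    obtain ⟨k, hk, hka⟩ := exists_contraction_star_mul_self a ha
    -- ⟨x, x⟩ - ⟨ax, ax⟩ = ⟨x, (1 - a* a) x⟩ = ⟨(1 - k) x, (1 - k) x⟩ ≥ 0. Only the algebraic
    -- adjoint relation enters; boundedness of ρ is a conclusion.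
    have h1 : F.ip (ρ a x) (ρ a x) ≤ F.ip x x := by
      rw [← sub_nonneg]
      convert F.nonneg (x - ρ k x) using 1
      have h2 : F.ip (ρ a x) (ρ a x) = F.ip x (ρ (star a * a) x) := by
        rw [hadj, map_mul]
        rfl
      have h3 : F.ip (ρ k x) (ρ k x) = F.ip x (ρ (k * k) x) := by
        rw [hadj, hk, map_mul]
        rfl
      have h4 : F.ip (ρ k x) x = F.ip x (ρ k x) := by rw [hadj, hk]
      rw [h2, ← hka]
      simp only [map_sub, map_add, LinearMap.sub_apply, LinearMap.add_apply, h3, h4]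
      abel
    exact Real.sqrt_le_sqrt (CStarAlgebra.norm_le_norm_of_nonneg_of_le (F.nonneg _) h1)
  rcases eq_or_ne a 0 with rfl | ha
  · have : F.nrm 0 = 0 := by simp [nrm]
    simp [this]
  have ha' : 0 < ‖a‖ := norm_pos_iff.mpr ha
  have h := key (((‖a‖⁻¹ : ℝ) : ℂ) • a) (by
    rw [norm_smul, Complex.norm_real, norm_inv, norm_norm, inv_mul_cancel₀ ha'.ne'])
  rw [map_smul, LinearMap.smul_apply, nrm_smul, Complex.norm_real, norm_inv, norm_norm,
    inv_mul_le_iff₀ ha'] at h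
  exact h

end PosForm

/-! ### Automatic boundedness of representations of C_c(A). -/

namespace FellBundle

variable {G : Type u} [Group G] (A : FellBundle.{u, v} G)

/-- The inclusion of the unit fiber into `C_c(A)`, as a *-homomorphism. -/
def δUnitHom : A.UnitFiber →⋆ₙₐ[ℂ] A.Cc where
  toFun := A.δUnit
  map_smul' := map_smul A.δUnit
  map_zero' := map_zero A.δUnit
  map_add' := map_add A.δUnit
  map_mul' a b := (A.δUnit_mul a b).symm
  map_star' a := (A.star_δUnit a).symm

theorem star_δ_mul_δ {t : G} (a : A.fiber t) :
    star (A.δ t a) * A.δ t a = A.δUnit (A.starMulUnit a a) := by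
  rw [A.star_δ rfl, A.δ_mul_δ (inv_mul_cancel t)]
  rfl

/-- The operators of a *-representation of `C_c(A)` on a space with a positive form are bounded. -/
theorem exists_bound_rep {V D : Type*} [AddCommGroup V] [Module ℂ V] [NonUnitalCStarAlgebra D]
    [PartialOrder D] [StarOrderedRing D] (F : PosForm V D) (ρ : A.Cc →ₙₐ[ℂ] Module.End ℂ V)
    (hadj : ∀ a x y, F.ip (ρ a x) y = F.ip x (ρ (star a) y)) (f : A.Cc) :
    ∃ C, ∀ x, F.nrm (ρ f x) ≤ C * F.nrm x := by
  induction f using A.Cc_induction with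
  | h0 => exact ⟨0, fun x => by simp [PosForm.nrm]⟩
  | hadd f g hf hg =>
    obtain ⟨C, hC⟩ := hf
    obtain ⟨D, hD⟩ := hg
    refine ⟨C + D, fun x => ?_⟩
    rw [map_add, add_mul]
    exact (F.nrm_add_le _ _).trans (add_le_add (hC x) (hD x))
  | hδ t a =>
    -- ρ(δ_a)* ρ(δ_a) = ρ(δ_{a* a}) comes from the C*-algebra A_e, whose representations are
    -- contractive. The factor 4 is that of the crude inequality `norm_ip_le`; any bound suffices
    -- here.
    refine ⟨√(4 * ‖A.starMulUnit a a‖), fun x => ?_⟩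
    have h1 := F.nrm_rep_le (ρ.comp (A.δUnitHom : A.UnitFiber →ₙₐ[ℂ] A.Cc))
      (fun a x y => (hadj _ x y).trans
        (congrArg (fun f => F.ip x (ρ f y)) (A.star_δUnit a))) (A.starMulUnit a a) x
    have h2 : F.ip (ρ (A.δ t a) x) (ρ (A.δ t a) x) =
        F.ip x (ρ (A.δUnit (A.starMulUnit a a)) x) := by
      rw [hadj, ← star_δ_mul_δ, map_mul]
      rfl
    refine le_of_sq_le_sq ?_ (mul_nonneg (Real.sqrt_nonneg _) (F.nrm_nonneg _))
    rw [F.sq_nrm, h2, mul_pow, Real.sq_sqrt (by positivity)]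
    calc _ ≤ 4 * F.nrm x * F.nrm (ρ (A.δUnit (A.starMulUnit a a)) x) := F.norm_ip_le _ _
      _ ≤ 4 * F.nrm x * (‖A.starMulUnit a a‖ * F.nrm x) := by
        gcongr
        · exact mul_nonneg (by norm_num) (F.nrm_nonneg _)
        · exact h1
      _ = _ := by ring

end FellBundle

/-! ### Commuting *-homomorphisms and tensor products of representations. -/

section TensorHom

variable {R₁ R₂ E : Type*}
  [NonUnitalRing R₁] [StarRing R₁] [Module ℂ R₁] [StarModule ℂ R₁]
  [SMulCommClass ℂ R₁ R₁] [IsScalarTower ℂ R₁ R₁]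
  [NonUnitalRing R₂] [StarRing R₂] [Module ℂ R₂] [StarModule ℂ R₂]
  [SMulCommClass ℂ R₂ R₂] [IsScalarTower ℂ R₂ R₂]
  [NonUnitalRing E] [StarRing E] [Module ℂ E] [SMulCommClass ℂ E E] [IsScalarTower ℂ E E]

/-- The *-homomorphism of the algebraic tensor product given by two commuting
*-homomorphisms. -/
def tensorHom (π₁ : R₁ →⋆ₙₐ[ℂ] E) (π₂ : R₂ →⋆ₙₐ[ℂ] E) (hc : ∀ a b, Commute (π₁ a) (π₂ b)) :
    R₁ ⊗[ℂ] R₂ →⋆ₙₐ[ℂ] E :=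
  let L : R₁ ⊗[ℂ] R₂ →ₗ[ℂ] E := TensorProduct.lift
    ((LinearMap.mul ℂ E).compl₁₂ (π₁ : R₁ →ₗ[ℂ] E) (π₂ : R₂ →ₗ[ℂ] E))
  have hL : ∀ a b, L (a ⊗ₜ b) = π₁ a * π₂ b := fun a b => by simp [L]
  { toFun := L
    map_smul' := map_smul L
    map_zero' := map_zero L
    map_add' := map_add L
    map_mul' := fun x y => by
      induction x with
      | zero => simp
      | add x x' h h' => rw [add_mul, map_add, h, h', map_add, add_mul]
      | tmul a b =>
      induction y with
      | zero => simp
      | add y y' h h' => rw [mul_add, map_add, h, h', map_add, mul_add]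
      | tmul a' b' =>
        rw [Algebra.TensorProduct.tmul_mul_tmul, hL, hL, hL, map_mul, map_mul,
          (hc a' b).symm.mul_mul_mul_comm]
    map_star' := fun x => by
      induction x with
      | zero => simp
      | add x x' h h' => rw [star_add, map_add, h, h', map_add, star_add]
      | tmul a b =>
        rw [TensorProduct.star_tmul, hL, hL, star_mul, map_star, map_star, ← map_star π₁,
          ← map_star π₂, (hc _ _).eq] }

theorem tensorHom_tmul (π₁ : R₁ →⋆ₙₐ[ℂ] E) (π₂ : R₂ →⋆ₙₐ[ℂ] E)
    (hc : ∀ a b, Commute (π₁ a) (π₂ b)) (a : R₁) (b : R₂) :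
    tensorHom π₁ π₂ hc (a ⊗ₜ b) = π₁ a * π₂ b := by
  simp [tensorHom]

end TensorHom

namespace PosForm

variable {V₁ V₂ D : Type*} [AddCommGroup V₁] [Module ℂ V₁] [AddCommGroup V₂] [Module ℂ V₂]
  [NonUnitalCStarAlgebra D] [PartialOrder D] [StarOrderedRing D]

theorem ip_left_ext {W : Type*} [AddCommGroup W] [Module ℂ W]
    {f g : V₁ ⊗[ℂ] V₂ →ₗ⋆[ℂ] V₁ ⊗[ℂ] V₂ →ₗ[ℂ] W}
    (h : ∀ x y x' y', f (x ⊗ₜ y) (x' ⊗ₜ y') = g (x ⊗ₜ y) (x' ⊗ₜ y')) (z w : V₁ ⊗[ℂ] V₂) :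
    f z w = g z w := by
  induction z with
  | zero => simp
  | add z z' h h' => rw [map_add, map_add, LinearMap.add_apply, LinearMap.add_apply, h, h']
  | tmul x y =>
  induction w with
  | zero => simp
  | add w w' h h' => rw [map_add, map_add, h, h']
  | tmul x' y' => exact h x y x' y'

variable {R : Type*} [NonUnitalRing R] [StarRing R] [Module ℂ R]

/-- The representation `a ↦ ρ(a) ⊗ 1`. -/
def ampLeft (V₂ : Type*) [AddCommGroup V₂] [Module ℂ V₂] (ρ : R →ₙₐ[ℂ] Module.End ℂ V₁) :
    R →ₙₐ[ℂ] Module.End ℂ (V₁ ⊗[ℂ] V₂) :=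
  NonUnitalAlgHom.comp
    ((Module.End.rTensorAlgHom ℂ V₁ V₂ : Module.End ℂ V₁ →ₐ[ℂ] Module.End ℂ (V₁ ⊗[ℂ] V₂)) :
      Module.End ℂ V₁ →ₙₐ[ℂ] Module.End ℂ (V₁ ⊗[ℂ] V₂)) ρ

/-- The representation `b ↦ 1 ⊗ ρ(b)`. -/
def ampRight (V₁ : Type*) [AddCommGroup V₁] [Module ℂ V₁] (ρ : R →ₙₐ[ℂ] Module.End ℂ V₂) :
    R →ₙₐ[ℂ] Module.End ℂ (V₁ ⊗[ℂ] V₂) :=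
  NonUnitalAlgHom.comp
    ((Module.End.lTensorAlgHom ℂ V₂ V₁ : Module.End ℂ V₂ →ₐ[ℂ] Module.End ℂ (V₁ ⊗[ℂ] V₂)) :
      Module.End ℂ V₂ →ₙₐ[ℂ] Module.End ℂ (V₁ ⊗[ℂ] V₂)) ρ

theorem ampLeft_tmul (ρ : R →ₙₐ[ℂ] Module.End ℂ V₁) (a : R) (x : V₁) (y : V₂) :
    ampLeft V₂ ρ a (x ⊗ₜ y) = ρ a x ⊗ₜ y := rfl

theorem ampRight_tmul (ρ : R →ₙₐ[ℂ] Module.End ℂ V₂) (a : R) (x : V₁) (y : V₂) :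
    ampRight V₁ ρ a (x ⊗ₜ y) = x ⊗ₜ ρ a y := rfl

variable (F : PosForm (V₁ ⊗[ℂ] V₂) D)

theorem ampLeft_adjoint (ρ : R →ₙₐ[ℂ] Module.End ℂ V₁)
    (h : ∀ a x y x' y', F.ip (ρ a x ⊗ₜ y) (x' ⊗ₜ y') = F.ip (x ⊗ₜ y) (ρ (star a) x' ⊗ₜ y'))
    (a : R) (z w : V₁ ⊗[ℂ] V₂) :
    F.ip (ampLeft V₂ ρ a z) w = F.ip z (ampLeft V₂ ρ (star a) w) :=
  ip_left_ext (f := F.ip.comp (ampLeft V₂ ρ a)) (g := F.ip.compl₂ (ampLeft V₂ ρ (star a)))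
    (h a) z w

theorem ampRight_adjoint (ρ : R →ₙₐ[ℂ] Module.End ℂ V₂)
    (h : ∀ a x y x' y', F.ip (x ⊗ₜ ρ a y) (x' ⊗ₜ y') = F.ip (x ⊗ₜ y) (x' ⊗ₜ ρ (star a) y'))
    (a : R) (z w : V₁ ⊗[ℂ] V₂) :
    F.ip (ampRight V₁ ρ a z) w = F.ip z (ampRight V₁ ρ (star a) w) :=
  ip_left_ext (f := F.ip.comp (ampRight V₁ ρ a)) (g := F.ip.compl₂ (ampRight V₁ ρ (star a)))
    (h a) z w

/-- Operators that act on different tensor factors commute. -/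
theorem commute_of_amp {S T : F.Adj} {s : Module.End ℂ V₁} {t : Module.End ℂ V₂}
    (hS : ∀ x y, S.op (F.toHilb (x ⊗ₜ y)) = F.toHilb (s x ⊗ₜ y))
    (hT : ∀ x y, T.op (F.toHilb (x ⊗ₜ y)) = F.toHilb (x ⊗ₜ t y)) : Commute S T :=
  Adj.ext_toHilb fun z => by
    induction z with
    | zero => simp
    | add z z' h h' => rw [map_add, map_add, map_add, h, h']
    | tmul x y => rw [mul_op, mul_op, hS, hT, hT, hS]

section CStar

variable {R₁ R₂ : Type*} [NonUnitalCStarAlgebra R₁] [NonUnitalCStarAlgebra R₂]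
  (ρ₁ : R₁ →ₙₐ[ℂ] Module.End ℂ V₁) (ρ₂ : R₂ →ₙₐ[ℂ] Module.End ℂ V₂)
  (h₁ : ∀ a x y x' y', F.ip (ρ₁ a x ⊗ₜ y) (x' ⊗ₜ y') = F.ip (x ⊗ₜ y) (ρ₁ (star a) x' ⊗ₜ y'))
  (h₂ : ∀ a x y x' y', F.ip (x ⊗ₜ ρ₂ a y) (x' ⊗ₜ y') = F.ip (x ⊗ₜ y) (x' ⊗ₜ ρ₂ (star a) y'))

/-- The representation `a ⊗ b ↦ ρ₁(a) ⊗ ρ₂(b)` of the algebraic tensor product of two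
C*-algebras. -/
def tensorRep : R₁ ⊗[ℂ] R₂ →⋆ₙₐ[ℂ] F.Adj :=
  -- The amplified representations are representations of C*-algebras, hence automatically bounded.
  have b₁ := fun a => ⟨‖a‖, F.nrm_rep_le _ (F.ampLeft_adjoint ρ₁ h₁) a⟩
  have b₂ := fun a => ⟨‖a‖, F.nrm_rep_le _ (F.ampRight_adjoint ρ₂ h₂) a⟩
  tensorHom (F.rep (ampLeft V₂ ρ₁) (F.ampLeft_adjoint ρ₁ h₁) b₁)
    (F.rep (ampRight V₁ ρ₂) (F.ampRight_adjoint ρ₂ h₂) b₂) fun a b =>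
      F.commute_of_amp (s := ρ₁ a) (t := ρ₂ b) (fun x y => F.rep_toHilb _ _ _ a (x ⊗ₜ y))
        (fun x y => F.rep_toHilb _ _ _ b (x ⊗ₜ y))

theorem tensorRep_tmul (a : R₁) (b : R₂) (x : V₁) (y : V₂) :
    (F.tensorRep ρ₁ ρ₂ h₁ h₂ (a ⊗ₜ b)).op (F.toHilb (x ⊗ₜ y)) = F.toHilb (ρ₁ a x ⊗ₜ ρ₂ b y) := by
  rw [tensorRep, tensorHom_tmul, mul_op, rep_toHilb, rep_toHilb, ampRight_tmul, ampLeft_tmul]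

end CStar

end PosForm

/-! ### Positive matrices and positive functionals -/

section Gram

variable {R : Type*} [NonUnitalCStarAlgebra R] [PartialOrder R] [StarOrderedRing R]

theorem eq_zero_of_mul_mul_self_eq_zero {N : R} (hN : star N = N) (h : N * N * N = 0) : N = 0 := by
  have h2 : N * N = 0 := by
    rw [← CStarRing.star_mul_self_eq_zero_iff, star_mul, hN, ← mul_assoc, h, zero_mul]
  rw [← CStarRing.star_mul_self_eq_zero_iff, hN, h2]

theorem exists_nonneg_sub_nonneg (x : R) (hx : IsSelfAdjoint x) :
    ∃ p n : R, x = p - n ∧ n * p = 0 ∧ 0 ≤ p ∧ 0 ≤ n :=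
  ⟨x⁺, x⁻, (CFC.posPart_sub_negPart x hx).symm, CFC.negPart_mul_posPart x,
    CFC.posPart_nonneg x, CFC.negPart_nonneg x⟩

theorem exists_eq_star_mul_self (x : R) (hx : 0 ≤ x) : ∃ c, x = star c * c :=
  CStarAlgebra.nonneg_iff_eq_star_mul_self.mp hx

/-- A matrix over a C*-algebra that is positive as a form is a Gram matrix. -/
theorem exists_gram {n : Type*} [Fintype n] [DecidableEq n] (M : n → n → R)
    (hM : ∀ i j, star (M i j) = M j i)
    (hpos : ∀ v : n → R, 0 ≤ ∑ i, ∑ j, star (v i) * M i j * v j) :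
    ∃ c : n → n → R, ∀ i j, M i j = ∑ k, star (c k i) * c k j := by
  let X : CStarMatrix n n R := CStarMatrix.ofMatrix M
  have hX : IsSelfAdjoint X := by
    ext i j
    rw [CStarMatrix.star_apply]
    exact hM j i
  obtain ⟨P, N, hPN, hNP, hP0, hN0⟩ := exists_nonneg_sub_nonneg X hX
  -- Without a negative part, X is positive in the C*-algebra of matrices, so X = c* c, and this
  -- read entrywise is the claim.
  suffices h : N = 0 by
    rw [h, sub_zero] at hPN
    replace h : 0 ≤ X := hPN ▸ hP0
    obtain ⟨c, hc⟩ := exists_eq_star_mul_self X h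
    refine ⟨c, fun i j => ?_⟩
    change X i j = _
    rw [hc, CStarMatrix.mul_apply]
    exact Finset.sum_congr rfl fun k _ => by rw [CStarMatrix.star_apply]
  have hNs : star N = N := (IsSelfAdjoint.of_nonneg hN0).star_eq
  -- N annihilates the positive part of X. The diagonal entries of N X N are the values of the form
  -- at the columns of N, hence nonnegative. Those of N³ = (qN)* (qN) are sums of squares. So these
  -- sums vanish, and qN = 0.
  have h1 : N * X * N = -(N * N * N) := by
    rw [hPN, mul_sub, hNP, zero_sub, neg_mul]
  obtain ⟨q, hq⟩ := exists_eq_star_mul_self N hN0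
  have h2 : N * N * N = star (q * N) * (q * N) := by
    rw [star_mul, hNs, mul_assoc N (star q), ← mul_assoc (star q), ← hq, mul_assoc]
  have h3 : q * N = 0 := by
    have h4 : ∀ k, (star (q * N) * (q * N)) k k = ∑ l, star ((q * N) l k) * (q * N) l k := by
      intro k
      rw [CStarMatrix.mul_apply]
      exact Finset.sum_congr rfl fun l _ => by rw [CStarMatrix.star_apply]
    have h5 : ∀ k, 0 ≤ (N * X * N) k k := by
      intro k
      have := hpos fun i => N i k
      convert this using 1
      simp only [CStarMatrix.mul_apply, Finset.sum_mul]
      rw [Finset.sum_comm]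
      refine Finset.sum_congr rfl fun i _ => Finset.sum_congr rfl fun j _ => ?_
      rw [← CStarMatrix.star_apply, hNs]
      rfl
    ext l k
    have h6 : ∑ l, star ((q * N) l k) * (q * N) l k = 0 := by
      refine le_antisymm ?_ (Finset.sum_nonneg fun l _ => star_mul_self_nonneg _)
      rw [← h4, ← h2, ← neg_nonneg, ← CStarMatrix.neg_apply, ← h1]
      exact h5 k
    have h7 := (Finset.sum_eq_zero_iff_of_nonneg fun l _ => star_mul_self_nonneg _).mp h6 l
      (Finset.mem_univ l)
    exact CStarRing.star_mul_self_eq_zero_iff _ |>.mp h7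
  exact eq_zero_of_mul_mul_self_eq_zero hNs (by rw [h2, h3, mul_zero])

end Gram

open scoped ComplexOrder in
/-- The positive functionals of a C*-algebra separate its elements. -/
theorem exists_posForm_ne_zero {R : Type*} [NonUnitalCStarAlgebra R] (a : R) (ha : a ≠ 0) :
    ∃ φ : R →ₗ[ℂ] ℂ, (∀ x, star (φ x) = φ (star x)) ∧ (∀ x, 0 ≤ φ (star x * x)) ∧
      φ (star a * a) ≠ 0 := by
  let := CStarAlgebra.spectralOrder R
  let := CStarAlgebra.spectralOrderedRing R
  have h1 : -(star a * a) ∉ {x : R | 0 ≤ x} := by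
    intro h
    have h2 : star a * a = 0 :=
      le_antisymm (neg_nonneg.mp h) (star_mul_self_nonneg a)
    exact ha (CStarRing.star_mul_self_eq_zero_iff _ |>.mp h2)
  have hconv : Convex ℝ {x : R | 0 ≤ x} := fun x (hx : 0 ≤ x) y (hy : 0 ≤ y) s t hs ht _ =>
    show 0 ≤ s • x + t • y from add_nonneg (smul_nonneg hs hx) (smul_nonneg ht hy)
  -- A real functional f separates -(a* a) from the closed cone of positive elements. Being bounded
  -- below on a cone, it is nonnegative there by scaling.
  obtain ⟨f, r, hf1, hf2⟩ := geometric_hahn_banach_point_closed hconv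
    (CStarAlgebra.isClosed_nonneg (A := R)) h1
  have hr : r < 0 := by simpa using hf2 0 (le_refl (0 : R))
  have hf : ∀ x : R, 0 ≤ x → 0 ≤ f x := by
    intro x hx
    by_contra! hlt
    have h3 := hf2 ((r / f x) • x) (smul_nonneg (div_nonneg_of_nonpos hr.le hlt.le) hx)
    rw [map_smul, smul_eq_mul, div_mul_cancel₀ _ hlt.ne] at h3
    exact lt_irrefl r h3
  -- Symmetrizing f makes its complexification hermitian. Since i x* x is skew-adjoint, g vanishes
  -- on it, which leaves φ(x* x) = 2 f(x* x).
  let g : Module.Dual ℝ R :=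
    { toFun := fun x => f (x + star x)
      map_add' := fun x y => by rw [← map_add, star_add]; congr 1; abel
      map_smul' := fun c x => by simp [mul_add] }
  have hg : ∀ x, g x = f (x + star x) := fun x => rfl
  have hgs : ∀ x, g (star x) = g x := fun x => by rw [hg, hg, star_star, add_comm]
  have hφ : ∀ x, (g.extendRCLike : Module.Dual ℂ R) x = g x - Complex.I * g (Complex.I • x) :=
    fun x => Module.Dual.extendRCLike_apply g x
  have hsq : ∀ x, (g.extendRCLike : Module.Dual ℂ R) (star x * x) =
      ((2 * f (star x * x) : ℝ) : ℂ) := by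
    intro x
    rw [hφ, hg, hg, star_smul, star_mul, star_star, Complex.star_def, Complex.conj_I, neg_smul,
      add_neg_cancel, map_zero, ← two_smul ℝ, map_smul]
    simp
  refine ⟨g.extendRCLike, fun x => ?_, fun x => ?_, ?_⟩
  · rw [hφ, hφ, hgs]
    have : g (Complex.I • star x) = - g (Complex.I • x) := by
      rw [← hgs, star_smul, star_star, Complex.star_def, Complex.conj_I, neg_smul, map_neg]
    rw [this]
    simp
  · rw [hsq]
    exact_mod_cast mul_nonneg two_pos.le (hf _ (star_mul_self_nonneg x))
  · rw [hsq]
    rw [map_neg] at hf1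
    have : 0 < f (star a * a) := by linarith
    exact_mod_cast (mul_pos two_pos this).ne'

/-! ### Slices -/

namespace PosForm

open scoped ComplexOrder

variable {V₁ V₂ D : Type*} [AddCommGroup V₁] [Module ℂ V₁] [AddCommGroup V₂] [Module ℂ V₂]
  [NonUnitalCStarAlgebra D] [PartialOrder D] [StarOrderedRing D]
  (F₁ : PosForm V₁ ℂ) (F₂ : PosForm V₂ D)

/-- The form `⟨x ⊗ y, x' ⊗ y'⟩ = ⟨x, x'⟩ ⟨y, y'⟩`. -/
def sliceIp : V₁ ⊗[ℂ] V₂ →ₗ⋆[ℂ] V₁ ⊗[ℂ] V₂ →ₗ[ℂ] D :=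
  TensorProduct.lift <| LinearMap.mk₂'ₛₗ (starRingEnd ℂ) (starRingEnd ℂ)
    (fun x y => TensorProduct.lift ((LinearMap.lsmul ℂ D).compl₁₂ (F₁.ip x) (F₂.ip y)))
    (fun x x' y => by ext z w; simp)
    (fun c x y => by ext z w; simp [mul_smul])
    (fun x y y' => by ext z w; simp)
    (fun c x y => by ext z w; simp [smul_smul, mul_comm])

theorem sliceIp_tmul (x x' : V₁) (y y' : V₂) :
    sliceIp F₁ F₂ (x ⊗ₜ y) (x' ⊗ₜ y') = F₁.ip x x' • F₂.ip y y' := by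
  simp [sliceIp]

theorem sliceIp_sum {ι : Type*} [Fintype ι] (x : ι → V₁) (y : ι → V₂) :
    sliceIp F₁ F₂ (∑ i, x i ⊗ₜ y i) (∑ i, x i ⊗ₜ y i) =
      ∑ i, ∑ j, F₁.ip (x i) (x j) • F₂.ip (y i) (y j) := by
  simp only [map_sum, LinearMap.sum_apply, sliceIp_tmul]
  exact Finset.sum_comm

/-- The form of this matrix at v is the value of `F₁` at the vector Σ vᵢ xᵢ, hence nonnegative, and
`exists_gram` applies over ℂ. -/
theorem exists_gram_complex {ι : Type*} [Fintype ι] [DecidableEq ι] (x : ι → V₁) :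
    ∃ c : ι → ι → ℂ, ∀ i j, F₁.ip (x i) (x j) = ∑ k, star (c k i) * c k j := by
  refine exists_gram (R := ℂ) (fun i j => F₁.ip (x i) (x j)) (fun i j => F₁.star_ip _ _) fun v => ?_
  convert F₁.nonneg (∑ i, v i • x i) using 1
  simp only [map_sum, LinearMap.sum_apply, map_smul, LinearMap.map_smulₛₗ, LinearMap.smul_apply,
    smul_eq_mul]
  rw [Finset.sum_comm]
  refine Finset.sum_congr rfl fun i _ => ?_
  rw [Finset.mul_sum]
  refine Finset.sum_congr rfl fun j _ => ?_
  rw [Complex.star_def]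
  ring

/-- Factoring the scalar coefficients regroups the double sum into values of `F₂` on the diagonal.
This shows positivity, and if the total vanishes then so does every summand. -/
theorem sliceIp_sum_of_gram {ι : Type*} [Fintype ι] (x : ι → V₁) (y : ι → V₂)
    (c : ι → ι → ℂ) (hc : ∀ i j, F₁.ip (x i) (x j) = ∑ k, star (c k i) * c k j) :
    sliceIp F₁ F₂ (∑ i, x i ⊗ₜ y i) (∑ i, x i ⊗ₜ y i) =
      ∑ k, F₂.ip (∑ i, c k i • y i) (∑ i, c k i • y i) := by
  rw [sliceIp_sum]
  simp only [map_sum, LinearMap.sum_apply, map_smul, LinearMap.map_smulₛₗ, LinearMap.smul_apply,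
    hc, Finset.sum_smul]
  rw [Finset.sum_congr rfl fun i _ => Finset.sum_comm, Finset.sum_comm]
  refine Finset.sum_congr rfl fun k _ => ?_
  rw [Finset.sum_comm]
  refine Finset.sum_congr rfl fun j _ => ?_
  rw [Finset.smul_sum]
  refine Finset.sum_congr rfl fun i _ => ?_
  rw [smul_smul, mul_comm]
  rfl

theorem _root_.TensorProduct.exists_fintype_sum {V₁ : Type u₁} {V₂ : Type u₂} [AddCommGroup V₁]
    [Module ℂ V₁] [AddCommGroup V₂] [Module ℂ V₂] (z : V₁ ⊗[ℂ] V₂) :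
    ∃ (ι : Type (max u₁ u₂)) (_ : Fintype ι) (x : ι → V₁) (y : ι → V₂), z = ∑ i, x i ⊗ₜ y i := by
  obtain ⟨S, rfl⟩ := TensorProduct.exists_finset z
  exact ⟨S, inferInstance, fun i => i.1.1, fun i => i.1.2,
    (Finset.sum_coe_sort S fun i => i.1 ⊗ₜ[ℂ] i.2).symm⟩

/-- The tensor product of a scalar valued and a C*-algebra valued positive form. -/
def sliceForm : PosForm (V₁ ⊗[ℂ] V₂) D where
  ip := sliceIp F₁ F₂
  star_ip z w := by
    induction z with
    | zero => simp
    | add z z' h h' => simp only [map_add, LinearMap.add_apply, star_add, h, h']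
    | tmul x y =>
    induction w with
    | zero => simp
    | add z z' h h' => simp only [map_add, LinearMap.add_apply, star_add, h, h']
    | tmul x' y' =>
      rw [sliceIp_tmul, sliceIp_tmul, star_smul, F₁.star_ip, F₂.star_ip]
  nonneg z := by
    classical
    obtain ⟨ι, _, x, y, rfl⟩ := TensorProduct.exists_fintype_sum z
    obtain ⟨c, hc⟩ := F₁.exists_gram_complex x
    rw [sliceIp_sum_of_gram F₁ F₂ x y c hc]
    exact Finset.sum_nonneg fun k _ => F₂.nonneg _

/-- If `⟨·,·⟩` is definite on the second factor, the tensor products with a separating family of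
forms on the first factor are separating. -/
theorem eq_zero_of_sliceForm {Φ : Type*} (F : Φ → PosForm V₁ ℂ)
    (hF : ∀ x, (∀ φ, (F φ).ip x x = 0) → x = 0) (hF₂ : ∀ y, F₂.ip y y = 0 → y = 0)
    (z : V₁ ⊗[ℂ] V₂) (hz : ∀ φ, ((F φ).sliceForm F₂).ip z z = 0) : z = 0 := by
  classical
  -- Expand z = Σ mᵢ ⊗ bᵢ along a basis of the second factor. If the form vanishes at z, then Σᵢ dₖᵢ
  -- bᵢ = 0 for every k by definiteness, so d = 0 by independence, and ⟨mᵢ, mᵢ⟩ = Σₖ |dₖᵢ|² = 0 for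
  -- every φ.
  let b := Module.Basis.ofVectorSpace ℂ V₂
  obtain ⟨c, rfl⟩ := TensorProduct.eq_repr_basis_right b z
  have hc : (c.sum fun i m => m ⊗ₜ[ℂ] b i) = ∑ i : c.support, c i.1 ⊗ₜ[ℂ] b i.1 :=
    (Finset.sum_coe_sort c.support fun i => c i ⊗ₜ[ℂ] b i).symm
  rw [hc] at hz ⊢
  have hli : LinearIndependent ℂ fun i : c.support => b i.1 :=
    b.linearIndependent.comp _ Subtype.val_injective
  refine Finset.sum_eq_zero fun i _ => ?_
  have h0 : c i.1 = 0 := hF _ fun φ => by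
    obtain ⟨d, hd⟩ := (F φ).exists_gram_complex fun i : c.support => c i.1
    have h1 := (sliceIp_sum_of_gram (F φ) F₂ (fun i : c.support => c i.1) (fun i => b i.1) d
      hd).symm.trans (hz φ)
    have h2 := (Finset.sum_eq_zero_iff_of_nonneg fun k _ => F₂.nonneg _).mp h1
    rw [hd i i]
    refine Finset.sum_eq_zero fun k _ => ?_
    have h3 := Fintype.linearIndependent_iff.mp hli (d k) (hF₂ _ (h2 k (Finset.mem_univ k))) i
    rw [h3, mul_zero]
  rw [h0, TensorProduct.zero_tmul]

end PosForm

/-! ### Faithfulness of the maximal C*-norm. -/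

section Faithful

open scoped ComplexOrder

/-- The positive functionals on a C*-algebra. -/
def PosFunctional (R : Type*) [NonUnitalCStarAlgebra R] : Type _ :=
  {φ : R →ₗ[ℂ] ℂ // (∀ x, star (φ x) = φ (star x)) ∧ ∀ x, 0 ≤ φ (star x * x)}

/-- The form `⟨x, y⟩ = φ(x* y)`. -/
def PosFunctional.form {R : Type*} [NonUnitalCStarAlgebra R] (φ : PosFunctional R) :
    PosForm R ℂ where
  ip := ((LinearMap.mul ℂ R).compr₂ φ.1).comp (starLinearEquiv ℂ (A := R) : R →ₗ⋆[ℂ] R)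
  star_ip x y := by
    change star (φ.1 (star x * y)) = φ.1 (star y * x)
    rw [φ.2.1, star_mul, star_star]
  nonneg x := φ.2.2 x

theorem PosFunctional.separating {R : Type*} [NonUnitalCStarAlgebra R] (a : R)
    (h : ∀ φ : PosFunctional R, φ.1 (star a * a) = 0) : a = 0 := by
  by_contra ha
  obtain ⟨φ, h1, h2, h3⟩ := exists_posForm_ne_zero a ha
  exact h3 (h ⟨φ, h1, h2⟩)

/-- The form `⟨x, y⟩ = x* y` on a C*-algebra. -/
def selfForm (R : Type*) [NonUnitalCStarAlgebra R] [PartialOrder R] [StarOrderedRing R] :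
    PosForm R R where
  ip := (LinearMap.mul ℂ R).comp (starLinearEquiv ℂ (A := R) : R →ₗ⋆[ℂ] R)
  star_ip x y := by
    change star (star x * y) = star y * x
    rw [star_mul, star_star]
  nonneg x := star_mul_self_nonneg x

variable {A B : Type*} [NonUnitalCStarAlgebra A] [NonUnitalCStarAlgebra B]

/-- The maximal C*-norm is a norm on the algebraic tensor product. -/
theorem eq_zero_of_maxTensorNorm_eq_zero (x : A ⊗[ℂ] B) (hx : maxTensorNorm A B x = 0) :
    x = 0 := by
  let := CStarAlgebra.spectralOrder B
  let := CStarAlgebra.spectralOrderedRing B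
  let F : PosFunctional A → PosForm (A ⊗[ℂ] B) B := fun φ => φ.form.sliceForm (selfForm B)
  have hF : ∀ φ a b a' b', (F φ).ip (a ⊗ₜ b) (a' ⊗ₜ b') = φ.1 (star a * a') • (star b * b') :=
    fun φ a b a' b' => PosForm.sliceIp_tmul _ _ _ _ _ _
  have hsep : ∀ z, (∀ φ, (F φ).ip z z = 0) → z = 0 := PosForm.eq_zero_of_sliceForm (selfForm B)
    (fun φ : PosFunctional A => φ.form) (fun a h => PosFunctional.separating a h)
    (fun b h => CStarRing.star_mul_self_eq_zero_iff _ |>.mp h)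
  -- For each φ, left multiplication is a *-representation of A ⊙ B on itself with the sliced form.
  -- Its norm at x is at most the maximal norm of x, which is 0, so x y is null for every φ.
  have h1 : ∀ y, x * y = 0 := fun y => hsep _ fun φ => by
    let T := (F φ).tensorRep (NonUnitalAlgHom.lmul ℂ A) (NonUnitalAlgHom.lmul ℂ B)
      (fun a x y x' y' => by
        simp only [NonUnitalAlgHom.coe_lmul_eq_mul, LinearMap.mul_apply', hF, star_mul, mul_assoc])
      (fun a x y x' y' => by
        simp only [NonUnitalAlgHom.coe_lmul_eq_mul, LinearMap.mul_apply', hF, star_mul, mul_assoc])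
    have hT : ∀ z w, (T z).op ((F φ).toHilb w) = (F φ).toHilb (z * w) := by
      intro z w
      induction z with
      | zero => rw [map_zero, zero_mul, PosForm.zero_op, map_zero]
      | add z z' h h' => rw [map_add, add_mul, PosForm.add_op, h, h', map_add]
      | tmul a b =>
      induction w with
      | zero => simp
      | add w w' h h' => rw [mul_add, map_add, map_add, h, h', map_add]
      | tmul a' b' =>
        rw [Algebra.TensorProduct.tmul_mul_tmul]
        exact (F φ).tensorRep_tmul (NonUnitalAlgHom.lmul ℂ A) (NonUnitalAlgHom.lmul ℂ B) _ _ a b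
          a' b'
    have h2 : T x = 0 := norm_le_zero_iff.mp ((norm_le_maxTensorNorm T x).trans_eq hx)
    have h3 := (F φ).norm_toHilb (x * y)
    rw [← hT, h2, PosForm.zero_op, norm_zero] at h3
    rw [← norm_eq_zero, ← PosForm.sq_nrm, ← h3, zero_pow two_ne_zero]
  -- There is no unit to insert for y. But the form depends on z* w only, so its value at z = w = x*
  -- is a slice of x x* = 0.
  have h4 : ∀ (φ : PosFunctional A) (z w : A ⊗[ℂ] B), (F φ).ip z w =
      TensorProduct.lift ((LinearMap.lsmul ℂ B).comp φ.1) (star z * w) := by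
    intro φ z w
    induction z with
    | zero => simp
    | add z z' h h' => rw [map_add, LinearMap.add_apply, star_add, add_mul, map_add, h, h']
    | tmul a b =>
    induction w with
    | zero => simp
    | add w w' h h' => rw [mul_add, map_add, map_add, h, h']
    | tmul a' b' =>
      rw [hF, TensorProduct.star_tmul, Algebra.TensorProduct.tmul_mul_tmul]
      rfl
  rw [← star_eq_zero]
  exact hsep _ fun φ => by rw [h4, star_star, h1, map_zero]

end Faithful

/-! ### The maximal C*-norm on the tensor product of two Fell bundles -/

instance {R : Type*} [NonUnitalRing R] [StarRing R] [Module ℂ R] [IsScalarTower ℂ R R]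
    [SMulCommClass ℂ R R] [StarModule ℂ R] (p : CStarSeminorm R) : PartialOrder p.Compl :=
  CStarAlgebra.spectralOrder _

instance {R : Type*} [NonUnitalRing R] [StarRing R] [Module ℂ R] [IsScalarTower ℂ R R]
    [SMulCommClass ℂ R R] [StarModule ℂ R] (p : CStarSeminorm R) : StarOrderedRing p.Compl :=
  CStarAlgebra.spectralOrderedRing _

namespace StarBundle

variable {G : Type u} [Group G] (P : StarBundle.{u, v} G)

/-- From (ab)* (a'b') = b* (a* a') b', a product of two fibers is reduced to the action of the unit
fiber on one of them, which is how submultiplicativity of `max` is proved. -/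
theorem starMul_mulMap {s t r : G} (h : s * t = r) (a a' : P.fiber s) (b b' : P.fiber t) :
    P.starMul (P.mulMap h a b) (P.mulMap h a' b') =
      P.starMul b (P.mulMap (one_mul t) (P.starMul a a') b') := by
  subst h
  rw [P.starMul_apply rfl (inv_mul_cancel _), P.starMul_apply rfl (inv_mul_cancel t),
    P.starMul_apply rfl (inv_mul_cancel s), P.starMap_mulMap rfl rfl rfl rfl (mul_inv_rev s t).symm,
    P.mulMap_assoc _ _ (by group : s⁻¹ * (s * t) = t) (inv_mul_cancel t),
    P.mulMap_assoc (inv_mul_cancel s) (one_mul t) rfl (by group)]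

theorem star_starMul_aux {t : G} (a b : P.fiber t) :
    P.starMap inv_one (P.starMul a b) = P.starMul b a := by
  rw [P.starMul_apply rfl (inv_mul_cancel t), P.starMul_apply rfl (inv_mul_cancel t),
    P.starMap_mulMap _ (inv_inv t) rfl _ (inv_mul_cancel t), P.starMap_starMap]

theorem starMul_one_mulMap {t : G} (c : P.fiber 1) (a b : P.fiber t) :
    P.starMul (P.mulMap (one_mul t) c a) b =
      P.starMul a (P.mulMap (one_mul t) (P.starMap inv_one c) b) := by
  rw [P.starMul_apply rfl (inv_mul_cancel t), P.starMul_apply rfl (inv_mul_cancel t),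
    P.starMap_mulMap _ inv_one rfl _ (mul_one _), P.mulMap_assoc _ _ (one_mul t) (inv_mul_cancel t)]

theorem starMul_mulMap_one {t : G} (a b : P.fiber t) (c d : P.fiber 1) :
    P.starMul (P.mulMap (mul_one t) a c) (P.mulMap (mul_one t) b d) =
      P.mulMap (one_mul 1) (P.mulMap (one_mul 1) (P.starMap inv_one c) (P.starMul a b)) d := by
  rw [P.starMul_mulMap, P.starMul_apply inv_one (one_mul 1),
    P.mulMap_assoc (one_mul 1) (one_mul 1) (one_mul 1) (one_mul 1)]

end StarBundle

namespace FellBundle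

variable {G : Type u} [Group G] (A : FellBundle.{u, v} G)

theorem star_starMulUnit {t : G} (a b : A.fiber t) :
    star (A.starMulUnit a b) = A.starMulUnit b a := A.star_starMul_aux a b

theorem eq_zero_of_starMulUnit {t : G} (a : A.fiber t) (h : A.starMulUnit a a = 0) : a = 0 := by
  refine A.cstarNorm.eq_zero t a (pow_eq_zero_iff two_ne_zero |>.mp ?_)
  rw [← A.cstarNorm.starMul_self]
  exact (congrArg (A.cstarNorm.nrm 1) h).trans (map_zero _)

/-- The form `⟨a, b⟩ = a* b` on a fiber. -/
def fiberForm (t : G) : PosForm (A.fiber t) A.UnitFiber where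
  ip := A.starMulUnit
  star_ip := A.star_starMulUnit
  nonneg := A.starMulUnit_nonneg

/-- The left action of the unit fiber on a fiber. -/
def unitRep (t : G) : A.UnitFiber →ₙₐ[ℂ] Module.End ℂ (A.fiber t) where
  toFun c := A.mulMap (one_mul t) c
  map_smul' c a := map_smul (A.mulMap (one_mul t)) c a
  map_zero' := map_zero (A.mulMap (one_mul t))
  map_add' := map_add (A.mulMap (one_mul t))
  map_mul' a b := LinearMap.ext fun c =>
    A.mulMap_assoc (one_mul 1) (one_mul t) (one_mul t) (one_mul t) a b c

theorem starMulUnit_unitRep {t : G} (c : A.UnitFiber) (a b : A.fiber t) :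
    A.starMulUnit (A.unitRep t c a) b = A.starMulUnit a (A.unitRep t (star c) b) :=
  A.starMul_one_mulMap c a b

/-- Through the right action of A_e on the fiber, the form of the matrix (aᵢ* aⱼ) at v is w* w with
w = Σ aᵢ vᵢ, which is positive in a Fell bundle. -/
theorem exists_gram_fiber {t : G} {ι : Type*} [Fintype ι] [DecidableEq ι] (a : ι → A.fiber t) :
    ∃ c : ι → ι → A.UnitFiber, ∀ i j,
      A.starMulUnit (a i) (a j) = ∑ k, star (c k i) * c k j := by
  refine exists_gram (fun i j => A.starMulUnit (a i) (a j)) (fun i j => A.star_starMulUnit _ _)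
    fun v => ?_
  convert A.starMulUnit_nonneg (∑ i, A.mulMap (mul_one t) (a i) (v i)) using 1
  simp only [map_sum, LinearMap.sum_apply]
  rw [Finset.sum_comm]
  exact Finset.sum_congr rfl fun i _ => Finset.sum_congr rfl fun j _ =>
    (A.starMul_mulMap_one (a j) (a i) (v j) (v i)).symm

end FellBundle

/-! ### The form z* w on A_t ⊙ B_s and the norm it defines. -/

namespace FellBundle

variable {G : Type u₁} [Group G] {H : Type u₂} [Group H]
  (A : FellBundle.{u₁, v₁} G) (B : FellBundle.{u₂, v₂} H)

/-- The product `z* w` of two elements of a fiber of `A ⊙ B`, as an element of `A_e ⊙ B_e`. -/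
def starMulTensor (t : G) (s : H) : A.fiber t ⊗[ℂ] B.fiber s →ₗ⋆[ℂ]
    A.fiber t ⊗[ℂ] B.fiber s →ₗ[ℂ] A.UnitFiber ⊗[ℂ] B.UnitFiber :=
  (A.tensor B).starMul (t := (t, s))

/-- The product of elements of `A_e ⊙ B_e` and `A_t ⊙ B_s`. -/
def unitMulTensor (t : G) (s : H) : A.UnitFiber ⊗[ℂ] B.UnitFiber →ₗ[ℂ]
    A.fiber t ⊗[ℂ] B.fiber s →ₗ[ℂ] A.fiber t ⊗[ℂ] B.fiber s :=
  (A.tensor B).mulMap (s := (1, 1)) (t := (t, s)) (r := (t, s)) (one_mul (t, s))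

variable {t : G} {s : H}

theorem starMulTensor_tmul (a a' : A.fiber t) (b b' : B.fiber s) :
    A.starMulTensor B t s (a ⊗ₜ[ℂ] b) (a' ⊗ₜ[ℂ] b') =
      A.starMulUnit a a' ⊗ₜ B.starMulUnit b b' := rfl

theorem star_starMulTensor (z w : A.fiber t ⊗[ℂ] B.fiber s) :
    star (A.starMulTensor B t s z w) = A.starMulTensor B t s w z := by
  induction z with
  | zero => simp
  | add z z' h h' => simp only [map_add, LinearMap.add_apply, star_add, h, h']
  | tmul x y =>
  induction w with
  | zero => simp
  | add z z' h h' => simp only [map_add, LinearMap.add_apply, star_add, h, h']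
  | tmul x' y' =>
    rw [starMulTensor_tmul, starMulTensor_tmul, TensorProduct.star_tmul, star_starMulUnit,
      star_starMulUnit]

/-- If c and d are Gram factors of (aᵢ* aⱼ) and (bᵢ* bⱼ), the elements y_{kl} = Σᵢ c_{ki} ⊗ d_{li}
do it. Since they lie in the algebraic tensor product, z* z is positive in the maximal completion.
-/
theorem exists_starMulTensor_eq_sum (z : A.fiber t ⊗[ℂ] B.fiber s) :
    ∃ (ι : Type (max v₁ v₂)) (_ : Fintype ι) (y : ι → A.UnitFiber ⊗[ℂ] B.UnitFiber),
      A.starMulTensor B t s z z = ∑ i, star (y i) * y i := by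
  classical
  obtain ⟨ι, _, a, b, rfl⟩ := TensorProduct.exists_fintype_sum z
  obtain ⟨c, hc⟩ := A.exists_gram_fiber a
  obtain ⟨d, hd⟩ := B.exists_gram_fiber b
  refine ⟨ι × ι, inferInstance, fun k => ∑ i, c k.1 i ⊗ₜ d k.2 i, ?_⟩
  rw [Fintype.sum_prod_type]
  simp only [map_sum, LinearMap.sum_apply, starMulTensor_tmul, hc, hd, TensorProduct.sum_tmul,
    TensorProduct.tmul_sum, star_sum, Finset.sum_mul, Finset.mul_sum, TensorProduct.star_tmul,
    Algebra.TensorProduct.tmul_mul_tmul]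
  have h2 : ∀ f : ι → ι → ι → ι → A.UnitFiber ⊗[ℂ] B.UnitFiber,
      ∑ i, ∑ j, ∑ k, ∑ l, f i j k l = ∑ k, ∑ l, ∑ i, ∑ j, f i j k l := by
    intro f
    rw [Finset.sum_congr rfl fun i _ => Finset.sum_comm, Finset.sum_comm]
    refine Finset.sum_congr rfl fun k _ => ?_
    rw [Finset.sum_congr rfl fun i _ => Finset.sum_comm, Finset.sum_comm]
  rw [h2]
  exact Finset.sum_comm

/-- The form `⟨z, w⟩ = z* w` on a fiber of `A ⊙ B`, with values in `A_e ⊗_max B_e`. -/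
def tensorFiberForm (t : G) (s : H) :
    PosForm (A.fiber t ⊗[ℂ] B.fiber s) (MaxTensor A.UnitFiber B.UnitFiber) where
  ip := (A.starMulTensor B t s).compr₂ₛₗ (maxTensorNorm A.UnitFiber B.UnitFiber).toCompl
  star_ip z w := by
    change star ((maxTensorNorm A.UnitFiber B.UnitFiber).of (A.starMulTensor B t s z w)) =
      (maxTensorNorm A.UnitFiber B.UnitFiber).of (A.starMulTensor B t s w z)
    rw [← map_star, star_starMulTensor]
  nonneg z := by
    obtain ⟨ι, _, y, hy⟩ := A.exists_starMulTensor_eq_sum B z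
    change 0 ≤ (maxTensorNorm A.UnitFiber B.UnitFiber).of (A.starMulTensor B t s z z)
    rw [hy, map_sum]
    refine Finset.sum_nonneg fun i _ => ?_
    rw [map_mul, map_star]
    exact star_mul_self_nonneg _

theorem tensorFiberForm_ip (z w : A.fiber t ⊗[ℂ] B.fiber s) :
    (A.tensorFiberForm B t s).ip z w =
      (maxTensorNorm A.UnitFiber B.UnitFiber).of (A.starMulTensor B t s z w) := rfl

theorem sq_nrm_tensorFiberForm (z : A.fiber t ⊗[ℂ] B.fiber s) :
    (A.tensorFiberForm B t s).nrm z ^ 2 =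
      maxTensorNorm A.UnitFiber B.UnitFiber (A.starMulTensor B t s z z) := by
  rw [PosForm.sq_nrm, tensorFiberForm_ip, CStarSeminorm.norm_of]

theorem starMulTensor_one (z w : A.UnitFiber ⊗[ℂ] B.UnitFiber) :
    A.starMulTensor B 1 1 z w = star z * w := by
  let f : A.UnitFiber ⊗[ℂ] B.UnitFiber →ₗ⋆[ℂ] A.UnitFiber ⊗[ℂ] B.UnitFiber →ₗ[ℂ]
    A.UnitFiber ⊗[ℂ] B.UnitFiber := A.starMulTensor B 1 1
  change f z w = _
  induction z with
  | zero => simp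
  | add z z' h h' => rw [star_add, add_mul, ← h, ← h', map_add, LinearMap.add_apply]
  | tmul a b =>
  induction w with
  | zero => simp
  | add z z' h h' => rw [mul_add, ← h, ← h', map_add]
  | tmul a' b' =>
    rw [TensorProduct.star_tmul, Algebra.TensorProduct.tmul_mul_tmul]
    refine (A.starMulTensor_tmul B (t := 1) (s := 1) a a' b b').trans ?_
    rw [show A.starMulUnit (t := 1) a a' = star a * a' from
        A.starMul_apply inv_one (one_mul 1) a a',
      show B.starMulUnit (t := 1) b b' = star b * b' from B.starMul_apply inv_one (one_mul 1) b b']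

theorem nrm_tensorFiberForm_one (x : A.UnitFiber ⊗[ℂ] B.UnitFiber) :
    (A.tensorFiberForm B 1 1).nrm x = maxTensorNorm A.UnitFiber B.UnitFiber x := by
  have h := (A.sq_nrm_tensorFiberForm B (t := 1) (s := 1) x).trans
    (congrArg (maxTensorNorm A.UnitFiber B.UnitFiber) (A.starMulTensor_one B x x))
  exact (sq_eq_sq₀ ((A.tensorFiberForm B 1 1).nrm_nonneg x) (CStarSeminorm.nonneg _ x)).mp
    (h.trans ((maxTensorNorm A.UnitFiber B.UnitFiber).star_mul_self x))

/-- The left actions of A_e and B_e on the fibers are adjointable for the forms a* b, so together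
they give a *-representation of A_e ⊙ B_e on A_t ⊙ B_s, and the maximal norm dominates every such
representation. -/
theorem nrm_unitMulTensor_le (z : A.UnitFiber ⊗[ℂ] B.UnitFiber) (w : A.fiber t ⊗[ℂ] B.fiber s) :
    (A.tensorFiberForm B t s).nrm (A.unitMulTensor B t s z w) ≤
      maxTensorNorm A.UnitFiber B.UnitFiber z * (A.tensorFiberForm B t s).nrm w := by
  set F := A.tensorFiberForm B t s with hF
  let T := F.tensorRep (A.unitRep t) (B.unitRep s)
    (fun a x y x' y' => by
      rw [hF, tensorFiberForm_ip, tensorFiberForm_ip, starMulTensor_tmul, starMulTensor_tmul,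
        starMulUnit_unitRep])
    (fun a x y x' y' => by
      rw [hF, tensorFiberForm_ip, tensorFiberForm_ip, starMulTensor_tmul, starMulTensor_tmul,
        starMulUnit_unitRep])
  have hT : (T z).op (F.toHilb w) = F.toHilb (A.unitMulTensor B t s z w) := by
    induction z with
    | zero => simp [PosForm.zero_op]
    | add z z' h h' => rw [map_add, PosForm.add_op, h, h', map_add, LinearMap.add_apply, map_add]
    | tmul a b =>
    induction w with
    | zero => simp
    | add w w' h h' => rw [map_add, map_add, h, h', map_add, map_add]
    | tmul a' b' => exact F.tensorRep_tmul (A.unitRep t) (B.unitRep s) _ _ a b a' b'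
  rw [← F.norm_toHilb, ← F.norm_toHilb, ← hT]
  refine ((T z).op.le_opNorm _).trans ?_
  gcongr
  exact norm_le_maxTensorNorm T z

open scoped ComplexOrder in
-- Slicing z* z by the positive functionals of A_e gives zero. The resulting scalar forms on A_t
-- separate points, because a* a = c* c for some c in A_e and positive functionals detect c.
theorem eq_zero_of_starMulTensor (z : A.fiber t ⊗[ℂ] B.fiber s)
    (hz : A.starMulTensor B t s z z = 0) : z = 0 := by
  let F : PosFunctional A.UnitFiber → PosForm (A.fiber t) ℂ := fun φ =>
    { ip := (A.starMulUnit).compr₂ₛₗ φ.1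
      star_ip := fun x y => by
        change star (φ.1 (A.starMulUnit x y)) = φ.1 (A.starMulUnit y x)
        rw [φ.2.1, star_starMulUnit]
      nonneg := fun x => by
        obtain ⟨c, hc⟩ := exists_eq_star_mul_self _ (A.starMulUnit_nonneg x)
        change 0 ≤ φ.1 (A.starMulUnit x x)
        rw [hc]
        exact φ.2.2 c }
  refine PosForm.eq_zero_of_sliceForm (B.fiberForm s) F (fun x hx => ?_)
    (fun y hy => B.eq_zero_of_starMulUnit y hy) z fun φ => ?_
  · obtain ⟨c, hc⟩ := exists_eq_star_mul_self _ (A.starMulUnit_nonneg x)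
    have h1 : c = 0 := PosFunctional.separating c fun φ => by
      rw [← hc]
      exact hx φ
    refine A.eq_zero_of_starMulUnit x ?_
    rw [hc, h1, mul_zero]
  · have h4 : ∀ (z w : A.fiber t ⊗[ℂ] B.fiber s), ((F φ).sliceForm (B.fiberForm s)).ip z w =
        TensorProduct.lift ((LinearMap.lsmul ℂ B.UnitFiber).comp φ.1)
          (A.starMulTensor B t s z w) := by
      intro z w
      induction z with
      | zero => simp
      | add z z' h h' =>
        rw [map_add, LinearMap.add_apply, h, h', map_add, LinearMap.add_apply, map_add]
      | tmul a b =>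
      induction w with
      | zero => simp
      | add w w' h h' => rw [map_add, h, h', map_add, map_add]
      | tmul a' b' => exact PosForm.sliceIp_tmul _ _ _ _ _ _
    rw [h4, hz, map_zero]

/-- The C*-norm on `A ⊙ B` that extends the maximal C*-norm of `A_e ⊙ B_e`. -/
def maxNorm : (A.tensor B).CStarNorm where
  nrm r := (show Seminorm ℂ (A.fiber r.1 ⊗[ℂ] B.fiber r.2) from
    { toFun := (A.tensorFiberForm B r.1 r.2).nrm
      map_zero' := by simp [PosForm.nrm]
      add_le' := (A.tensorFiberForm B r.1 r.2).nrm_add_le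
      neg' := fun x => by simp [PosForm.nrm]
      smul' := (A.tensorFiberForm B r.1 r.2).nrm_smul })
  eq_zero r z hz := by
    refine A.eq_zero_of_starMulTensor B (t := r.1) (s := r.2) z
      (eq_zero_of_maxTensorNorm_eq_zero _ ?_)
    refine (A.sq_nrm_tensorFiberForm B (t := r.1) (s := r.2) z).symm.trans ?_
    exact (congrArg (· ^ 2) hz).trans (zero_pow two_ne_zero)
  -- (xy)* (xy) is the inner product of y with (x* x) y and is positive, so the sharp Cauchy–Schwarz
  -- inequality bounds ‖xy‖² by ‖y‖ · ‖x* x‖_max ‖y‖ = ‖x‖² ‖y‖².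
  mul_le {s t r} h x y := by
    let F := A.tensorFiberForm B t.1 t.2
    have h1 : (A.tensorFiberForm B r.1 r.2).ip ((A.tensor B).mulMap h x y)
        ((A.tensor B).mulMap h x y) =
        F.ip y (A.unitMulTensor B t.1 t.2 (A.starMulTensor B s.1 s.2 x x) y) :=
      congrArg (maxTensorNorm A.UnitFiber B.UnitFiber).of ((A.tensor B).starMul_mulMap h x x y y)
    have h2 : (A.tensorFiberForm B r.1 r.2).nrm ((A.tensor B).mulMap h x y) ^ 2 ≤
        ((A.tensorFiberForm B s.1 s.2).nrm x * F.nrm y) ^ 2 := by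
      refine ((PosForm.sq_nrm _ _).trans (congrArg norm h1)).trans_le ?_
      refine (PosForm.norm_ip_le_of_nonneg _ (h1 ▸ PosForm.nonneg _ _)).trans ?_
      calc _ ≤ F.nrm y * (maxTensorNorm A.UnitFiber B.UnitFiber
              (A.starMulTensor B s.1 s.2 x x) * F.nrm y) :=
            mul_le_mul_of_nonneg_left (A.nrm_unitMulTensor_le B _ y) (F.nrm_nonneg y)
        _ = F.nrm y * ((A.tensorFiberForm B s.1 s.2).nrm x ^ 2 * F.nrm y) := by
            congr 2
            exact (A.sq_nrm_tensorFiberForm B (t := s.1) (s := s.2) x).symm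
        _ = _ := by ring
    exact le_of_sq_le_sq h2 (mul_nonneg (PosForm.nrm_nonneg _ _) (PosForm.nrm_nonneg _ _))
  starMul_self r x := (A.nrm_tensorFiberForm_one B (A.starMulTensor B r.1 r.2 x x)).trans
    (A.sq_nrm_tensorFiberForm B (t := r.1) (s := r.2) x).symm
  -- In the completion x* x = d* d. Approximating d by some c in A_e ⊙ B_e gives the element
  -- required.
  pos r x ε hε := by
    let p := maxTensorNorm A.UnitFiber B.UnitFiber
    obtain ⟨d, hd⟩ := exists_eq_star_mul_self _ ((A.tensorFiberForm B r.1 r.2).nonneg x)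
    have ho : IsOpen {y : p.Compl | ‖star d * d - star y * y‖ < ε} :=
      isOpen_lt (by fun_prop) continuous_const
    obtain ⟨c, hc⟩ := p.denseRange_of.exists_mem_open ho ⟨d, by
      change ‖star d * d - star d * d‖ < ε
      rwa [sub_self, norm_zero]⟩
    refine ⟨c, ?_⟩
    have h1 : p (A.starMulTensor B r.1 r.2 x x - star c * c) < ε := by
      rw [← p.norm_of, map_sub, map_mul, map_star]
      exact hd ▸ hc
    refine lt_of_eq_of_lt ?_ h1
    refine (A.nrm_tensorFiberForm_one B (A.starMulTensor B r.1 r.2 x x -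
      A.starMulTensor B 1 1 c c)).trans ?_
    exact congrArg (fun y => p (A.starMulTensor B r.1 r.2 x x - y)) (A.starMulTensor_one B c c)

theorem maxNorm_one (x : A.UnitFiber ⊗[ℂ] B.UnitFiber) :
    (A.maxNorm B).nrm (1, 1) x = maxTensorNorm A.UnitFiber B.UnitFiber x :=
  A.nrm_tensorFiberForm_one B x

end FellBundle

/-! ### Homomorphisms of the cross-sectional C*-algebra of a completed bundle -/

namespace StarBundle

variable {G : Type u} [Group G] {P : StarBundle.{u, v} G}

theorem starMul_δ {t : G} (a : P.fiber t) : star (P.δ t a) * P.δ t a = P.δ 1 (P.starMul a a) := by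
  rw [P.star_δ rfl, P.δ_mul_δ (inv_mul_cancel t)]
  rfl

/-- The *-homomorphism of `C_c(A)` given by its restrictions to the fibers. -/
def liftHom {E : Type*} [NonUnitalRing E] [StarRing E] [Module ℂ E]
    (f : ∀ t, P.fiber t →ₗ[ℂ] E)
    (hmul : ∀ (s t : G) a b, f (s * t) (P.mulMap rfl a b) = f s a * f t b)
    (hstar : ∀ (t : G) a, f t⁻¹ (P.starMap rfl a) = star (f t a)) : P.Cc →⋆ₙₐ[ℂ] E where
  toFun := P.liftCc f
  map_smul' := map_smul _
  map_zero' := map_zero _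
  map_add' := map_add _
  map_mul' x y := by
    induction x using P.Cc_induction with
    | h0 => simp
    | hadd x x' h h' => rw [add_mul, map_add, h, h', map_add, add_mul]
    | hδ s a =>
    induction y using P.Cc_induction with
    | h0 => simp
    | hadd x x' h h' => rw [mul_add, map_add, h, h', map_add, mul_add]
    | hδ t b => rw [P.δ_mul_δ rfl, liftCc_δ, liftCc_δ, liftCc_δ, hmul]
  map_star' x := by
    induction x using P.Cc_induction with
    | h0 => simp
    | hadd x x' h h' => rw [star_add, map_add, h, h', map_add, star_add]
    | hδ s a => rw [P.star_δ rfl, liftCc_δ, liftCc_δ, hstar]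

theorem liftHom_δ {E : Type*} [NonUnitalRing E] [StarRing E] [Module ℂ E]
    (f : ∀ t, P.fiber t →ₗ[ℂ] E)
    (hmul : ∀ (s t : G) a b, f (s * t) (P.mulMap rfl a b) = f s a * f t b)
    (hstar : ∀ (t : G) a, f t⁻¹ (P.starMap rfl a) = star (f t a)) (t : G) (a : P.fiber t) :
    liftHom f hmul hstar (P.δ t a) = f t a := P.liftCc_δ f t a

namespace CStarNorm

variable (n : P.CStarNorm)

/-- The inclusion of `C_c(A)` into the finitely supported sections of the completed bundle. -/
def toComplCc : P.Cc →⋆ₙₐ[ℂ] n.compl.Cc :=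
  liftHom (fun t => (n.compl.δ t).comp n.toCompl)
    (fun s t a b => by
      rw [LinearMap.comp_apply, LinearMap.comp_apply, LinearMap.comp_apply, n.compl.δ_mul_δ rfl]
      exact congrArg (n.compl.δ (s * t)) (n.mulCompl_coe rfl a b).symm)
    (fun t a => by
      rw [LinearMap.comp_apply, LinearMap.comp_apply, n.compl.star_δ rfl]
      exact congrArg (n.compl.δ t⁻¹) (n.starCompl_coe rfl a).symm)

theorem toComplCc_δ (t : G) (a : P.fiber t) :
    n.toComplCc (P.δ t a) = n.compl.δ t (n.toCompl a) := liftHom_δ _ _ _ _ _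

/-- The canonical *-homomorphism of `C_c(A)` into the cross-sectional C*-algebra of the completed
bundle. -/
def toComplCStar : P.Cc →⋆ₙₐ[ℂ] n.compl.CStar := n.compl.toCStar.comp n.toComplCc

theorem toComplCStar_δ (t : G) (a : P.fiber t) :
    n.toComplCStar (P.δ t a) = n.compl.toCStar (n.compl.δ t (n.toCompl a)) :=
  congrArg n.compl.toCStar (n.toComplCc_δ t a)

theorem norm_toCStar_δ_le (t : G) (x : n.ComplFib t) :
    ‖n.compl.toCStar (n.compl.δ t x)‖ ≤ ‖x‖ :=
  (n.compl.univNorm.norm_of _).trans_le (n.compl.seminorm_δ_le n.compl.univNorm t x)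

/-- A closed additive subgroup of a normed space contains the image of `C_c` of the completed
bundle under a contractive linear map if it contains the image of `C_c(A)`. -/
theorem mem_of_isClosed {E : Type*} [NormedAddCommGroup E] [NormedSpace ℂ E]
    (L : n.compl.Cc →ₗ[ℂ] E) (hL : ∀ t (x : n.ComplFib t), ‖L (n.compl.δ t x)‖ ≤ ‖x‖)
    (S : AddSubgroup E) (hS : IsClosed (S : Set E))
    (h : ∀ t (a : P.fiber t), L (n.compl.δ t (n.toCompl a)) ∈ S) (f : n.compl.Cc) : L f ∈ S := by
  induction f using n.compl.Cc_induction with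
  | h0 => rw [map_zero]; exact S.zero_mem
  | hadd f g hf hg => rw [map_add]; exact S.add_mem hf hg
  | hδ t x =>
    let M : n.ComplFib t →ₗ[ℂ] E := L.comp (n.compl.δ t)
    have hM : Continuous M := AddMonoidHomClass.continuous_of_bound M 1 fun x => by
      rw [one_mul]; exact hL t x
    exact n.complFib_induction (q := fun x => M x ∈ S) (hS.preimage hM) (fun a => h t a) x

/-- On each completed fiber δ is contractive into C*, so the closure of the image contains all δ_x
with x in a completed fiber, and hence everything. -/
theorem denseRange_toComplCStar : DenseRange n.toComplCStar := by
  intro x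
  let S : AddSubgroup n.compl.CStar :=
    (AddMonoidHom.range (n.toComplCStar : P.Cc →+ n.compl.CStar)).topologicalClosure
  have hS : IsClosed (S : Set n.compl.CStar) := AddSubgroup.isClosed_topologicalClosure _
  induction x using n.compl.univNorm.compl_induction with
  | hc => exact hS
  | h f =>
    refine n.mem_of_isClosed (n.compl.toCStar : n.compl.Cc →ₗ[ℂ] n.compl.CStar)
      n.norm_toCStar_δ_le S hS (fun t a => ?_) f
    exact subset_closure ⟨P.δ t a, n.toComplCStar_δ t a⟩

variable {E : Type*} [NonUnitalCStarAlgebra E]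

variable (π : P.Cc →⋆ₙₐ[ℂ] E) (h : ∀ a : P.fiber 1, ‖π (P.δ 1 a)‖ ≤ n.nrm 1 a)

include h in
-- By the C*-identity ‖π(δ_a)‖² = ‖π(δ_{a* a})‖ with a* a in the unit fiber, so a bound on that
-- fiber controls all of them.
theorem norm_hom_δ_le (t : G) (a : P.fiber t) : ‖π (P.δ t a)‖ ≤ n.nrm t a := by
  refine le_of_sq_le_sq ?_ (apply_nonneg _ _)
  rw [← n.starMul_self, sq, ← CStarRing.norm_star_mul_self, ← map_star, ← map_mul, starMul_δ]
  exact h _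

/-- The extension of a *-homomorphism to a completed fiber. -/
def fiberExt (t : G) : n.ComplFib t →L[ℂ] E :=
  linExt (V := n.Fib t) ((π : P.Cc →ₗ[ℂ] E).comp (P.δ t) : P.fiber t →ₗ[ℂ] E)

include h in
theorem fiberExt_coe (t : G) (a : P.fiber t) :
    n.fiberExt π t (n.toComplFib a) = π (P.δ t a) :=
  linExt_coe (V := n.Fib t) ((π : P.Cc →ₗ[ℂ] E).comp (P.δ t) : P.fiber t →ₗ[ℂ] E)
    ⟨1, fun a => by rw [one_mul]; exact n.norm_hom_δ_le π h t a⟩ a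

/-- The extension of a *-homomorphism of `C_c(A)` that is contractive on the unit fiber to the
cross-sectional C*-algebra of the completed bundle. -/
def liftCompl : n.compl.CStar →⋆ₙₐ[ℂ] E :=
  n.compl.lift <| liftHom (fun t => (n.fiberExt π t : n.ComplFib t →ₗ[ℂ] E))
    (fun s t a b => by
      change n.fiberExt π (s * t) (n.mulCompl rfl a b) = n.fiberExt π s a * n.fiberExt π t b
      induction a using n.complFib_induction with
      | hc => exact isClosed_eq (by fun_prop) (by fun_prop)
      | h a =>
      induction b using n.complFib_induction with
      | hc => exact isClosed_eq (by fun_prop) (by fun_prop)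
      | h b =>
        rw [mulCompl_coe, n.fiberExt_coe π h, n.fiberExt_coe π h, n.fiberExt_coe π h, ← map_mul,
          P.δ_mul_δ rfl])
    (fun t a => by
      change n.fiberExt π t⁻¹ (n.starCompl rfl a) = star (n.fiberExt π t a)
      induction a using n.complFib_induction with
      | hc => exact isClosed_eq (by fun_prop) (by fun_prop)
      | h a =>
        rw [starCompl_coe, n.fiberExt_coe π h, n.fiberExt_coe π h, ← map_star, P.star_δ rfl])

theorem liftCompl_δ (t : G) (a : P.fiber t) :
    n.liftCompl π h (n.compl.toCStar (n.compl.δ t (n.toCompl a))) = π (P.δ t a) := by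
  rw [liftCompl, FellBundle.lift_toCStar]
  exact (liftHom_δ (P := n.compl.toStarBundle) _ _ _ t _).trans (n.fiberExt_coe π h t a)

theorem liftCompl_toComplCStar (f : P.Cc) : n.liftCompl π h (n.toComplCStar f) = π f := by
  induction f using P.Cc_induction with
  | h0 => simp
  | hadd f g hf hg => simp only [map_add, hf, hg]
  | hδ t a => rw [toComplCStar_δ, liftCompl_δ]

end CStarNorm

end StarBundle

/-! ### The full cross-sectional C*-algebra of the maximal tensor product -/

section TensorMap

variable {R₁ R₂ S₁ S₂ : Type*}
  [NonUnitalRing R₁] [StarRing R₁] [Module ℂ R₁] [StarModule ℂ R₁]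
  [SMulCommClass ℂ R₁ R₁] [IsScalarTower ℂ R₁ R₁]
  [NonUnitalRing R₂] [StarRing R₂] [Module ℂ R₂] [StarModule ℂ R₂]
  [SMulCommClass ℂ R₂ R₂] [IsScalarTower ℂ R₂ R₂]
  [NonUnitalRing S₁] [StarRing S₁] [Module ℂ S₁] [StarModule ℂ S₁]
  [SMulCommClass ℂ S₁ S₁] [IsScalarTower ℂ S₁ S₁]
  [NonUnitalRing S₂] [StarRing S₂] [Module ℂ S₂] [StarModule ℂ S₂]
  [SMulCommClass ℂ S₂ S₂] [IsScalarTower ℂ S₂ S₂]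

/-- The tensor product of two *-homomorphisms. -/
def tensorMap (φ : R₁ →⋆ₙₐ[ℂ] S₁) (ψ : R₂ →⋆ₙₐ[ℂ] S₂) : R₁ ⊗[ℂ] R₂ →⋆ₙₐ[ℂ] S₁ ⊗[ℂ] S₂ :=
  let L : R₁ ⊗[ℂ] R₂ →ₗ[ℂ] S₁ ⊗[ℂ] S₂ :=
    TensorProduct.map (φ : R₁ →ₗ[ℂ] S₁) (ψ : R₂ →ₗ[ℂ] S₂)
  have hL : ∀ a b, L (a ⊗ₜ b) = φ a ⊗ₜ ψ b := fun a b => rfl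
  { toFun := L
    map_smul' := map_smul L
    map_zero' := map_zero L
    map_add' := map_add L
    map_mul' := fun x y => by
      induction x with
      | zero => simp
      | add x x' h h' => rw [add_mul, map_add, h, h', map_add, add_mul]
      | tmul a b =>
      induction y with
      | zero => simp
      | add y y' h h' => rw [mul_add, map_add, h, h', map_add, mul_add]
      | tmul a' b' =>
        rw [Algebra.TensorProduct.tmul_mul_tmul, hL, hL, hL, map_mul, map_mul,
          Algebra.TensorProduct.tmul_mul_tmul]
    map_star' := fun x => by
      induction x with
      | zero => simp
      | add x x' h h' => rw [star_add, map_add, h, h', map_add, star_add]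
      | tmul a b =>
        rw [TensorProduct.star_tmul, hL, hL, map_star, map_star, TensorProduct.star_tmul] }

theorem tensorMap_tmul (φ : R₁ →⋆ₙₐ[ℂ] S₁) (ψ : R₂ →⋆ₙₐ[ℂ] S₂) (a : R₁) (b : R₂) :
    tensorMap φ ψ (a ⊗ₜ b) = φ a ⊗ₜ ψ b := rfl

end TensorMap

namespace FellBundle

variable {G : Type u₁} [Group G] {H : Type u₂} [Group H]
  (A : FellBundle.{u₁, v₁} G) (B : FellBundle.{u₂, v₂} H)

/-- The *-homomorphism `C_c(A ⊙ B) → C_c(A) ⊙ C_c(B)`, `δ_{a ⊗ b} ↦ δ_a ⊗ δ_b`. -/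
def ccToTensor : (A.tensor B).Cc →⋆ₙₐ[ℂ] A.Cc ⊗[ℂ] B.Cc :=
  StarBundle.liftHom (P := A.tensor B)
    (fun r => (TensorProduct.map (A.δ r.1) (B.δ r.2) :
      A.fiber r.1 ⊗[ℂ] B.fiber r.2 →ₗ[ℂ] A.Cc ⊗[ℂ] B.Cc))
    (fun s t z w => by
      have key : ∀ (z : A.fiber s.1 ⊗[ℂ] B.fiber s.2) (w : A.fiber t.1 ⊗[ℂ] B.fiber t.2),
          TensorProduct.map (A.δ (s.1 * t.1)) (B.δ (s.2 * t.2)) (TensorProduct.map₂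
            (A.mulMap rfl) (B.mulMap rfl) z w) = TensorProduct.map (A.δ s.1) (B.δ s.2) z *
            TensorProduct.map (A.δ t.1) (B.δ t.2) w := by
        intro z w
        induction z with
        | zero => simp
        | add z z' h h' => simp only [map_add, LinearMap.add_apply, add_mul, h, h']
        | tmul a b =>
        induction w with
        | zero => simp
        | add z z' h h' => simp only [map_add, mul_add, h, h']
        | tmul a' b' =>
          change A.δ (s.1 * t.1) (A.mulMap rfl a a') ⊗ₜ B.δ (s.2 * t.2) (B.mulMap rfl b b') =
            (A.δ s.1 a ⊗ₜ B.δ s.2 b) * (A.δ t.1 a' ⊗ₜ B.δ t.2 b')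
          rw [Algebra.TensorProduct.tmul_mul_tmul, A.δ_mul_δ rfl, B.δ_mul_δ rfl]
      exact key z w)
    (fun t z => by
      have key : ∀ z : A.fiber t.1 ⊗[ℂ] B.fiber t.2,
          TensorProduct.map (A.δ t.1⁻¹) (B.δ t.2⁻¹) (TensorProduct.map
            (A.starMap rfl) (B.starMap rfl) z) =
            star (TensorProduct.map (A.δ t.1) (B.δ t.2) z) := by
        intro z
        induction z with
        | zero => simp
        | add z z' h h' => simp only [map_add, star_add, h, h']
        | tmul a b =>
          rw [TensorProduct.map_tmul, TensorProduct.map_tmul, TensorProduct.map_tmul,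
            TensorProduct.star_tmul, A.star_δ rfl, B.star_δ rfl]
      exact key z)

theorem ccToTensor_δ (r : G × H) (z : A.fiber r.1 ⊗[ℂ] B.fiber r.2) :
    A.ccToTensor B ((A.tensor B).δ r z) = TensorProduct.map (A.δ r.1) (B.δ r.2) z :=
  StarBundle.liftHom_δ (P := A.tensor B) _ _ _ r z

/-- The linear map `C_c(A) ⊙ C_c(B) → C_c(A ⊙ B)`, `δ_a ⊗ δ_b ↦ δ_{a ⊗ b}`. -/
def tensorToCc : A.Cc ⊗[ℂ] B.Cc →ₗ[ℂ] (A.tensor B).Cc :=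
  TensorProduct.lift <| A.liftCc fun t => LinearMap.flip <| B.liftCc fun s => LinearMap.flip <|
    (A.toStarBundle.tmul B.toStarBundle).compr₂ ((A.tensor B).δ (t, s))

theorem tensorToCc_δ (t : G) (s : H) (a : A.fiber t) (b : B.fiber s) :
    A.tensorToCc B (A.δ t a ⊗ₜ B.δ s b) =
      (A.tensor B).δ (t, s) (A.toStarBundle.tmul B.toStarBundle a b) := by
  rw [tensorToCc, TensorProduct.lift.tmul, StarBundle.liftCc_δ, LinearMap.flip_apply,
    StarBundle.liftCc_δ]
  rfl

theorem ccTensor_induction {q : A.Cc ⊗[ℂ] B.Cc → Prop} (z : A.Cc ⊗[ℂ] B.Cc) (h0 : q 0)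
    (hδ : ∀ t s a b, q (A.δ t a ⊗ₜ B.δ s b)) (hadd : ∀ z w, q z → q w → q (z + w)) : q z := by
  induction z with
  | zero => exact h0
  | add z w hz hw => exact hadd z w hz hw
  | tmul f g =>
  induction f using A.Cc_induction with
  | h0 => rw [TensorProduct.zero_tmul]; exact h0
  | hadd f f' hf hf' => rw [TensorProduct.add_tmul]; exact hadd _ _ hf hf'
  | hδ t a =>
  induction g using B.Cc_induction with
  | h0 => rw [TensorProduct.tmul_zero]; exact h0
  | hadd f f' hf hf' => rw [TensorProduct.tmul_add]; exact hadd _ _ hf hf'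
  | hδ s b => exact hδ t s a b

theorem ccToTensor_tensorToCc (z : A.Cc ⊗[ℂ] B.Cc) : A.ccToTensor B (A.tensorToCc B z) = z := by
  induction z using A.ccTensor_induction B with
  | h0 => simp
  | hadd z w hz hw => rw [map_add, map_add, hz, hw]
  | hδ t s a b =>
    rw [tensorToCc_δ]
    exact A.ccToTensor_δ B (t, s) (a ⊗ₜ b)

theorem tensorCc_induction {q : (A.tensor B).Cc → Prop} (f : (A.tensor B).Cc) (h0 : q 0)
    (hδ : ∀ t s (a : A.fiber t) (b : B.fiber s),
      q ((A.tensor B).δ (t, s) (A.toStarBundle.tmul B.toStarBundle a b)))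
    (hadd : ∀ f g, q f → q g → q (f + g)) : q f := by
  induction f using (A.tensor B).Cc_induction with
  | h0 => exact h0
  | hadd f g hf hg => exact hadd f g hf hg
  | hδ r z =>
    let L : A.fiber r.1 ⊗[ℂ] B.fiber r.2 →ₗ[ℂ] (A.tensor B).Cc := (A.tensor B).δ r
    have key : ∀ z, q (L z) := by
      intro z
      induction z with
      | zero => rw [map_zero]; exact h0
      | add z w hz hw => rw [map_add]; exact hadd _ _ hz hw
      | tmul a b => exact hδ r.1 r.2 a b
    exact key z

theorem tensorToCc_ccToTensor (f : (A.tensor B).Cc) : A.tensorToCc B (A.ccToTensor B f) = f := by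
  induction f using A.tensorCc_induction B with
  | h0 => simp
  | hadd z w hz hw => rw [map_add, map_add, hz, hw]
  | hδ t s a b =>
    refine Eq.trans ?_ (A.tensorToCc_δ B t s a b)
    exact congrArg (A.tensorToCc B) (A.ccToTensor_δ B (t, s) (a ⊗ₜ b))

/-- The *-isomorphism `C_c(A) ⊙ C_c(B) ≅ C_c(A ⊙ B)`. -/
def tensorToCcHom : A.Cc ⊗[ℂ] B.Cc →⋆ₙₐ[ℂ] (A.tensor B).Cc where
  toFun := A.tensorToCc B
  map_smul' := map_smul (A.tensorToCc B)
  map_zero' := map_zero (A.tensorToCc B)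
  map_add' := map_add (A.tensorToCc B)
  -- Multiplicativity is inherited from the inverse map, which is already a *-homomorphism.
  map_mul' z w := by
    conv_lhs => rw [← A.ccToTensor_tensorToCc B z, ← A.ccToTensor_tensorToCc B w, ← map_mul]
    rw [tensorToCc_ccToTensor]
  map_star' z := by
    conv_lhs => rw [← A.ccToTensor_tensorToCc B z, ← map_star]
    rw [tensorToCc_ccToTensor]

variable {E : Type*} [NonUnitalCStarAlgebra E]

/-- Every *-homomorphism of `C_c(A) ⊙ C_c(B)` into a C*-algebra is bounded by the maximal C*-norm
of `C*(A) ⊙ C*(B)`. -/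
theorem norm_le_maxTensorNorm_toCStar (π : A.Cc ⊗[ℂ] B.Cc →⋆ₙₐ[ℂ] E) (z : A.Cc ⊗[ℂ] B.Cc) :
    ‖π z‖ ≤ maxTensorNorm A.CStar B.CStar (tensorMap A.toCStar B.toCStar z) := by
  let := CStarAlgebra.spectralOrder E
  let := CStarAlgebra.spectralOrderedRing E
  -- Without units, π has no restrictions to C_c(A) and C_c(B). The form π(x)* π(y) gives a module
  -- on which f ⊗ 1 and 1 ⊗ g act by left multiplication, and in which the norm of x is ‖π x‖.
  let F : PosForm (A.Cc ⊗[ℂ] B.Cc) E :=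
    { ip := ((LinearMap.mul ℂ E).compl₂ (π : A.Cc ⊗[ℂ] B.Cc →ₗ[ℂ] E)).comp
        ((starLinearEquiv ℂ (A := E) : E →ₗ⋆[ℂ] E).comp (π : A.Cc ⊗[ℂ] B.Cc →ₗ[ℂ] E))
      star_ip := fun x y => by
        change star (star (π x) * π y) = star (π y) * π x
        rw [star_mul, star_star]
      nonneg := fun x => star_mul_self_nonneg (π x) }
  have hF : ∀ x y, F.ip x y = π (star x * y) := fun x y => by
    rw [map_mul, map_star]
    rfl
  have hn : ∀ x, ‖F.toHilb x‖ = ‖π x‖ := fun x => by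
    rw [F.norm_toHilb, PosForm.nrm, hF, map_mul, map_star, CStarRing.norm_star_mul_self,
      Real.sqrt_mul_self (norm_nonneg _)]
  have h₁ := F.ampLeft_adjoint (NonUnitalAlgHom.lmul ℂ A.Cc) fun a x y x' y' => by
    simp only [hF, NonUnitalAlgHom.coe_lmul_eq_mul, LinearMap.mul_apply', TensorProduct.star_tmul,
      Algebra.TensorProduct.tmul_mul_tmul, star_mul, mul_assoc]
  have h₂ := F.ampRight_adjoint (NonUnitalAlgHom.lmul ℂ B.Cc) fun a x y x' y' => by
    simp only [hF, NonUnitalAlgHom.coe_lmul_eq_mul, LinearMap.mul_apply', TensorProduct.star_tmul,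
      Algebra.TensorProduct.tmul_mul_tmul, star_mul, mul_assoc]
  let r₁ : A.Cc →⋆ₙₐ[ℂ] F.Adj := F.rep _ h₁ (A.exists_bound_rep F _ h₁)
  let r₂ : B.Cc →⋆ₙₐ[ℂ] F.Adj := F.rep _ h₂ (B.exists_bound_rep F _ h₂)
  have e₁ : ∀ f x y, (r₁ f).op (F.toHilb (x ⊗ₜ y)) = F.toHilb ((f * x) ⊗ₜ y) := fun f x y =>
    F.rep_toHilb _ h₁ _ f (x ⊗ₜ y)
  have e₂ : ∀ f x y, (r₂ f).op (F.toHilb (x ⊗ₜ y)) = F.toHilb (x ⊗ₜ (f * y)) := fun f x y =>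
    F.rep_toHilb _ h₂ _ f (x ⊗ₜ y)
  have hcomm : ∀ f g, Commute (r₁ f) (r₂ g) := fun f g =>
    F.commute_of_amp (s := LinearMap.mulLeft ℂ f) (t := LinearMap.mulLeft ℂ g) (e₁ f) (e₂ g)
  have hcomm' : ∀ x y, Commute (A.lift r₁ x) (B.lift r₂ y) := by
    intro x y
    have c₁ := continuous_starHom (A.lift r₁)
    have c₂ := continuous_starHom (B.lift r₂)
    rw [commute_iff_eq]
    induction x using A.univNorm.compl_induction with
    | hc => exact isClosed_eq (by fun_prop) (by fun_prop)
    | h f =>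
    induction y using B.univNorm.compl_induction with
    | hc => exact isClosed_eq (by fun_prop) (by fun_prop)
    | h g =>
      have := (hcomm f g).eq
      rw [← A.lift_toCStar r₁, ← B.lift_toCStar r₂] at this
      exact this
  let T := (tensorHom (A.lift r₁) (B.lift r₂) hcomm').comp (tensorMap A.toCStar B.toCStar)
  have hT : ∀ z w, (T z).op (F.toHilb w) = F.toHilb (z * w) := by
    intro z w
    induction z with
    | zero => rw [map_zero, zero_mul, PosForm.zero_op, map_zero]
    | add z z' h h' => rw [map_add, add_mul, PosForm.add_op, h, h', map_add]
    | tmul f g =>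
    induction w with
    | zero => simp
    | add w w' h h' => rw [mul_add, map_add, map_add, h, h', map_add]
    | tmul x y =>
      have h5 : T (f ⊗ₜ g) = r₁ f * r₂ g := by
        rw [NonUnitalStarAlgHom.comp_apply, tensorMap_tmul, tensorHom_tmul, lift_toCStar,
          lift_toCStar]
      rw [h5, PosForm.mul_op, e₂, e₁, Algebra.TensorProduct.tmul_mul_tmul]
  have h6 : ‖T z‖ ≤ maxTensorNorm A.CStar B.CStar (tensorMap A.toCStar B.toCStar z) :=
    norm_le_maxTensorNorm (tensorHom (A.lift r₁) (B.lift r₂) hcomm') _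
  refine le_trans ?_ h6
  -- Evaluation at z* takes the place of evaluation at a unit: ‖π z‖² = ‖π(z z*)‖ ≤ ‖T z‖ ‖π z‖.
  have h7 := (T z).op.le_opNorm (F.toHilb (star z))
  rw [hT, hn, hn, map_mul, map_star, CStarRing.norm_self_mul_star, norm_star] at h7
  rcases (norm_nonneg (π z)).eq_or_lt with h | h
  · rw [← h]; exact norm_nonneg _
  · exact le_of_mul_le_mul_right h7 h

/-- The inclusion `A_e ⊙ B_e → C_c(A ⊙ B)`. -/
def unitTensorToCc : A.UnitFiber ⊗[ℂ] B.UnitFiber →⋆ₙₐ[ℂ] (A.tensor B).Cc :=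
  (A.tensorToCcHom B).comp (tensorMap A.δUnitHom B.δUnitHom)

theorem unitTensorToCc_apply (z : A.UnitFiber ⊗[ℂ] B.UnitFiber) :
    A.unitTensorToCc B z = (A.tensor B).δ (1, 1) z := by
  let L : A.UnitFiber ⊗[ℂ] B.UnitFiber →ₗ[ℂ] (A.tensor B).Cc := (A.tensor B).δ (1, 1)
  change _ = L z
  induction z with
  | zero => simp
  | add z w hz hw => rw [map_add, map_add, hz, hw]
  | tmul a b => exact A.tensorToCc_δ B 1 1 a b

/-- On the unit fiber π is a *-homomorphism of A_e ⊙ B_e, hence bounded by the maximal norm. This is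
why every π extends to C*(A ⊗_max B), which need not hold with other norms α. -/
theorem norm_δ_one_le (π : (A.tensor B).Cc →⋆ₙₐ[ℂ] E) (x : (A.tensor B).fiber 1) :
    ‖π ((A.tensor B).δ 1 x)‖ ≤ (A.maxNorm B).nrm 1 x := by
  refine le_of_eq_of_le ?_ ((norm_le_maxTensorNorm (π.comp (A.unitTensorToCc B)) x).trans_eq
    (A.maxNorm_one B x).symm)
  exact congrArg (fun f => ‖π f‖) (A.unitTensorToCc_apply B x).symm

/-- The universal property of `C*(A ⊗_max B)`. -/
def liftMax (π : (A.tensor B).Cc →⋆ₙₐ[ℂ] E) : (A.maxNorm B).compl.CStar →⋆ₙₐ[ℂ] E :=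
  (A.maxNorm B).liftCompl π (A.norm_δ_one_le B π)

theorem liftMax_δ (π : (A.tensor B).Cc →⋆ₙₐ[ℂ] E) (r : G × H) (x : (A.tensor B).fiber r) :
    A.liftMax B π ((A.maxNorm B).compl.toCStar ((A.maxNorm B).compl.δ r ((A.maxNorm B).toCompl x)))
      = π ((A.tensor B).δ r x) :=
  (A.maxNorm B).liftCompl_δ π _ r x

theorem liftMax_toComplCStar (π : (A.tensor B).Cc →⋆ₙₐ[ℂ] E) (f : (A.tensor B).Cc) :
    A.liftMax B π ((A.maxNorm B).toComplCStar f) = π f :=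
  (A.maxNorm B).liftCompl_toComplCStar π _ f

/-- The *-homomorphism `C_c(A ⊙ B) → C*(A) ⊗_max C*(B)`, `δ_{a ⊗ b} ↦ δ_a ⊗ δ_b`. -/
def ccToMaxTensor : (A.tensor B).Cc →⋆ₙₐ[ℂ] MaxTensor A.CStar B.CStar :=
  ((maxTensorNorm A.CStar B.CStar).of.comp (tensorMap A.toCStar B.toCStar)).comp (A.ccToTensor B)

/-- The *-homomorphism `C*(A ⊗_max B) → C*(A) ⊗_max C*(B)`. -/
def maxHom : (A.maxNorm B).compl.CStar →⋆ₙₐ[ℂ] MaxTensor A.CStar B.CStar :=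
  A.liftMax B (A.ccToMaxTensor B)

theorem maxHom_δ (t : G) (s : H) (a : A.fiber t) (b : B.fiber s) :
    A.maxHom B ((A.maxNorm B).compl.toCStar
      ((A.maxNorm B).compl.δ (t, s) ((A.maxNorm B).tmul a b))) =
      (maxTensorNorm A.CStar B.CStar).of
        (A.toCStar (A.δ t a) ⊗ₜ[ℂ] B.toCStar (B.δ s b)) := by
  refine (A.liftMax_δ B (A.ccToMaxTensor B) (t, s) _).trans ?_
  exact congrArg (fun z => (maxTensorNorm A.CStar B.CStar).of
    (tensorMap A.toCStar B.toCStar z)) (A.ccToTensor_δ B (t, s) (a ⊗ₜ b))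

/-- One inequality is contractivity. The other is `norm_le_maxTensorNorm_toCStar` for the canonical
map of C_c(A) ⊙ C_c(B) ≅ C_c(A ⊙ B) into C*(A ⊗_max B), checked on a dense subspace. -/
theorem norm_maxHom (x : (A.maxNorm B).compl.CStar) : ‖A.maxHom B x‖ = ‖x‖ := by
  have hc := continuous_starHom (A.maxHom B)
  refine le_antisymm (NonUnitalStarAlgHom.norm_apply_le (A.maxHom B) x) ?_
  refine (A.maxNorm B).denseRange_toComplCStar.induction_on (p := fun x => ‖x‖ ≤ ‖A.maxHom B x‖) x
    (isClosed_le (by fun_prop) (by fun_prop)) fun f => ?_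
  rw [maxHom, liftMax_toComplCStar]
  have h := A.norm_le_maxTensorNorm_toCStar B
    ((A.maxNorm B).toComplCStar.comp (A.tensorToCcHom B)) (A.ccToTensor B f)
  rw [NonUnitalStarAlgHom.comp_apply] at h
  have h2 : A.tensorToCcHom B (A.ccToTensor B f) = f := A.tensorToCc_ccToTensor B f
  rw [h2] at h
  exact h.trans_eq (CStarSeminorm.norm_of _ _).symm

theorem continuous_of_tmul {C D : Type*} [NonUnitalCStarAlgebra C] [NonUnitalCStarAlgebra D] :
    Continuous fun x : C × D => (maxTensorNorm C D).of (x.1 ⊗ₜ[ℂ] x.2) := by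
  let L : C →ₗ[ℂ] D →ₗ[ℂ] MaxTensor C D :=
    (TensorProduct.mk ℂ C D).compr₂ (maxTensorNorm C D).toCompl
  have hL : ∀ x y, ‖L x y‖ ≤ 1 * ‖x‖ * ‖y‖ := fun x y => by
    rw [one_mul]
    exact ((maxTensorNorm C D).norm_of _).trans_le ((maxTensorNorm C D).tmul_le x y)
  exact (L.mkContinuous₂ 1 hL).continuous₂

theorem maxTensor_induction {q : MaxTensor A.CStar B.CStar → Prop} (hq : IsClosed {x | q x})
    (h : ∀ f g, q ((maxTensorNorm A.CStar B.CStar).of (A.toCStar f ⊗ₜ B.toCStar g)))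
    (hadd : ∀ x y, q x → q y → q (x + y)) (x : MaxTensor A.CStar B.CStar) : q x := by
  induction x using (maxTensorNorm A.CStar B.CStar).compl_induction with
  | hc => exact hq
  | h z =>
  change q ((maxTensorNorm A.CStar B.CStar).of z)
  have key : ∀ x y, q ((maxTensorNorm A.CStar B.CStar).of (x ⊗ₜ y)) := by
    intro x y
    have hc := hq.preimage (continuous_of_tmul (C := A.CStar) (D := B.CStar))
    have hd : DenseRange (Prod.map A.toCStar B.toCStar) :=
      A.univNorm.denseRange_of.prodMap B.univNorm.denseRange_of
    exact hd.induction_on (p := fun z : A.CStar × B.CStar =>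
      q ((maxTensorNorm A.CStar B.CStar).of (z.1 ⊗ₜ z.2))) (x, y) hc fun z => h z.1 z.2
  induction z with
  | zero => simpa using key 0 0
  | add z w hz hw => rw [map_add]; exact hadd _ _ hz hw
  | tmul x y => exact key x y

/-- The range is closed and stable under sums, so it is enough to reach the tensors f ⊗ g with f in
C_c(A) and g in C_c(B). -/
theorem maxHom_surjective : Function.Surjective (A.maxHom B) := by
  refine A.maxTensor_induction B (q := fun x => ∃ y, A.maxHom B y = x)
    (isClosed_range_starHom (A.maxHom B)) (fun f g => ?_) ?_
  · refine ⟨(A.maxNorm B).toComplCStar (A.tensorToCc B (f ⊗ₜ g)), ?_⟩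
    rw [maxHom, liftMax_toComplCStar, ccToMaxTensor, NonUnitalStarAlgHom.comp_apply,
      ccToTensor_tensorToCc]
    rfl
  · rintro _ _ ⟨x, rfl⟩ ⟨y, rfl⟩
    exact ⟨x + y, map_add _ _ _⟩

/-- The *-isomorphism `C*(A ⊗_max B) ≅ C*(A) ⊗_max C*(B)`. -/
def maxEquiv : (A.maxNorm B).compl.CStar ≃⋆ₐ[ℂ] MaxTensor A.CStar B.CStar :=
  StarAlgEquiv.ofBijective (A.maxHom B)
    ⟨(AddMonoidHomClass.isometry_of_norm (A.maxHom B) (A.norm_maxHom B)).injective,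
      A.maxHom_surjective B⟩

end FellBundle

/-! ### Reduced C*-algebras as images of full C*-algebras -/

/-- The range is a closed *-subalgebra. The reduced algebras are defined by generators, and this
makes the regular representations surjective onto them. -/
theorem adjoin_topologicalClosure_le_range {R E : Type*} [NonUnitalCStarAlgebra R]
    [NonUnitalCStarAlgebra E] (φ : R →⋆ₙₐ[ℂ] E) {s : Set E} (hs : s ⊆ Set.range φ) :
    (NonUnitalStarAlgebra.adjoin ℂ s).topologicalClosure ≤ NonUnitalStarAlgHom.range φ :=
  NonUnitalStarSubalgebra.topologicalClosure_minimal _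
    (NonUnitalStarAlgebra.adjoin_le fun _ hx => hs hx) (isClosed_range_starHom φ)

namespace FellBundle

variable {G : Type u} [Group G] (A : FellBundle.{u, v} G)

/-- The left regular representation of `C*(A)` on `ℓ²(A)`. -/
def fullRegRep : A.CStar →⋆ₙₐ[ℂ] A.AdjL2 := A.lift A.regRep

theorem fullRegRep_toCStar (f : A.Cc) : A.fullRegRep (A.toCStar f) = A.regRep f :=
  A.lift_toCStar A.regRep f

theorem fullRegRep_mem (x : A.CStar) : A.fullRegRep x ∈ A.CStarRed := by
  induction x using A.univNorm.compl_induction with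
  | hc => exact isClosed_closure.preimage (continuous_starHom A.fullRegRep)
  | h f =>
  change A.fullRegRep (A.toCStar f) ∈ A.CStarRed
  rw [fullRegRep_toCStar]
  induction f using A.Cc_induction with
  | h0 => rw [map_zero]; exact zero_mem _
  | hadd f g hf hg => rw [map_add]; exact add_mem hf hg
  | hδ t a => exact subset_closure (NonUnitalStarAlgebra.subset_adjoin ℂ _ ⟨t, a, rfl⟩)

/-- The left regular representation `C*(A) → C*_r(A)`. -/
def redHom : A.CStar →⋆ₙₐ[ℂ] A.CStarRed :=
  NonUnitalStarAlgHom.codRestrict A.fullRegRep A.CStarRed A.fullRegRep_mem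

theorem redHom_toCStar (f : A.Cc) : (A.redHom (A.toCStar f) : A.AdjL2) = A.regRep f :=
  A.fullRegRep_toCStar f

theorem redHom_surjective : Function.Surjective A.redHom := by
  rintro ⟨T, hT⟩
  have h : A.CStarRed ≤ NonUnitalStarAlgHom.range A.fullRegRep := by
    refine adjoin_topologicalClosure_le_range A.fullRegRep ?_
    rintro _ ⟨t, b, rfl⟩
    exact ⟨_, A.fullRegRep_toCStar _⟩
  obtain ⟨x, hx⟩ := h hT
  exact ⟨x, Subtype.ext hx⟩

end FellBundle

/-! ### Equivalences of Hilbert modules -/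

namespace PosForm

section Transport

variable {V V' V₀ D : Type*} [AddCommGroup V] [Module ℂ V] [AddCommGroup V'] [Module ℂ V']
  [AddCommGroup V₀] [Module ℂ V₀] [NonUnitalCStarAlgebra D] [PartialOrder D] [StarOrderedRing D]
  {F : PosForm V D} {F' : PosForm V' D} {f : V₀ →ₗ[ℂ] F.Hilb} {g : V₀ →ₗ[ℂ] F'.Hilb}

theorem norm_le_of_inner_eq (h : ∀ x y, F.inner (f x) (f y) = F'.inner (g x) (g y)) (x : V₀) :
    ‖g x‖ ≤ 1 * ‖f x‖ := by
  rw [one_mul]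
  refine le_of_sq_le_sq ?_ (norm_nonneg _)
  rw [← norm_inner_self, ← norm_inner_self, h]

variable (hf : DenseRange f) (hg : DenseRange g)
  (h : ∀ x y, F.inner (f x) (f y) = F'.inner (g x) (g y))

include hf h in
theorem extendOfNorm_apply (x : V₀) : g.extendOfNorm f (f x) = g x :=
  LinearMap.extendOfNorm_eq hf ⟨1, norm_le_of_inner_eq h⟩ x

include hf h in
theorem inner_extendOfNorm (x y : F.Hilb) :
    F'.inner (g.extendOfNorm f x) (g.extendOfNorm f y) = F.inner x y := by
  refine hf.induction_on (p := fun x => F'.inner (g.extendOfNorm f x) (g.extendOfNorm f y) =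
    F.inner x y) x (isClosed_eq (by fun_prop) (by fun_prop)) fun x => ?_
  refine hf.induction_on (p := fun y => F'.inner (g.extendOfNorm f (f x)) (g.extendOfNorm f y) =
    F.inner (f x) y) y (isClosed_eq (by fun_prop) (by fun_prop)) fun y => ?_
  rw [extendOfNorm_apply hf h, extendOfNorm_apply hf h, h]

include hf hg h in
theorem extendOfNorm_extendOfNorm (x : F.Hilb) :
    f.extendOfNorm g (g.extendOfNorm f x) = x := by
  refine hf.induction_on (p := fun x => f.extendOfNorm g (g.extendOfNorm f x) = x) x
    (isClosed_eq (by fun_prop) (by fun_prop)) fun x => ?_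
  rw [extendOfNorm_apply hf h, extendOfNorm_apply hg fun x y => (h x y).symm]

include hf hg h in
-- The extension preserves inner products and has the extension in the opposite direction as
-- inverse, so that inverse is its adjoint.
theorem inner_extendOfNorm_left (x : F.Hilb) (y : F'.Hilb) :
    F'.inner (g.extendOfNorm f x) y = F.inner x (f.extendOfNorm g y) := by
  conv_lhs => rw [← extendOfNorm_extendOfNorm hg hf (fun x y => (h x y).symm) y]
  exact inner_extendOfNorm hf h _ _

/-- The conjugation of adjointable operators by the unitary that extends `f x ↦ g x`. -/
def conjAdj (T : F.Adj) : F'.Adj :=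
  (⟨(g.extendOfNorm f).comp (T.op.comp (f.extendOfNorm g)),
    (g.extendOfNorm f).comp ((star T).op.comp (f.extendOfNorm g)), fun x y => by
      have h' := fun x y => (h x y).symm
      change F'.inner (g.extendOfNorm f (T.op (f.extendOfNorm g x))) y =
        F'.inner x (g.extendOfNorm f ((star T).op (f.extendOfNorm g y)))
      rw [inner_extendOfNorm_left hf hg h, inner_apply_left,
        inner_extendOfNorm_left hg hf h']⟩ : F'.adjSubalgebra)

theorem conjAdj_op (T : F.Adj) (x : F'.Hilb) :
    (conjAdj hf hg h T).op x = g.extendOfNorm f (T.op (f.extendOfNorm g x)) := rfl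

theorem conjAdj_op_apply (T : F.Adj) (x : V₀) :
    (conjAdj hf hg h T).op (g x) = g.extendOfNorm f (T.op (f x)) := by
  rw [conjAdj_op, extendOfNorm_apply hg fun x y => (h x y).symm]

/-- The isomorphism of the algebras of adjointable operators given by the unitary that extends
`f x ↦ g x`. -/
def adjEquiv : F.Adj ≃⋆ₐ[ℂ] F'.Adj where
  toFun := conjAdj hf hg h
  invFun := conjAdj hg hf fun x y => (h x y).symm
  left_inv T := Adj.ext fun x => by
    rw [conjAdj_op, conjAdj_op, extendOfNorm_extendOfNorm hf hg h,
      extendOfNorm_extendOfNorm hf hg h]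
  right_inv T := Adj.ext fun x => by
    have h' := fun x y => (h x y).symm
    rw [conjAdj_op, conjAdj_op, extendOfNorm_extendOfNorm hg hf h',
      extendOfNorm_extendOfNorm hg hf h']
  map_mul' S T := Adj.ext fun x => by
    rw [mul_op, conjAdj_op, conjAdj_op, conjAdj_op, extendOfNorm_extendOfNorm hf hg h, mul_op]
  map_add' S T := Adj.ext fun x => by
    rw [add_op, conjAdj_op, conjAdj_op, conjAdj_op, add_op, map_add]
  map_star' T := (F'.star_eq_of_adjoint fun x y => by
    have h' := fun x y => (h x y).symm
    rw [conjAdj_op, conjAdj_op, inner_extendOfNorm_left hf hg h, inner_apply_left,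
      inner_extendOfNorm_left hg hf h']).symm
  map_smul' c T := Adj.ext fun x => by
    rw [smul_op, conjAdj_op, conjAdj_op, smul_op, map_smul]

theorem adjEquiv_op_apply (T : F.Adj) (x : V₀) :
    (adjEquiv hf hg h T).op (g x) = g.extendOfNorm f (T.op (f x)) := conjAdj_op_apply hf hg h T x

end Transport

variable {V D : Type*} [AddCommGroup V] [Module ℂ V] [NonUnitalCStarAlgebra D]
    [PartialOrder D] [StarOrderedRing D] (F : PosForm V D)

/-- The adjointable operators, as linear maps. -/
def opHom : F.Adj →ₙₐ[ℂ] Module.End ℂ F.Hilb where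
  toFun T := T.op
  map_smul' _ _ := rfl
  map_zero' := rfl
  map_add' _ _ := rfl
  map_mul' _ _ := rfl

theorem Adj.ext_denseRange {F : PosForm V D} {X : Type*} {g : X → F.Hilb} (hg : DenseRange g)
    {S T : F.Adj} (h : ∀ v, S.op (g v) = T.op (g v)) : S = T :=
  Adj.ext fun x => hg.induction_on (p := fun x => S.op x = T.op x) x
    (isClosed_eq (by fun_prop) (by fun_prop)) h

end PosForm

/-! ### The Hilbert module of a tensor product of Fell bundles -/

namespace FellBundle

variable {G : Type u} [Group G] (A : FellBundle.{u, v} G)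

theorem ip_δ_same {t : G} (a b : A.fiber t) :
    A.l2Form.ip (A.δ t a) (A.δ t b) = A.starMulUnit a b := by
  rw [l2Form_ip, A.star_δ rfl, A.δ_mul_δ (inv_mul_cancel t)]
  exact A.ev_δ_same 1 _

theorem ip_δ_ne {s t : G} (h : s ≠ t) (a : A.fiber s) (b : A.fiber t) :
    A.l2Form.ip (A.δ s a) (A.δ t b) = 0 := by
  rw [l2Form_ip, A.star_δ rfl, A.δ_mul_δ rfl]
  exact A.ev_δ_ne (fun h' => h (inv_mul_eq_one.mp h')) _

theorem inner_toL2 (f g : A.Cc) : A.l2Form.inner (A.toL2 f) (A.toL2 g) = A.l2Form.ip f g :=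
  A.l2Form.inner_coe f g

theorem regRep_op_toL2 (f g : A.Cc) : (A.regRep f).op (A.toL2 g) = A.toL2 (f * g) :=
  A.leftConv_toL2 f g

end FellBundle

namespace StarBundle.CStarNorm

theorem norm_toL2_δ_le {G : Type u} [Group G] {P : StarBundle.{u, v} G} (n : P.CStarNorm) (t : G)
    (x : n.ComplFib t) : ‖n.compl.toL2 (n.compl.δ t x)‖ ≤ ‖x‖ := by
  refine le_of_sq_le_sq ?_ (norm_nonneg _)
  rw [FellBundle.toL2, PosForm.norm_toHilb, PosForm.sq_nrm]
  exact (congrArg norm (n.compl.ip_δ_same (t := t) x x)).trans_le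
    (n.compl.cstarNorm.starMul_self t x).le

variable {G : Type u₁} [Group G] {H : Type u₂} [Group H]
  {A : FellBundle.{u₁, v₁} G} {B : FellBundle.{u₂, v₂} H} (α : (A.tensor B).CStarNorm)

theorem inner_toTensorL2 (z w : A.L2 ⊗[ℂ] B.L2) :
    α.tensorForm.inner (α.toTensorL2 z) (α.toTensorL2 w) = α.tensorIp z w :=
  α.tensorForm.inner_coe z w

/-- The map `C_c(A) ⊙ C_c(B) → ℓ²(A) ⊗_α ℓ²(B)`. -/
def ccTensorL2 : A.Cc ⊗[ℂ] B.Cc →ₗ[ℂ] α.TensorL2 :=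
  α.toTensorL2.comp (TensorProduct.map A.toL2 B.toL2)

/-- The map `C_c(A) ⊙ C_c(B) → C_c(A ⊗_α B)`. -/
def ccTensorCompl : A.Cc ⊗[ℂ] B.Cc →⋆ₙₐ[ℂ] α.tensorBundle.Cc :=
  α.toComplCc.comp (A.tensorToCcHom B)

/-- The map `C_c(A) ⊙ C_c(B) → ℓ²(A ⊗_α B)`. -/
def ccTensorComplL2 : A.Cc ⊗[ℂ] B.Cc →ₗ[ℂ] α.tensorBundle.L2 :=
  α.tensorBundle.toL2.comp (α.ccTensorCompl : A.Cc ⊗[ℂ] B.Cc →ₗ[ℂ] α.tensorBundle.Cc)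

theorem ccTensorL2_tmul (f : A.Cc) (g : B.Cc) :
    α.ccTensorL2 (f ⊗ₜ g) = α.toTensorL2 (A.toL2 f ⊗ₜ B.toL2 g) := rfl

theorem ccTensorComplL2_apply (z : A.Cc ⊗[ℂ] B.Cc) :
    α.ccTensorComplL2 z = α.tensorBundle.toL2 (α.ccTensorCompl z) := rfl

theorem ccTensorCompl_δ (t : G) (s : H) (a : A.fiber t) (b : B.fiber s) :
    α.ccTensorCompl (A.δ t a ⊗ₜ B.δ s b) = α.tensorBundle.δ (t, s) (α.tmul a b) :=
  (congrArg α.toComplCc (A.tensorToCc_δ B t s a b)).trans (α.toComplCc_δ (t, s) _)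

/-- On sections δ_a ⊗ δ_b both sides vanish unless the group elements agree, and otherwise both are
(a* a') ⊗ (b* b'). Only the algebraic operations matter, so this works for every α. -/
theorem inner_ccTensorL2 (z w : A.Cc ⊗[ℂ] B.Cc) :
    α.tensorForm.inner (α.ccTensorL2 z) (α.ccTensorL2 w) =
      α.tensorBundle.l2Form.inner (α.ccTensorComplL2 z) (α.ccTensorComplL2 w) := by
  induction z using A.ccTensor_induction B with
  | h0 => simp
  | hadd z z' h h' => simp only [map_add, add_apply, h, h']
  | hδ t s a b =>
  induction w using A.ccTensor_induction B with
  | h0 => simp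
  | hadd z z' h h' => simp only [map_add, h, h']
  | hδ t' s' a' b' =>
    rw [ccTensorL2_tmul, ccTensorL2_tmul, inner_toTensorL2, tensorIp_tmul, A.inner_toL2,
      B.inner_toL2, ccTensorComplL2_apply, ccTensorComplL2_apply, FellBundle.inner_toL2,
      ccTensorCompl_δ, ccTensorCompl_δ]
    by_cases ht : t = t'
    · subst ht
      by_cases hs : s = s'
      · subst hs
        rw [A.ip_δ_same, B.ip_δ_same, FellBundle.ip_δ_same, tmulUnit_starMul]
      · rw [B.ip_δ_ne hs, map_zero, FellBundle.ip_δ_ne]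
        exact fun h => hs (congrArg Prod.snd h)
    · rw [A.ip_δ_ne ht, map_zero, LinearMap.zero_apply, FellBundle.ip_δ_ne]
      exact fun h => ht (congrArg Prod.fst h)

theorem denseRange_ccTensorComplL2 : DenseRange α.ccTensorComplL2 := by
  intro x
  let S : AddSubgroup α.tensorBundle.L2 :=
    (AddMonoidHom.range
      (α.ccTensorComplL2 : A.Cc ⊗[ℂ] B.Cc →+ α.tensorBundle.L2)).topologicalClosure
  have hS : IsClosed (S : Set α.tensorBundle.L2) := AddSubgroup.isClosed_topologicalClosure _
  induction x using α.tensorBundle.l2Form.hilb_induction with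
  | hc => exact hS
  | h f =>
    refine α.mem_of_isClosed α.tensorBundle.toL2 α.norm_toL2_δ_le S hS (fun r z => ?_) f
    refine subset_closure ⟨A.ccToTensor B ((A.tensor B).δ r z), ?_⟩
    exact congrArg α.tensorBundle.toL2 ((congrArg α.toComplCc
      (A.tensorToCc_ccToTensor B _)).trans (α.toComplCc_δ r z))

theorem continuous_toTensorL2 :
    Continuous fun x : A.L2 × B.L2 => α.toTensorL2 (x.1 ⊗ₜ[ℂ] x.2) := by
  obtain ⟨C, hC⟩ := α.exists_bound_tmulUnit
  let L : A.L2 →ₗ[ℂ] B.L2 →ₗ[ℂ] α.TensorL2 := (TensorProduct.mk ℂ A.L2 B.L2).compr₂ α.toTensorL2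
  -- ‖x ⊗ y‖² = ‖⟨x, x⟩ ⊗ ⟨y, y⟩‖ ≤ C ‖x‖² ‖y‖². The absolute value is needed because C comes
  -- without a sign.
  have hL : ∀ x y, ‖L x y‖ ≤ √|C| * ‖x‖ * ‖y‖ := fun x y => by
    refine le_of_sq_le_sq ?_ (by positivity)
    rw [← PosForm.norm_inner_self]
    change ‖α.tensorForm.inner (α.toTensorL2 (x ⊗ₜ y)) (α.toTensorL2 (x ⊗ₜ y))‖ ≤ _
    rw [inner_toTensorL2, tensorIp_tmul, mul_pow, mul_pow, Real.sq_sqrt (abs_nonneg C),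
      ← PosForm.norm_inner_self, ← PosForm.norm_inner_self]
    refine (hC _ _).trans ?_
    gcongr
    exact le_abs_self C
  exact (L.mkContinuous₂ _ hL).continuous₂

theorem denseRange_ccTensorL2 : DenseRange α.ccTensorL2 := by
  intro x
  let S : AddSubgroup α.TensorL2 :=
    (AddMonoidHom.range (α.ccTensorL2 : A.Cc ⊗[ℂ] B.Cc →+ α.TensorL2)).topologicalClosure
  have hS : IsClosed (S : Set α.TensorL2) := AddSubgroup.isClosed_topologicalClosure _
  change x ∈ S
  induction x using α.tensorForm.hilb_induction with
  | hc => exact hS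
  | h z =>
  change α.toTensorL2 z ∈ S
  induction z with
  | zero => rw [map_zero]; exact S.zero_mem
  | add z w hz hw => rw [map_add]; exact S.add_mem hz hw
  | tmul x y =>
    have hd : DenseRange (Prod.map A.toL2 B.toL2) :=
      A.l2Form.denseRange_toHilb.prodMap B.l2Form.denseRange_toHilb
    exact hd.induction_on (p := fun z : A.L2 × B.L2 => α.toTensorL2 (z.1 ⊗ₜ z.2) ∈ S) (x, y)
      (hS.preimage α.continuous_toTensorL2) fun z => subset_closure ⟨z.1 ⊗ₜ z.2, rfl⟩

/-- The isomorphism `𝓛(ℓ²(A) ⊗_α ℓ²(B)) ≅ 𝓛(ℓ²(A ⊗_α B))`. -/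
def tensorAdjEquiv : α.tensorForm.Adj ≃⋆ₐ[ℂ] α.tensorBundle.AdjL2 :=
  PosForm.adjEquiv α.denseRange_ccTensorL2 α.denseRange_ccTensorComplL2 α.inner_ccTensorL2

theorem tensorAdjEquiv_op {T : α.tensorForm.Adj} {z w : A.Cc ⊗[ℂ] B.Cc}
    (h : T.op (α.ccTensorL2 z) = α.ccTensorL2 w) :
    (α.tensorAdjEquiv T).op (α.ccTensorComplL2 z) = α.ccTensorComplL2 w := by
  rw [tensorAdjEquiv, PosForm.adjEquiv_op_apply, h,
    PosForm.extendOfNorm_apply α.denseRange_ccTensorL2 α.inner_ccTensorL2]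

/-! ### The tensor product of the left regular representations -/

/-- The representation `x ⊗ y ↦ Λ(x) ⊗ Λ(y)` of `C*(A) ⊙ C*(B)`. -/
def algTensorRegRep : A.CStar ⊗[ℂ] B.CStar →⋆ₙₐ[ℂ] α.tensorForm.Adj :=
  α.tensorForm.tensorRep
    (A.l2Form.opHom.comp (A.fullRegRep : A.CStar →ₙₐ[ℂ] A.AdjL2))
    (B.l2Form.opHom.comp (B.fullRegRep : B.CStar →ₙₐ[ℂ] B.AdjL2))
    (fun a x y x' y' => by
      change α.tensorIp ((A.fullRegRep a).op x ⊗ₜ y) (x' ⊗ₜ y') =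
        α.tensorIp (x ⊗ₜ y) ((A.fullRegRep (star a)).op x' ⊗ₜ y')
      rw [tensorIp_tmul, tensorIp_tmul, PosForm.inner_apply_left, map_star])
    (fun a x y x' y' => by
      change α.tensorIp (x ⊗ₜ (B.fullRegRep a).op y) (x' ⊗ₜ y') =
        α.tensorIp (x ⊗ₜ y) (x' ⊗ₜ (B.fullRegRep (star a)).op y')
      rw [tensorIp_tmul, tensorIp_tmul, PosForm.inner_apply_left, map_star])

/-- The representation `x ⊗ y ↦ Λ(x) ⊗ Λ(y)` of `C*(A) ⊗_max C*(B)`. -/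
def tensorRegRep : MaxTensor A.CStar B.CStar →⋆ₙₐ[ℂ] α.tensorForm.Adj :=
  (maxTensorNorm A.CStar B.CStar).lift α.algTensorRegRep (norm_le_maxTensorNorm α.algTensorRegRep)

theorem isTensor_tensorRegRep (x : A.CStar) (y : B.CStar) :
    α.IsTensor (A.fullRegRep x) (B.fullRegRep y)
      (α.tensorRegRep ((maxTensorNorm A.CStar B.CStar).of (x ⊗ₜ[ℂ] y))) := by
  intro ξ η
  rw [tensorRegRep, CStarSeminorm.lift_of]
  exact α.tensorForm.tensorRep_tmul _ _ _ _ x y ξ η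

/-- Elementary tensors span a dense subspace. Uniqueness is needed because `redTensor` is generated
by all R in the relation `IsTensor`, which then have to be recognized as values of `tensorRegRep`.
-/
theorem IsTensor.unique {T : A.AdjL2} {S : B.AdjL2} {R R' : α.tensorForm.Adj}
    (h : α.IsTensor T S R) (h' : α.IsTensor T S R') : R = R' :=
  PosForm.Adj.ext_toHilb fun z => by
    induction z with
    | zero => simp
    | add z w hz hw => rw [map_add, map_add, map_add, hz, hw]
    | tmul x y => exact (h x y).trans (h' x y).symm

/-- Each generator T ⊗ S is the image of some x ⊗ y, since both regular representations are
surjective onto the reduced algebras. -/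
theorem redTensor_le_range : α.redTensor ≤ NonUnitalStarAlgHom.range α.tensorRegRep := by
  refine adjoin_topologicalClosure_le_range α.tensorRegRep ?_
  rintro R ⟨T, hT, S, hS, h⟩
  obtain ⟨x, hx⟩ := A.redHom_surjective ⟨T, hT⟩
  obtain ⟨y, hy⟩ := B.redHom_surjective ⟨S, hS⟩
  obtain rfl : A.fullRegRep x = T := congrArg Subtype.val hx
  obtain rfl : B.fullRegRep y = S := congrArg Subtype.val hy
  exact ⟨_, (α.isTensor_tensorRegRep x y).unique α h⟩

theorem tensorRegRep_mem (x : MaxTensor A.CStar B.CStar) : α.tensorRegRep x ∈ α.redTensor := by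
  induction x using (maxTensorNorm A.CStar B.CStar).compl_induction with
  | hc => exact isClosed_closure.preimage (continuous_starHom α.tensorRegRep)
  | h z =>
  change α.tensorRegRep ((maxTensorNorm A.CStar B.CStar).of z) ∈ α.redTensor
  induction z with
  | zero => rw [map_zero, map_zero]; exact zero_mem _
  | add z w hz hw => rw [map_add, map_add]; exact add_mem hz hw
  | tmul x y =>
    exact subset_closure (NonUnitalStarAlgebra.subset_adjoin ℂ _
      ⟨_, A.fullRegRep_mem x, _, B.fullRegRep_mem y, α.isTensor_tensorRegRep x y⟩)

/-- The *-homomorphism `C*(A) ⊗_max C*(B) → C*_r(A) ⊗_α̂ C*_r(B)`. -/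
def tensorRedHom : MaxTensor A.CStar B.CStar →⋆ₙₐ[ℂ] α.redTensor :=
  NonUnitalStarAlgHom.codRestrict α.tensorRegRep α.redTensor α.tensorRegRep_mem

theorem tensorRedHom_surjective : Function.Surjective α.tensorRedHom := by
  rintro ⟨T, hT⟩
  obtain ⟨x, hx⟩ := α.redTensor_le_range hT
  exact ⟨x, Subtype.ext hx⟩

/-- For z = f ⊗ g, both operators send the vector of w to the vector of z w: the unitary turns Λ(f)
⊗ Λ(g) into left convolution. This is the commutativity of the diagram before completion. -/
theorem tensorAdjEquiv_tensorRegRep (z : A.Cc ⊗[ℂ] B.Cc) :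
    α.tensorAdjEquiv (α.tensorRegRep ((maxTensorNorm A.CStar B.CStar).of
      (tensorMap A.toCStar B.toCStar z))) = α.tensorBundle.regRep (α.ccTensorCompl z) := by
  induction z with
  | zero => simp
  | add z w hz hw => simp only [map_add, hz, hw]
  | tmul f g =>
  refine PosForm.Adj.ext_denseRange α.denseRange_ccTensorComplL2 fun w => ?_
  rw [ccTensorComplL2_apply, FellBundle.regRep_op_toL2, ← map_mul, ← ccTensorComplL2_apply,
    ← ccTensorComplL2_apply]
  refine α.tensorAdjEquiv_op ?_
  induction w with
  | zero => simp
  | add w w' h h' => rw [mul_add, map_add, map_add, map_add, h, h']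
  | tmul x y =>
    rw [tensorMap_tmul, ccTensorL2_tmul, α.isTensor_tensorRegRep, A.fullRegRep_toCStar,
      B.fullRegRep_toCStar, A.regRep_op_toL2, B.regRep_op_toL2,
      Algebra.TensorProduct.tmul_mul_tmul, ccTensorL2_tmul]

/-- The *-homomorphism `C*(A ⊗_max B) → C*(A ⊗_α B)`. -/
def fromMax : (A.maxNorm B).compl.CStar →⋆ₙₐ[ℂ] α.tensorBundle.CStar :=
  A.liftMax B α.toComplCStar

theorem fromMax_δ (r : G × H) (x : (A.tensor B).fiber r) :
    α.fromMax ((A.maxNorm B).compl.toCStar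
      ((A.maxNorm B).compl.δ r ((A.maxNorm B).toCompl x))) =
      α.tensorBundle.toCStar (α.tensorBundle.δ r (α.toCompl x)) :=
  (A.liftMax_δ B α.toComplCStar r x).trans (α.toComplCStar_δ r x)

theorem fromMax_surjective : Function.Surjective α.fromMax := fun x =>
  α.denseRange_toComplCStar.induction_on (p := fun x => ∃ y, α.fromMax y = x) x
    (isClosed_range_starHom α.fromMax) fun f => ⟨_, A.liftMax_toComplCStar B α.toComplCStar f⟩

/-- Both sides are continuous in x, and on the dense image of C_c(A ⊙ B) they agree by
`tensorAdjEquiv_tensorRegRep`. -/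
theorem tensorAdjEquiv_comp (x : (A.maxNorm B).compl.CStar) :
    α.tensorAdjEquiv (α.tensorRegRep (A.maxHom B x)) =
      α.tensorBundle.fullRegRep (α.fromMax x) := by
  have hc₁ := continuous_starHom ((α.tensorAdjEquiv : α.tensorForm.Adj →⋆ₙₐ[ℂ]
    α.tensorBundle.AdjL2).comp (α.tensorRegRep.comp (A.maxHom B)))
  have hc₂ := continuous_starHom (α.tensorBundle.fullRegRep.comp α.fromMax)
  refine (A.maxNorm B).denseRange_toComplCStar.induction_on (p := fun x =>
    α.tensorAdjEquiv (α.tensorRegRep (A.maxHom B x)) =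
      α.tensorBundle.fullRegRep (α.fromMax x)) x (isClosed_eq hc₁ hc₂) fun f => ?_
  rw [FellBundle.maxHom, fromMax, FellBundle.liftMax_toComplCStar,
    FellBundle.liftMax_toComplCStar]
  refine (α.tensorAdjEquiv_tensorRegRep (A.ccToTensor B f)).trans ?_
  refine Eq.trans ?_ (α.tensorBundle.fullRegRep_toCStar (α.toComplCc f)).symm
  exact congrArg (fun f => α.tensorBundle.regRep (α.toComplCc f)) (A.tensorToCc_ccToTensor B f)

/-- R lifts through two surjections to C*(A ⊗_max B), and going around the diagram the other way
ends in the reduced algebra. -/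
theorem tensorAdjEquiv_mem (R : α.redTensor) :
    α.tensorAdjEquiv R ∈ α.tensorBundle.CStarRed := by
  obtain ⟨y, rfl⟩ := α.tensorRedHom_surjective R
  obtain ⟨x, rfl⟩ := A.maxHom_surjective B y
  exact (α.tensorAdjEquiv_comp x).symm ▸ α.tensorBundle.fullRegRep_mem _

/-- The *-homomorphism `C*_r(A) ⊗_α̂ C*_r(B) → C*_r(A ⊗_α B)`. -/
def redTensorHom : α.redTensor →⋆ₙₐ[ℂ] α.tensorBundle.CStarRed :=
  NonUnitalStarAlgHom.codRestrict ((α.tensorAdjEquiv : α.tensorForm.Adj →⋆ₙₐ[ℂ]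
    α.tensorBundle.AdjL2).comp (NonUnitalStarSubalgebraClass.subtype α.redTensor))
    α.tensorBundle.CStarRed α.tensorAdjEquiv_mem

theorem redTensorHom_tensorRedHom (x : (A.maxNorm B).compl.CStar) :
    α.redTensorHom (α.tensorRedHom (A.maxHom B x)) = α.tensorBundle.redHom (α.fromMax x) :=
  Subtype.ext (α.tensorAdjEquiv_comp x)

/-- Injectivity is inherited from conjugation by a unitary. Surjectivity follows from the diagram,
since Λ_α ∘ Θ_α is surjective. -/
theorem redTensorHom_bijective : Function.Bijective α.redTensorHom := by
  refine ⟨fun R R' h => Subtype.ext (α.tensorAdjEquiv.injective (congrArg Subtype.val h)),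
    fun T => ?_⟩
  obtain ⟨y, rfl⟩ := α.tensorBundle.redHom_surjective T
  obtain ⟨x, rfl⟩ := α.fromMax_surjective y
  exact ⟨_, α.redTensorHom_tensorRedHom x⟩

/-- The *-isomorphism `C*_r(A) ⊗_α̂ C*_r(B) ≅ C*_r(A ⊗_α B)`. -/
def redTensorEquiv : α.redTensor ≃⋆ₐ[ℂ] α.tensorBundle.CStarRed :=
  StarAlgEquiv.ofBijective α.redTensorHom α.redTensorHom_bijective

theorem redTensorEquiv_of_isTensor (t : G) (s : H) (a : A.fiber t) (b : B.fiber s)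
    (R : α.redTensor) (h : α.IsTensor (A.regRep (A.δ t a)) (B.regRep (B.δ s b)) R) :
    (α.redTensorEquiv R : α.tensorBundle.AdjL2) =
      α.tensorBundle.regRep (α.tensorBundle.δ (t, s) (α.tmul a b)) := by
  have h2 := α.isTensor_tensorRegRep (A.toCStar (A.δ t a)) (B.toCStar (B.δ s b))
  rw [A.fullRegRep_toCStar, B.fullRegRep_toCStar] at h2
  rw [← α.ccTensorCompl_δ t s a b, ← tensorAdjEquiv_tensorRegRep]
  exact congrArg α.tensorAdjEquiv (h.unique α h2)

end StarBundle.CStarNorm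

end

/-! ### The commutative diagram. -/

theorem mainTheorem2 {G : Type u₁} [Group G] {H : Type u₂} [Group H]
    (A : FellBundle.{u₁, v₁} G) (B : FellBundle.{u₂, v₂} H) :
    -- The C*-norm `max` on `A ⊙ B` that extends the maximal C*-norm on `A_e ⊙ B_e`.
    ∃ mx : (A.tensor B).CStarNorm,
      (∀ x : A.UnitFiber ⊗[ℂ] B.UnitFiber,
        mx.nrm (1, 1) x = maxTensorNorm A.UnitFiber B.UnitFiber x) ∧
    ∀ α : (A.tensor B).CStarNorm,
    ∃ (Θ : mx.tensorBundle.CStar →⋆ₙₐ[ℂ] α.tensorBundle.CStar)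
      (Λα : α.tensorBundle.CStar →⋆ₙₐ[ℂ] α.tensorBundle.CStarRed)
      (Φ : mx.tensorBundle.CStar ≃⋆ₐ[ℂ] MaxTensor A.CStar B.CStar)
      (ΛA : A.CStar →⋆ₙₐ[ℂ] A.CStarRed)
      (ΛB : B.CStar →⋆ₙₐ[ℂ] B.CStarRed)
      (ΛAB : MaxTensor A.CStar B.CStar →⋆ₙₐ[ℂ] α.redTensor)
      (Ψ : α.redTensor ≃⋆ₐ[ℂ] α.tensorBundle.CStarRed),
      -- `Θ` is the identity on `C_c(A ⊙ B)`.
      (∀ (r : G × H) (x : (A.tensor B).fiber r),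
        Θ (mx.tensorBundle.toCStar (mx.tensorBundle.δ r (mx.toCompl x))) =
          α.tensorBundle.toCStar (α.tensorBundle.δ r (α.toCompl x))) ∧
      -- `Λα`, `ΛA` and `ΛB` are the left regular representations.
      (∀ f : α.tensorBundle.Cc,
        (Λα (α.tensorBundle.toCStar f) : α.tensorBundle.AdjL2) = α.tensorBundle.regRep f) ∧
      (∀ f : A.Cc, (ΛA (A.toCStar f) : A.AdjL2) = A.regRep f) ∧
      (∀ f : B.Cc, (ΛB (B.toCStar f) : B.AdjL2) = B.regRep f) ∧
      -- `Φ` maps `a ⊗ b ∈ A_t ⊗_max B_s` to `a ⊗ b ∈ C*(A) ⊗_max C*(B)`.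
      (∀ (t : G) (s : H) (a : A.fiber t) (b : B.fiber s),
        Φ (mx.tensorBundle.toCStar (mx.tensorBundle.δ (t, s) (mx.tmul a b))) =
          (maxTensorNorm A.CStar B.CStar).of
            (A.toCStar (A.δ t a) ⊗ₜ[ℂ] B.toCStar (B.δ s b))) ∧
      -- `ΛAB` maps `x ⊗ y` to the operator `ΛA(x) ⊗ ΛB(y)`.
      (∀ (x : A.CStar) (y : B.CStar),
        α.IsTensor (ΛA x) (ΛB y) (ΛAB ((maxTensorNorm A.CStar B.CStar).of (x ⊗ₜ[ℂ] y)))) ∧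
      -- `Ψ` maps the operator `Λ(a) ⊗ Λ(b)` to `Λ(a ⊗ b)`.
      (∀ (t : G) (s : H) (a : A.fiber t) (b : B.fiber s) (R : α.redTensor),
        α.IsTensor (A.regRep (A.δ t a)) (B.regRep (B.δ s b)) R →
        (Ψ R : α.tensorBundle.AdjL2) =
          α.tensorBundle.regRep (α.tensorBundle.δ (t, s) (α.tmul a b))) ∧
      -- The arrows of the diagram that are not isomorphisms are surjective.
      Function.Surjective Θ ∧ Function.Surjective Λα ∧ Function.Surjective ΛA ∧
      Function.Surjective ΛB ∧ Function.Surjective ΛAB ∧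
      -- The diagram commutes.
      ∀ x : mx.tensorBundle.CStar, Λα (Θ x) = Ψ (ΛAB (Φ x)) := by
  refine ⟨A.maxNorm B, A.maxNorm_one B, fun α => ⟨α.fromMax, α.tensorBundle.redHom, A.maxEquiv B,
    A.redHom, B.redHom, α.tensorRedHom, α.redTensorEquiv, α.fromMax_δ,
    α.tensorBundle.redHom_toCStar, A.redHom_toCStar, B.redHom_toCStar, A.maxHom_δ B,
    α.isTensor_tensorRegRep, α.redTensorEquiv_of_isTensor, α.fromMax_surjective,
    α.tensorBundle.redHom_surjective, A.redHom_surjective, B.redHom_surjective,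
    α.tensorRedHom_surjective, fun x => (α.redTensorHom_tensorRedHom x).symm⟩⟩
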